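/- Let $n\ge 1$, $\sigma>0$, $\mu\in\mathbb R^n$, and $y=\mu+\varepsilon$ with $\varepsilon\sim N(0,\sigma^2 I_n)$. Let $\hat\mu:\mathbb R^n\to\mathbb R^n$ be weakly differentiable (its components and their weak partial derivatives are locally integrable), let $\nabla\hat\mu$ be the $n\times n$ matrix whose $j$-th column is the gradient of $\hat\mu_j$, let $\operatorname{div}\hat\mu=\operatorname{trace}\nabla\hat\mu$, and write $\hat\mu,\nabla\hat\mu$ for $\hat\mu(y),\nabla\hat\mu(y)$. Put $$\mathrm{SURE}=\|y-\hat\mu\|^2+2\sigma^2\operatorname{div}\hat\mu-\sigma^2n,\qquad R_{\rm sure}=\mathbb E\big[(\mathrm{SURE}-\|\hat\mu-\mu\|^2)^2\big],$$ $$\hat R_{\rm sure}=4\sigma^2\|y-\hat\mu\|^2+4\sigma^4\operatorname{trace}[(\nabla\hat\mu)^2]-2\sigma^4n,\qquad \hat R'_{\rm sure}=2\sigma^2\big(\|y-\hat\mu\|^2+\mathrm{SURE}\big).$$ (i) If $\mathbb E\sum_{i=1}^n|(\nabla\hat\mu)_{ii}|<\infty$, then $\mathbb E[\hat R'_{\rm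 sure}]\ge\sigma^4n$ (the negative part of $\hat R'_{\rm sure}$ is integrable, and the expectation may be $+\infty$). (ii) If $\hat\mu$ is $1$-Lipschitz, then the expectations below are finite and $$\mathbb E\Big[\Big((\mathrm{SURE})_+^{1/2}-\mathbb E[\|\hat\mu-\mu\|^2]^{1/2}\Big)^4\Big]^{1/4}\le R_{\rm sure}^{1/4}+3\sigma .$$ (iii) If $\hat\mu$ is $1$-Lipschitz and $\nabla\hat\mu$ is almost everywhere symmetric positive semi-definite, then $\hat R_{\rm sure}\le\hat R'_{\rm sure}$ almost surely, $\mathrm{SURE}$ is square integrable, and $$\operatorname{Var}(\mathrm{SURE})=\mathbb E\Big[\big(\mathrm{SURE}-\mathbb E[\|\hat\mu-\mu\|^2]\big)^2\Big]\le R_{\rm sure}+\sigma^4n .$$ (iv) If almost surely $\hat R'_{\rm sure}\ge\hat R_{\rm sure}$ and the operator norm of $I_n-\nabla\hat\mu$ is at most $1$ (when $\nabla\hat\mu$ is symmetric this means $\max_{\|u\|=1}|u^\top(I_n-\nabla\hat\mu)u|\le1$), then $\hat R'_{\rm sure}$ is square integrable and $$\mathbb E\bigg[\bigg(\frac{\hat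 R'_{\rm sure}}{\mathbb E[\hat R'_{\rm sure}]}-1\bigg)^2\bigg]\le\frac{16\sigma^4}{\mathbb E[\hat R'_{\rm sure}]}\le\frac{16}{n}.$$ -/

import Mathlib

open MeasureTheory ProbabilityTheory
open scoped ENNReal

/-- `g` is a weak (distributional) partial derivative of `f : ℝⁿ → ℝ` in the `i`-th coordinate:
both are locally integrable and `∫ f ∂ᵢφ = - ∫ g φ` for every smooth compactly supported `φ`. -/
structure IsWeakPartialDeriv {n : ℕ} (i : Fin n) (f g : EuclideanSpace ℝ (Fin n) → ℝ) :
    Prop where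
  locallyIntegrable : LocallyIntegrable f volume
  locallyIntegrable_deriv : LocallyIntegrable g volume
  integral_eq : ∀ φ : EuclideanSpace ℝ (Fin n) → ℝ, ContDiff ℝ (⊤ : ℕ∞) φ → HasCompactSupport φ →
    ∫ x, f x * fderiv ℝ φ x (EuclideanSpace.single i 1) = - ∫ x, g x * φ x

/-- `G` is (a version of) the weak gradient `∇f` of `f : ℝⁿ → ℝⁿ`: the `j`-th column of `G` is the
weak gradient of the `j`-th component, so `G x i j = (∂/∂xᵢ) fⱼ (x)`.  In particular `f` is weakly
differentiable. -/
def IsWeakGradient {n : ℕ} (f : EuclideanSpace ℝ (Fin n) → EuclideanSpace ℝ (Fin n))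
    (G : EuclideanSpace ℝ (Fin n) → Matrix (Fin n) (Fin n) ℝ) : Prop :=
  ∀ i j, IsWeakPartialDeriv i (fun x => f x j) (fun x => G x i j)

/-- `SURE = ‖y - μ̂‖² + 2 σ² div μ̂ - σ² n`, where `G = ∇μ̂` and `div μ̂ = trace ∇μ̂`. -/
noncomputable def sureStat {n : ℕ} (σ : ℝ)
    (muhat : EuclideanSpace ℝ (Fin n) → EuclideanSpace ℝ (Fin n))
    (G : EuclideanSpace ℝ (Fin n) → Matrix (Fin n) (Fin n) ℝ)
    (y : EuclideanSpace ℝ (Fin n)) : ℝ :=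
  ‖y - muhat y‖ ^ 2 + 2 * σ ^ 2 * (G y).trace - σ ^ 2 * n

/-- SURE for SURE: `R̂ = 4 σ² ‖y - μ̂‖² + 4 σ⁴ trace ((∇μ̂)²) - 2 σ⁴ n`. -/
noncomputable def sureForSure {n : ℕ} (σ : ℝ)
    (muhat : EuclideanSpace ℝ (Fin n) → EuclideanSpace ℝ (Fin n))
    (G : EuclideanSpace ℝ (Fin n) → Matrix (Fin n) (Fin n) ℝ)
    (y : EuclideanSpace ℝ (Fin n)) : ℝ :=
  4 * σ ^ 2 * ‖y - muhat y‖ ^ 2 + 4 * σ ^ 4 * (G y ^ 2).trace - 2 * σ ^ 4 * n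

/-- The modified statistic `R̂' = 2 σ² (‖y - μ̂‖² + SURE)`. -/
noncomputable def modifiedSureForSure {n : ℕ} (σ : ℝ)
    (muhat : EuclideanSpace ℝ (Fin n) → EuclideanSpace ℝ (Fin n))
    (G : EuclideanSpace ℝ (Fin n) → Matrix (Fin n) (Fin n) ℝ)
    (y : EuclideanSpace ℝ (Fin n)) : ℝ :=
  2 * σ ^ 2 * (‖y - muhat y‖ ^ 2 + sureStat σ muhat G y)

/-- The mean squared risk `R = E[(SURE - ‖μ̂ - μ‖²)²]` of SURE as an estimator of the squared
loss; `y` is the observation, a random vector on `(Ω, P)`. -/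
noncomputable def sureRisk {n : ℕ} {Ω : Type*} [MeasurableSpace Ω] (P : Measure Ω) (σ : ℝ)
    (μ : EuclideanSpace ℝ (Fin n))
    (muhat : EuclideanSpace ℝ (Fin n) → EuclideanSpace ℝ (Fin n))
    (G : EuclideanSpace ℝ (Fin n) → Matrix (Fin n) (Fin n) ℝ)
    (y : Ω → EuclideanSpace ℝ (Fin n)) : ℝ :=
  ∫ ω, (sureStat σ muhat G (y ω) - ‖muhat (y ω) - μ‖ ^ 2) ^ 2 ∂P

/-- The extended expectation `E[X⁺] - E[X⁻]`; meaningful as soon as `E[X⁻] < ∞`, and then it takes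
values in `(-∞, +∞]`. -/
noncomputable def extExpectation {Ω : Type*} [MeasurableSpace Ω] (P : Measure Ω)
    (X : Ω → ℝ) : EReal :=
  ((∫⁻ ω, ENNReal.ofReal (X ω) ∂P : ℝ≥0∞) : EReal) -
    ((∫⁻ ω, ENNReal.ofReal (-(X ω)) ∂P : ℝ≥0∞) : EReal)

/-! Everything is expressed through the residual `h x = μ + x - muhat (μ + x)`, where `x` stands for
the noise. Its weak derivative is `D = 1 - J`, with `J` the Jacobian of `muhat` at `μ + x`. Then
`SURE = ‖h‖² - 2σ² tr D + σ² n`, the squared loss is `‖x - h‖²`, and `R̂' = 2σ² T` with `T = 2‖h‖² -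
2σ² tr D + σ² n`.

Two Gaussian tools carry the proof. With `δK = ⟪x, K⟫ - σ² div K`, Stein's identity gives `E[F δK] =
σ² E[DF(K)]`, hence `E[δK] = 0` and, applied twice, `E[(δK)²] = σ² E‖K‖² + σ⁴ E tr(DK ∘ DK)`. The
Poincaré inequality bounds `Var A` by `σ² E‖∇A‖²`. Expanding the square of `A + δK` and combining
the two gives `integral_add_gaussianDivergence_sq_sub_le`: `E[(A + δK)²] - (E A)² ≤ E[(δK)²] + σ²
E[‖∇A‖² + 2 DA(K)]`. Parts (iii) and (iv) are two choices of `A` and `K`.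

For (iv), `T = A + δ(2h)` with `A = 2‖h‖² - 2⟪x, h⟫ + σ² n`. Here `∇A + K = 2 Dᵀ(2h - x)`, and `‖D‖
≤ 1` turns the right-hand side into exactly `8σ² E[T]`; dividing by `(E T)²` gives the relative
variance. For (iii), `SURE = ‖x - h‖² + δ(2h - x)`, so the divergence is the error of SURE and
contributes the risk, while the remaining gradient terms are at most `‖x‖²` because `0 ≤ J² ≤ J ≤ 1`
(`sureVarianceBound_le_norm_sq`).

For (ii), the loss `L = ‖muhat - μ‖` is a `1`-Lipschitz function of the noise. Since `|√S₊ - L|⁴ ≤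
(S - L²)²`, Minkowski's inequality in `L⁴` leaves only the deviation of `L` from its root mean
square, which the Poincaré inequality bounds. For (i), Stein's identity replaces the trace by `⟪x,
h⟫`, and `‖2h - x‖² ≥ 0` finishes.

These computations use two derivatives, whereas `muhat` is only weakly differentiable. In (iii) and
(iv) they are done for mollified residuals, which keep the bound on the derivative and have
temperate growth, and the inequalities pass to the limit by dominated convergence
(`IsTame.tendsto_integral_mollify`). Part (i) instead uses Stein's identity directly for weak
derivatives. -/

/-- The centred isotropic Gaussian measure on `ℝⁿ` with covariance `σ² I`. -/
noncomputable abbrev isoGaussian (n : ℕ) (σ : ℝ) : Measure (EuclideanSpace ℝ (Fin n)) :=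
  multivariateGaussian 0 (σ ^ 2 • (1 : Matrix (Fin n) (Fin n) ℝ))

/-- The Lebesgue density of `isoGaussian n σ`. -/
noncomputable def isoGaussianDensity (n : ℕ) (σ : ℝ) (x : EuclideanSpace ℝ (Fin n)) : ℝ :=
  (∫ v : EuclideanSpace ℝ (Fin n), Real.exp (-(1 / (2 * σ ^ 2)) * ‖v‖ ^ 2))⁻¹ *
    Real.exp (-(1 / (2 * σ ^ 2)) * ‖x‖ ^ 2)

/-! ### The Gaussian density and Stein's identity for weak derivatives -/

section density

variable {n : ℕ} {σ : ℝ}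

lemma integral_exp_neg_norm_sq_pos (hσ : 0 < σ) :
    0 < ∫ v : EuclideanSpace ℝ (Fin n), Real.exp (-(1 / (2 * σ ^ 2)) * ‖v‖ ^ 2) := by
  rw [GaussianFourier.integral_rexp_neg_mul_sq_norm (by positivity)]
  positivity

lemma isoGaussianDensity_pos (hσ : 0 < σ) (x : EuclideanSpace ℝ (Fin n)) :
    0 < isoGaussianDensity n σ x :=
  mul_pos (inv_pos.2 (integral_exp_neg_norm_sq_pos hσ)) (Real.exp_pos _)

lemma contDiff_isoGaussianDensity : ContDiff ℝ (⊤ : ℕ∞) (isoGaussianDensity n σ) := by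
  unfold isoGaussianDensity
  exact contDiff_const.mul (Real.contDiff_exp.comp (contDiff_const.mul (contDiff_norm_sq ℝ)))

lemma continuous_isoGaussianDensity : Continuous (isoGaussianDensity n σ) :=
  contDiff_isoGaussianDensity.continuous

lemma fderiv_isoGaussianDensity (hσ : 0 < σ) (x v : EuclideanSpace ℝ (Fin n)) :
    fderiv ℝ (isoGaussianDensity n σ) x v
      = -(inner ℝ x v / σ ^ 2) * isoGaussianDensity n σ x := by
  have h1 : HasFDerivAt (fun x : EuclideanSpace ℝ (Fin n) => ‖x‖ ^ 2) (2 • innerSL ℝ x) x :=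
    (hasStrictFDerivAt_norm_sq x).hasFDerivAt
  have h2 := ((h1.const_mul (-(1 / (2 * σ ^ 2)))).exp).const_mul
    (∫ v : EuclideanSpace ℝ (Fin n), Real.exp (-(1 / (2 * σ ^ 2)) * ‖v‖ ^ 2))⁻¹
  have h3 : HasFDerivAt (isoGaussianDensity n σ) _ x := h2
  rw [h3.fderiv]
  simp [isoGaussianDensity]
  field_simp

lemma integrable_isoGaussianDensity (hσ : 0 < σ) :
    Integrable (isoGaussianDensity n σ) := by
  have h := GaussianFourier.integrable_cexp_neg_mul_sq_norm_add
    (V := EuclideanSpace ℝ (Fin n)) (b := ((1 / (2 * σ ^ 2) : ℝ) : ℂ))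
    (by rw [Complex.ofReal_re]; positivity) 0 0
  have h' := h.norm
  refine Integrable.const_mul ?_ _
  refine h'.congr (.of_forall fun x => ?_)
  simp only [zero_mul, add_zero, Complex.norm_exp]
  congr 1
  rw [← Complex.ofReal_neg, ← Complex.ofReal_pow, ← Complex.ofReal_mul, Complex.ofReal_re]

lemma posSemidef_sq_smul_one : (σ ^ 2 • (1 : Matrix (Fin n) (Fin n) ℝ)).PosSemidef :=
  Matrix.PosSemidef.one.smul (sq_nonneg σ)

/-- Weak derivatives are tested against Lebesgue measure, so Stein's identity needs the density.
Both measures have characteristic function `exp(-σ²‖t‖²/2)`. The normalising constant stays an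
unevaluated integral, which cancels. -/
lemma isoGaussian_eq_withDensity (hσ : 0 < σ) :
    isoGaussian n σ
      = volume.withDensity (fun x => ENNReal.ofReal (isoGaussianDensity n σ x)) := by
  have hfin : IsFiniteMeasure ((volume : Measure (EuclideanSpace ℝ (Fin n))).withDensity
      (fun x => ENNReal.ofReal (isoGaussianDensity n σ x))) :=
    isFiniteMeasure_withDensity_ofReal (integrable_isoGaussianDensity hσ).2
  refine Measure.ext_of_charFun ?_
  ext t
  rw [charFun_multivariateGaussian posSemidef_sq_smul_one, charFun_apply,
    integral_withDensity_eq_integral_toReal_smul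
      (continuous_isoGaussianDensity.measurable.ennreal_ofReal) (by simp)]
  have hb : 0 < (((1 / (2 * σ ^ 2) : ℝ) : ℂ)).re := by rw [Complex.ofReal_re]; positivity
  have e0 := GaussianFourier.integral_cexp_neg_mul_sq_norm (V := EuclideanSpace ℝ (Fin n)) hb
  have e1 := GaussianFourier.integral_cexp_neg_mul_sq_norm_add hb Complex.I t
  rw [← e0] at e1
  have e2 : ∫ v : EuclideanSpace ℝ (Fin n), Complex.exp (-((1 / (2 * σ ^ 2) : ℝ) : ℂ) * ‖v‖ ^ 2)
      = ((∫ v : EuclideanSpace ℝ (Fin n), Real.exp (-(1 / (2 * σ ^ 2)) * ‖v‖ ^ 2) : ℝ) : ℂ) := by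
    rw [← integral_complex_ofReal]
    push_cast
    rfl
  set Z := ∫ v : EuclideanSpace ℝ (Fin n), Real.exp (-(1 / (2 * σ ^ 2)) * ‖v‖ ^ 2) with hZ
  have hZ0 : (Z : ℂ) ≠ 0 := by exact_mod_cast (integral_exp_neg_norm_sq_pos hσ).ne'
  have e3 : ∀ x : EuclideanSpace ℝ (Fin n),
      (ENNReal.ofReal (isoGaussianDensity n σ x)).toReal •
        Complex.exp (inner ℝ x t * Complex.I)
      = (Z : ℂ)⁻¹ * Complex.exp (-((1 / (2 * σ ^ 2) : ℝ) : ℂ) * ‖x‖ ^ 2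
        + Complex.I * inner ℝ t x) := by
    intro x
    rw [ENNReal.toReal_ofReal (isoGaussianDensity_pos hσ x).le, isoGaussianDensity, ← hZ,
      Complex.exp_add, real_inner_comm]
    simp only [Complex.real_smul]
    push_cast
    ring_nf
  simp_rw [e3]
  rw [integral_const_mul, e1, e2, ← mul_assoc, inv_mul_cancel₀ hZ0, one_mul]
  congr 1
  have e4 : (t.ofLp ⬝ᵥ (σ ^ 2 • (1 : Matrix (Fin n) (Fin n) ℝ)).mulVec t.ofLp : ℝ)
      = σ ^ 2 * ‖t‖ ^ 2 := by
    rw [Matrix.smul_mulVec, Matrix.one_mulVec, dotProduct_smul, EuclideanSpace.real_norm_sq_eq]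
    simp [dotProduct, sq]
  rw [e4]
  simp
  field_simp
  ring

lemma isoGaussian_absolutelyContinuous (hσ : 0 < σ) : isoGaussian n σ ≪ volume := by
  rw [isoGaussian_eq_withDensity hσ]
  exact withDensity_absolutelyContinuous _ _

lemma absolutelyContinuous_isoGaussian (hσ : 0 < σ) :
    (volume : Measure (EuclideanSpace ℝ (Fin n))) ≪ isoGaussian n σ := by
  rw [isoGaussian_eq_withDensity hσ]
  refine withDensity_absolutelyContinuous'
    (continuous_isoGaussianDensity.measurable.ennreal_ofReal).aemeasurable ?_
  refine .of_forall fun x => ?_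
  simpa using isoGaussianDensity_pos hσ x

lemma integral_isoGaussian (hσ : 0 < σ) (f : EuclideanSpace ℝ (Fin n) → ℝ) :
    ∫ x, f x ∂(isoGaussian n σ) = ∫ x, isoGaussianDensity n σ x * f x := by
  rw [isoGaussian_eq_withDensity hσ, integral_withDensity_eq_integral_toReal_smul
      (continuous_isoGaussianDensity.measurable.ennreal_ofReal) (by simp)]
  refine integral_congr_ae (.of_forall fun x => ?_)
  simp [(isoGaussianDensity_pos hσ x).le]

/-- Stein's identity for a function with an integrable weak partial derivative. -/
theorem IsWeakPartialDeriv.integral_mul_isoGaussian (hσ : 0 < σ) {i : Fin n}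
    {f g : EuclideanSpace ℝ (Fin n) → ℝ} (hfg : IsWeakPartialDeriv i f g)
    (hf : Integrable f (isoGaussian n σ)) (hxf : Integrable (fun x => x i * f x) (isoGaussian n σ))
    (hg : Integrable g (isoGaussian n σ)) :
    ∫ x, x i * f x ∂(isoGaussian n σ) = σ ^ 2 * ∫ x, g x ∂(isoGaussian n σ) := by
  set e : EuclideanSpace ℝ (Fin n) := EuclideanSpace.single i 1
  -- The density is not compactly supported, so the test function is a cutoff times the density. The
  -- cutoffs `c k x = χ (a k • x)` tend to `1` pointwise, and their derivatives are bounded by `a k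
  -- * M`, which tends to `0`.
  let χ : ContDiffBump (0 : EuclideanSpace ℝ (Fin n)) := ⟨1, 2, one_pos, one_lt_two⟩
  let a : ℕ → ℝ := fun k => 1 / ((k : ℝ) + 1)
  have ha : Filter.Tendsto a Filter.atTop (nhds 0) := tendsto_one_div_add_atTop_nhds_zero_nat
  have ha0 : ∀ k, 0 < a k := fun k => by positivity
  let c : ℕ → EuclideanSpace ℝ (Fin n) → ℝ := fun k x => χ (a k • x)
  have hχ : ContDiff ℝ (⊤ : ℕ∞) χ := χ.contDiff
  have hc : ∀ k, ContDiff ℝ (⊤ : ℕ∞) (c k) := fun k => hχ.comp (contDiff_const_smul (a k))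
  have hcs : ∀ k, HasCompactSupport (c k) := fun k =>
    χ.hasCompactSupport.comp_homeomorph (Homeomorph.smulOfNeZero (a k) (ha0 k).ne')
  have hdc : ∀ k x, fderiv ℝ (c k) x e = a k * fderiv ℝ χ (a k • x) e := by
    intro k x
    have h1 : HasFDerivAt (fun x : EuclideanSpace ℝ (Fin n) => a k • x)
        (a k • ContinuousLinearMap.id ℝ _) x := (hasFDerivAt_id x).const_smul (a k)
    have h2 := ((hχ.differentiable (by simp)) (a k • x)).hasFDerivAt.comp x h1
    have h3 : HasFDerivAt (c k) _ x := h2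
    rw [h3.fderiv]
    simp
  obtain ⟨M, hM⟩ : ∃ M, ∀ x, ‖fderiv ℝ χ x e‖ ≤ M := by
    have h1 : Continuous fun x => fderiv ℝ χ x e :=
      (hχ.continuous_fderiv (by simp)).clm_apply continuous_const
    have h2 : HasCompactSupport fun x => fderiv ℝ χ x e :=
      (χ.hasCompactSupport.fderiv ℝ).comp_left
        (g := fun L : EuclideanSpace ℝ (Fin n) →L[ℝ] ℝ => L e) (by simp)
    exact h1.bounded_above_of_compact_support h2
  -- Weak derivative identity for `c k` times the density: the derivative of the density produces
  -- the factor `-x i / σ²`.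
  have key : ∀ k, ∫ x, (f x * (a k * fderiv ℝ χ (a k • x) e)
      - c k x * (x i * f x) / σ ^ 2) ∂(isoGaussian n σ)
      = - ∫ x, g x * c k x ∂(isoGaussian n σ) := by
    intro k
    have h := hfg.integral_eq (fun x => c k x * isoGaussianDensity n σ x)
      ((hc k).mul contDiff_isoGaussianDensity) (hcs k).mul_right
    rw [integral_isoGaussian hσ, integral_isoGaussian hσ]
    convert h using 1
    · refine integral_congr_ae (.of_forall fun x => ?_)
      have h1 := fderiv_fun_mul (𝕜 := ℝ) (((hc k).differentiable (by simp)) x)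
        ((contDiff_isoGaussianDensity (n := n) (σ := σ)).differentiable (by simp) x)
      beta_reduce
      rw [h1]
      simp only [add_apply, smul_apply, smul_eq_mul, fderiv_isoGaussianDensity hσ]
      have h2 : inner ℝ x (EuclideanSpace.single i (1 : ℝ)) = x i := by
        simp [EuclideanSpace.inner_single_right]
      rw [hdc, h2]
      ring
    · congr 1
      refine integral_congr_ae (.of_forall fun x => ?_)
      ring
  have hcle : ∀ k x, ‖c k x‖ ≤ 1 := fun k x => by
    rw [Real.norm_eq_abs, abs_of_nonneg χ.nonneg]; exact χ.le_one
  have hclim : ∀ x, Filter.Tendsto (fun k => c k x) Filter.atTop (nhds 1) := by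
    intro x
    have h1 : Filter.Tendsto (fun k => a k • x) Filter.atTop (nhds 0) := by
      simpa using ha.smul_const x
    have h2 := (χ.continuous.tendsto 0).comp h1
    rwa [χ.one_of_mem_closedBall (by simp [χ])] at h2
  have ale : ∀ k, |a k| ≤ 1 := fun k => by
    rw [abs_of_pos (ha0 k)]
    exact (div_le_one (by positivity)).2 (by linarith [k.cast_nonneg (α := ℝ)])
  have lim1 : Filter.Tendsto (fun k => ∫ x, (f x * (a k * fderiv ℝ χ (a k • x) e)
      - c k x * (x i * f x) / σ ^ 2) ∂(isoGaussian n σ)) Filter.atTop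
      (nhds (∫ x, - (x i * f x) / σ ^ 2 ∂(isoGaussian n σ))) := by
    refine tendsto_integral_of_dominated_convergence
      (fun x => ‖f x‖ * M + ‖x i * f x‖ / σ ^ 2) (fun k => ?_)
      ((hf.norm.mul_const M).add (hxf.norm.div_const _)) (fun k => .of_forall fun x => ?_)
      (.of_forall fun x => ?_)
    · refine (hf.1.mul (Continuous.aestronglyMeasurable ?_)).sub ?_
      · exact continuous_const.mul (((hχ.continuous_fderiv (by simp)).comp
          (continuous_const_smul _)).clm_apply continuous_const)
      · simp_rw [div_eq_mul_inv]
        exact ((hc k).continuous.aestronglyMeasurable.mul hxf.1).mul_const _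
    · refine (norm_sub_le _ _).trans (add_le_add ?_ ?_)
      · rw [norm_mul, norm_mul]
        refine mul_le_mul_of_nonneg_left ?_ (norm_nonneg _)
        calc _ ≤ 1 * M := mul_le_mul (ale k) (hM _) (norm_nonneg _) zero_le_one
          _ = M := one_mul M
      · rw [norm_div, norm_mul, Real.norm_of_nonneg (sq_nonneg σ)]
        refine div_le_div_of_nonneg_right ?_ (sq_nonneg σ)
        exact (mul_le_mul_of_nonneg_right (hcle k x) (norm_nonneg _)).trans_eq (one_mul _)
    · have h1 : Filter.Tendsto (fun k => a k * fderiv ℝ χ (a k • x) e) Filter.atTop (nhds 0) := by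
        refine squeeze_zero_norm (a := fun k => a k * M) (fun k => ?_) (by simpa using ha.mul_const M)
        rw [norm_mul, Real.norm_of_nonneg (ha0 k).le]
        exact mul_le_mul_of_nonneg_left (hM _) (ha0 k).le
      have h2 := (h1.const_mul (f x)).sub (((hclim x).mul_const (x i * f x)).div_const (σ ^ 2))
      simpa [neg_div] using h2
  have lim2 : Filter.Tendsto (fun k => - ∫ x, g x * c k x ∂(isoGaussian n σ)) Filter.atTop
      (nhds (- ∫ x, g x ∂(isoGaussian n σ))) := by
    refine (tendsto_integral_of_dominated_convergence (fun x => ‖g x‖) (fun k => ?_) hg.norm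
      (fun k => .of_forall fun x => ?_) (.of_forall fun x => ?_)).neg
    · exact hg.1.mul (hc k).continuous.aestronglyMeasurable
    · rw [norm_mul]
      exact (mul_le_mul_of_nonneg_left (hcle k x) (norm_nonneg _)).trans_eq (mul_one _)
    · simpa using (hclim x).const_mul (g x)
  simp_rw [key] at lim1
  have h := tendsto_nhds_unique lim1 lim2
  rw [integral_div, integral_neg] at h
  have : σ ^ 2 ≠ 0 := by positivity
  field_simp at h
  linarith

end density

/-! ### Closure properties of maps of temperate growth -/

namespace Function.HasTemperateGrowth

variable {E F G : Type*} [NormedAddCommGroup E] [NormedSpace ℝ E] [NormedAddCommGroup F]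
  [NormedSpace ℝ F] [NormedAddCommGroup G] [NormedSpace ℝ G]

lemma fderiv {f : E → F} (hf : f.HasTemperateGrowth) : (fderiv ℝ f).HasTemperateGrowth := by
  refine ⟨hf.1.fderiv_right (by simp), fun n => ?_⟩
  obtain ⟨k, C, h⟩ := hf.2 (n + 1)
  refine ⟨k, C, fun x => ?_⟩
  simpa [norm_iteratedFDeriv_fderiv] using h x

lemma clm_apply {f : E → F →L[ℝ] G} {g : E → F} (hf : f.HasTemperateGrowth)
    (hg : g.HasTemperateGrowth) : (fun x => f x (g x)).HasTemperateGrowth :=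
  (ContinuousLinearMap.id ℝ (F →L[ℝ] G)).bilinear_hasTemperateGrowth hf hg

lemma clm_comp_left (L : F →L[ℝ] G) {f : E → F} (hf : f.HasTemperateGrowth) :
    (fun x => L (f x)).HasTemperateGrowth :=
  L.hasTemperateGrowth.comp hf

lemma fst {f : E → F × G} (hf : f.HasTemperateGrowth) :
    (fun x => (f x).1).HasTemperateGrowth :=
  clm_comp_left (ContinuousLinearMap.fst ℝ F G) hf

lemma snd {f : E → F × G} (hf : f.HasTemperateGrowth) :
    (fun x => (f x).2).HasTemperateGrowth :=
  clm_comp_left (ContinuousLinearMap.snd ℝ F G) hf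

lemma inner {H : Type*} [NormedAddCommGroup H] [InnerProductSpace ℝ H] {f g : E → H}
    (hf : f.HasTemperateGrowth) (hg : g.HasTemperateGrowth) :
    (fun x => inner ℝ (f x) (g x)).HasTemperateGrowth :=
  (innerSL ℝ (E := H)).bilinear_hasTemperateGrowth hf hg

lemma norm_le {f : E → F} (hf : f.HasTemperateGrowth) :
    ∃ (k : ℕ) (C : ℝ), 0 ≤ C ∧ ∀ x, ‖f x‖ ≤ C * (1 + ‖x‖) ^ k := by
  obtain ⟨k, C, hC, h⟩ := hf.norm_iteratedFDeriv_le_uniform 0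
  exact ⟨k, C, hC, fun x => by simpa using h 0 le_rfl x⟩

end Function.HasTemperateGrowth

/-! ### Gaussian integrability under polynomial growth -/

namespace ProbabilityTheory.IsGaussian

variable {E F : Type*} [NormedAddCommGroup E] [NormedSpace ℝ E] [NormedAddCommGroup F]
  [MeasurableSpace E] [BorelSpace E] [CompleteSpace E] [SecondCountableTopology E]
  (ν : Measure E) [IsGaussian ν]

lemma integrable_one_add_norm_pow (C : ℝ) (k : ℕ) : Integrable (fun x => C * (1 + ‖x‖) ^ k) ν := by
  have h0 : MemLp (fun x : E => ‖x‖) k ν := (memLp_id ν k (by simp)).norm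
  have hc : MemLp (fun _ : E => (1 : ℝ)) k ν := memLp_const 1
  have h1 : MemLp (fun x : E => 1 + ‖x‖) k ν := hc.add h0
  have h2 : Integrable (fun x : E => ‖(1 + ‖x‖)‖ ^ k) ν := h1.integrable_norm_pow'
  have h3 : ∀ x : E, ‖(1 + ‖x‖)‖ ^ k = (1 + ‖x‖) ^ k := fun x => by
    rw [Real.norm_of_nonneg (by positivity)]
  simp_rw [h3] at h2
  exact h2.const_mul C

lemma integrable_of_norm_le {f : E → F} (hf : AEStronglyMeasurable f ν) {C : ℝ} {k : ℕ}
    (h : ∀ᵐ x ∂ν, ‖f x‖ ≤ C * (1 + ‖x‖) ^ k) : Integrable f ν :=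
  (integrable_one_add_norm_pow ν C k).mono' hf h

lemma integrable_of_hasTemperateGrowth [NormedSpace ℝ F] {f : E → F}
    (hf : f.HasTemperateGrowth) : Integrable f ν := by
  obtain ⟨k, C, -, h⟩ := hf.norm_le
  exact integrable_of_norm_le ν hf.1.continuous.aestronglyMeasurable (.of_forall h)

end ProbabilityTheory.IsGaussian

/-! ### Stein's identity for smooth vector fields -/

section stein

variable {n : ℕ} {σ : ℝ}

lemma ContDiff.isWeakPartialDeriv {F : EuclideanSpace ℝ (Fin n) → ℝ}
    (hF : ContDiff ℝ 1 F) (i : Fin n) :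
    IsWeakPartialDeriv i F (fun x => fderiv ℝ F x (EuclideanSpace.single i 1)) where
  locallyIntegrable := hF.continuous.locallyIntegrable
  locallyIntegrable_deriv :=
    ((hF.continuous_fderiv one_ne_zero).clm_apply continuous_const).locallyIntegrable
  integral_eq := by
    intro φ hφ hφc
    have hφ' : Continuous fun x => fderiv ℝ φ x (EuclideanSpace.single i 1) :=
      (hφ.continuous_fderiv (by simp)).clm_apply continuous_const
    have hφ'c : HasCompactSupport fun x => fderiv ℝ φ x (EuclideanSpace.single i 1) :=
      (hφc.fderiv ℝ).comp_left
        (g := fun L : EuclideanSpace ℝ (Fin n) →L[ℝ] ℝ => L (EuclideanSpace.single i 1)) (by simp)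
    refine integral_mul_fderiv_eq_neg_fderiv_mul_of_integrable ?_ ?_ ?_
      (fun x _ => hF.differentiable one_ne_zero x) (fun x _ => hφ.differentiable (by simp) x)
    · exact (((hF.continuous_fderiv one_ne_zero).clm_apply continuous_const).mul
        hφ.continuous).integrable_of_hasCompactSupport hφc.mul_left
    · exact (hF.continuous.mul hφ').integrable_of_hasCompactSupport hφ'c.mul_left
    · exact (hF.continuous.mul hφ.continuous).integrable_of_hasCompactSupport hφc.mul_left

/-- The trace of an endomorphism of `ℝⁿ`, as a continuous linear functional. -/
noncomputable def traceCLM (n : ℕ) :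
    (EuclideanSpace ℝ (Fin n) →L[ℝ] EuclideanSpace ℝ (Fin n)) →L[ℝ] ℝ :=
  ∑ i, (EuclideanSpace.proj i : EuclideanSpace ℝ (Fin n) →L[ℝ] ℝ) ∘L
    ContinuousLinearMap.apply ℝ (EuclideanSpace ℝ (Fin n)) (EuclideanSpace.single i (1 : ℝ))

lemma traceCLM_apply (A : EuclideanSpace ℝ (Fin n) →L[ℝ] EuclideanSpace ℝ (Fin n)) :
    traceCLM n A = ∑ i, A (EuclideanSpace.single i 1) i := by
  simp [traceCLM]

lemma sum_smul_single (x : EuclideanSpace ℝ (Fin n)) :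
    ∑ i, x i • EuclideanSpace.single i (1 : ℝ) = x := by
  simpa using (EuclideanSpace.basisFun (Fin n) ℝ).sum_repr x

lemma inner_eq_sum (x y : EuclideanSpace ℝ (Fin n)) : inner ℝ x y = ∑ i, x i * y i := by
  simp [PiLp.inner_apply, mul_comm]

/-- Stein's identity for vector fields of temperate growth. -/
theorem integral_inner_isoGaussian (hσ : 0 < σ)
    {K : EuclideanSpace ℝ (Fin n) → EuclideanSpace ℝ (Fin n)} (hK : K.HasTemperateGrowth) :
    ∫ x, inner ℝ x (K x) ∂(isoGaussian n σ)
      = σ ^ 2 * ∫ x, traceCLM n (fderiv ℝ K x) ∂(isoGaussian n σ) := by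
  have hi : ∀ i, Function.HasTemperateGrowth fun x => K x i := fun i =>
    .clm_comp_left (EuclideanSpace.proj i) hK
  have hxi : ∀ i, Function.HasTemperateGrowth fun x : EuclideanSpace ℝ (Fin n) => x i := fun i =>
    .clm_comp_left (EuclideanSpace.proj i) .id'
  have hd : ∀ i x, fderiv ℝ K x (EuclideanSpace.single i 1) i
      = fderiv ℝ (fun x => K x i) x (EuclideanSpace.single i 1) := by
    intro i x
    have h1 := (EuclideanSpace.proj i : EuclideanSpace ℝ (Fin n) →L[ℝ] ℝ).hasFDerivAt.comp x
      ((hK.1.differentiable (by simp)) x).hasFDerivAt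
    have h2 : HasFDerivAt (fun x => K x i) _ x := h1
    rw [h2.fderiv]
    rfl
  have hdi : ∀ i, Function.HasTemperateGrowth
      fun x => fderiv ℝ (fun x => K x i) x (EuclideanSpace.single i 1) := fun i =>
    (hi i).fderiv.clm_apply (.const _)
  simp_rw [inner_eq_sum, traceCLM_apply, hd]
  rw [integral_finsetSum _ fun i _ =>
      IsGaussian.integrable_of_hasTemperateGrowth _ ((hxi i).fun_mul (hi i)),
    integral_finsetSum _ fun i _ => IsGaussian.integrable_of_hasTemperateGrowth _ (hdi i),
    Finset.mul_sum]
  refine Finset.sum_congr rfl fun i _ => ?_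
  exact (((hi i).1.of_le (by simp)).isWeakPartialDeriv i).integral_mul_isoGaussian hσ
    (IsGaussian.integrable_of_hasTemperateGrowth _ (hi i))
    (IsGaussian.integrable_of_hasTemperateGrowth _ ((hxi i).fun_mul (hi i)))
    (IsGaussian.integrable_of_hasTemperateGrowth _ (hdi i))

lemma traceCLM_smulRight (L : EuclideanSpace ℝ (Fin n) →L[ℝ] ℝ) (v : EuclideanSpace ℝ (Fin n)) :
    traceCLM n (L.smulRight v) = L v := by
  conv_rhs => rw [← sum_smul_single v]
  simp [traceCLM_apply, mul_comm]

/-- Integration by parts against the Gaussian measure. -/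
theorem integral_mul_inner_sub_isoGaussian (hσ : 0 < σ)
    {F : EuclideanSpace ℝ (Fin n) → ℝ} (hF : F.HasTemperateGrowth)
    {K : EuclideanSpace ℝ (Fin n) → EuclideanSpace ℝ (Fin n)} (hK : K.HasTemperateGrowth) :
    ∫ x, F x * (inner ℝ x (K x) - σ ^ 2 * traceCLM n (fderiv ℝ K x)) ∂(isoGaussian n σ)
      = σ ^ 2 * ∫ x, fderiv ℝ F x (K x) ∂(isoGaussian n σ) := by
  -- Stein's identity for the product field `F • K`, whose divergence is `F div K + DF(K)`.
  have h := integral_inner_isoGaussian hσ (hF.smul hK)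
  have hd : ∀ x, traceCLM n (fderiv ℝ (F • K) x)
      = F x * traceCLM n (fderiv ℝ K x) + fderiv ℝ F x (K x) := by
    intro x
    rw [fderiv_smul (hF.1.differentiable (by simp) x) (hK.1.differentiable (by simp) x), map_add,
      map_smul, traceCLM_smulRight, smul_eq_mul]
  have t1 := hF.fun_mul (Function.HasTemperateGrowth.inner .id' hK)
  have t2 := hF.fun_mul (Function.HasTemperateGrowth.clm_comp_left (traceCLM n) hK.fderiv)
  have t3 := hF.fderiv.clm_apply hK
  have i1 := IsGaussian.integrable_of_hasTemperateGrowth (isoGaussian n σ) t1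
  have i2 := IsGaussian.integrable_of_hasTemperateGrowth (isoGaussian n σ) t2
  have i3 := IsGaussian.integrable_of_hasTemperateGrowth (isoGaussian n σ) t3
  simp only [hd, Pi.smul_apply', inner_smul_right] at h
  rw [integral_add i2 i3] at h
  have e : ∀ x, F x * (inner ℝ x (K x) - σ ^ 2 * traceCLM n (fderiv ℝ K x))
      = F x * inner ℝ x (K x) - σ ^ 2 * (F x * traceCLM n (fderiv ℝ K x)) := fun x => by ring
  simp_rw [e]
  rw [integral_sub i1 (i2.const_mul _), integral_const_mul]
  rw [h]; ring

/-- Stein's identity in a fixed direction. -/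
lemma integral_inner_mul_isoGaussian (hσ : 0 < σ) (a : EuclideanSpace ℝ (Fin n))
    {F : EuclideanSpace ℝ (Fin n) → ℝ} (hF : F.HasTemperateGrowth) :
    ∫ x, F x * inner ℝ a x ∂(isoGaussian n σ)
      = σ ^ 2 * ∫ x, fderiv ℝ F x a ∂(isoGaussian n σ) := by
  have h := integral_mul_inner_sub_isoGaussian hσ hF (Function.HasTemperateGrowth.const a)
  simpa [real_inner_comm] using h

end stein

/-! ### The Gaussian Poincaré inequality by rotating two independent copies -/

section poincare

variable {n : ℕ} {σ : ℝ}

lemma measurePreserving_rotation (θ : ℝ) :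
    MeasurePreserving (ContinuousLinearMap.rotation (E := EuclideanSpace ℝ (Fin n)) θ)
      ((isoGaussian n σ).prod (isoGaussian n σ)) ((isoGaussian n σ).prod (isoGaussian n σ)) :=
  ⟨by fun_prop, IsGaussian.map_rotation_eq_self integral_id_multivariateGaussian' θ⟩

lemma integral_comp_rotation (θ : ℝ)
    {Ψ : EuclideanSpace ℝ (Fin n) × EuclideanSpace ℝ (Fin n) → ℝ} (hΨ : Continuous Ψ) :
    ∫ p, Ψ (ContinuousLinearMap.rotation θ p) ∂((isoGaussian n σ).prod (isoGaussian n σ))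
      = ∫ p, Ψ p ∂((isoGaussian n σ).prod (isoGaussian n σ)) := by
  have h := measurePreserving_rotation (n := n) (σ := σ) θ
  rw [← integral_map (φ := ContinuousLinearMap.rotation θ) (f := Ψ) h.measurable.aemeasurable
    hΨ.aestronglyMeasurable, h.map_eq]

lemma norm_rotation_le (θ : ℝ) (p : EuclideanSpace ℝ (Fin n) × EuclideanSpace ℝ (Fin n)) :
    ‖ContinuousLinearMap.rotation θ p‖ ≤ 2 * ‖p‖ := by
  rw [ContinuousLinearMap.rotation_apply]
  have h1 := norm_fst_le p
  have h2 := norm_snd_le p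
  have aux : ∀ a b : ℝ, |a| ≤ 1 → |b| ≤ 1 → ‖a • p.1 + b • p.2‖ ≤ 2 * ‖p‖ := by
    intro a b ha hb
    calc ‖a • p.1 + b • p.2‖ ≤ |a| * ‖p.1‖ + |b| * ‖p.2‖ := by
          refine (norm_add_le _ _).trans_eq ?_
          rw [norm_smul, norm_smul, Real.norm_eq_abs, Real.norm_eq_abs]
      _ ≤ 1 * ‖p‖ + 1 * ‖p‖ := by gcongr
      _ = 2 * ‖p‖ := by ring
  exact max_le (aux _ _ (Real.abs_cos_le_one θ) (Real.abs_sin_le_one θ))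
    (aux _ _ (by rw [abs_neg]; exact Real.abs_sin_le_one θ) (Real.abs_cos_le_one θ))

lemma hasDerivAt_rotation_fst (p : EuclideanSpace ℝ (Fin n) × EuclideanSpace ℝ (Fin n)) (θ : ℝ) :
    HasDerivAt (fun θ => (ContinuousLinearMap.rotation θ p).1)
      (ContinuousLinearMap.rotation θ p).2 θ := by
  simp only [ContinuousLinearMap.rotation_apply]
  exact ((Real.hasDerivAt_cos θ).smul_const p.1).add ((Real.hasDerivAt_sin θ).smul_const p.2)

/-- Differentiation of `E[F(X) F(X cos θ + X' sin θ)]` with respect to the angle. -/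
lemma hasDerivAt_integral_rotation {F : EuclideanSpace ℝ (Fin n) → ℝ} (hF : F.HasTemperateGrowth)
    (θ : ℝ) :
    HasDerivAt (fun θ => ∫ p, F p.1 * F (ContinuousLinearMap.rotation θ p).1
        ∂((isoGaussian n σ).prod (isoGaussian n σ)))
      (∫ p, F p.1 * fderiv ℝ F (ContinuousLinearMap.rotation θ p).1
        (ContinuousLinearMap.rotation θ p).2 ∂((isoGaussian n σ).prod (isoGaussian n σ))) θ := by
  have tF : ∀ θ, Function.HasTemperateGrowth
      fun p : EuclideanSpace ℝ (Fin n) × EuclideanSpace ℝ (Fin n) =>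
        F p.1 * F (ContinuousLinearMap.rotation θ p).1 := fun θ =>
    (hF.comp (.fst .id')).fun_mul (hF.comp (.fst (ContinuousLinearMap.hasTemperateGrowth _)))
  have tF' : Function.HasTemperateGrowth
      fun p : EuclideanSpace ℝ (Fin n) × EuclideanSpace ℝ (Fin n) =>
        F p.1 * fderiv ℝ F (ContinuousLinearMap.rotation θ p).1
          (ContinuousLinearMap.rotation θ p).2 :=
    (hF.comp (.fst .id')).fun_mul
      ((hF.fderiv.comp (.fst (ContinuousLinearMap.hasTemperateGrowth _))).clm_apply
        (.snd (ContinuousLinearMap.hasTemperateGrowth _)))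
  obtain ⟨k, C, hC, hk⟩ := hF.norm_le
  obtain ⟨k', C', hC', hk'⟩ := hF.fderiv.norm_le
  refine (hasDerivAt_integral_of_dominated_loc_of_deriv_le (s := Set.univ)
    (F' := fun θ p => F p.1 * fderiv ℝ F (ContinuousLinearMap.rotation θ p).1
        (ContinuousLinearMap.rotation θ p).2)
    (bound := fun p => (C * (C' * 2 ^ k') * 2) * (1 + ‖p‖) ^ (k + k' + 1))
    Filter.univ_mem (.of_forall fun θ => (tF θ).1.continuous.aestronglyMeasurable)
    (IsGaussian.integrable_of_hasTemperateGrowth _ (tF θ)) tF'.1.continuous.aestronglyMeasurable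
    (.of_forall fun p θ _ => ?_) (IsGaussian.integrable_one_add_norm_pow _ _ _)
    (.of_forall fun p θ _ => ?_)).2
  · have hr := norm_rotation_le θ p
    have h1 : ‖F p.1‖ ≤ C * (1 + ‖p‖) ^ k :=
      (hk _).trans (by gcongr; exact norm_fst_le p)
    have h2 : ‖fderiv ℝ F (ContinuousLinearMap.rotation θ p).1‖
        ≤ (C' * 2 ^ k') * (1 + ‖p‖) ^ k' := by
      refine (hk' _).trans ?_
      rw [mul_assoc, ← mul_pow]
      have := (norm_fst_le _).trans hr
      gcongr
      linarith
    have h3 : ‖(ContinuousLinearMap.rotation θ p).2‖ ≤ 2 * (1 + ‖p‖) :=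
      ((norm_snd_le _).trans hr).trans (by linarith)
    rw [norm_mul]
    calc _ ≤ (C * (1 + ‖p‖) ^ k) * (((C' * 2 ^ k') * (1 + ‖p‖) ^ k') * (2 * (1 + ‖p‖))) :=
          mul_le_mul h1 ((ContinuousLinearMap.le_opNorm _ _).trans
            (mul_le_mul h2 h3 (norm_nonneg _) (by positivity))) (norm_nonneg _) (by positivity)
      _ = _ := by ring
  · exact (((hF.1.differentiable (by simp)) _).hasFDerivAt.comp_hasDerivAt θ
      (hasDerivAt_rotation_fst p θ)).const_mul _

lemma integral_isoGaussian_prod_fst {f : EuclideanSpace ℝ (Fin n) → ℝ} :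
    ∫ p, f p.1 ∂((isoGaussian n σ).prod (isoGaussian n σ)) = ∫ x, f x ∂(isoGaussian n σ) := by
  rw [integral_fun_fst]
  simp

/-- Rotation invariance moves the angle from the derivative onto the undifferentiated factor.
Integrating by parts in the second variable then leaves `-sin θ · σ²` times a product of two
gradients of `F`, taken at points each having the original law. Cauchy–Schwarz and `ab ≤ (a² +
b²)/2` bound that product. -/
lemma le_integral_rotation_deriv (hσ : 0 < σ) {F : EuclideanSpace ℝ (Fin n) → ℝ}
    (hF : F.HasTemperateGrowth) {θ : ℝ} (hθ : 0 ≤ Real.sin θ) :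
    -(Real.sin θ * (σ ^ 2 * ∫ x, ‖fderiv ℝ F x‖ ^ 2 ∂(isoGaussian n σ))) ≤
      ∫ p, F p.1 * fderiv ℝ F (ContinuousLinearMap.rotation θ p).1
        (ContinuousLinearMap.rotation θ p).2 ∂((isoGaussian n σ).prod (isoGaussian n σ)) := by
  set c := Real.cos θ
  set s := Real.sin θ
  -- The inverse rotation recovers the first coordinate.
  have hinv : ∀ p : EuclideanSpace ℝ (Fin n) × EuclideanSpace ℝ (Fin n),
      p.1 = c • (ContinuousLinearMap.rotation θ p).1 - s • (ContinuousLinearMap.rotation θ p).2 := by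
    intro p
    simp only [ContinuousLinearMap.rotation_apply, smul_add, smul_smul]
    have := Real.sin_sq_add_cos_sq θ
    have e : c • (c • p.1) + s • (s • p.1) = p.1 := by
      rw [smul_smul, smul_smul, ← add_smul, ← sq, ← sq, add_comm, this, one_smul]
    conv_lhs => rw [← e]
    module
  have tΨ : Function.HasTemperateGrowth
      fun q : EuclideanSpace ℝ (Fin n) × EuclideanSpace ℝ (Fin n) =>
        F (c • q.1 - s • q.2) * fderiv ℝ F q.1 q.2 :=
    (hF.comp ((((Function.HasTemperateGrowth.const c).smul (.fst .id'))).sub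
      ((Function.HasTemperateGrowth.const s).smul (.snd .id')))).fun_mul
        ((hF.fderiv.comp (.fst .id')).clm_apply (.snd .id'))
  have e1 : ∫ p, F p.1 * fderiv ℝ F (ContinuousLinearMap.rotation θ p).1
        (ContinuousLinearMap.rotation θ p).2 ∂((isoGaussian n σ).prod (isoGaussian n σ))
      = ∫ q, F (c • q.1 - s • q.2) * fderiv ℝ F q.1 q.2
        ∂((isoGaussian n σ).prod (isoGaussian n σ)) := by
    rw [← integral_comp_rotation θ tΨ.1.continuous]
    refine integral_congr_ae (.of_forall fun p => ?_)
    beta_reduce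
    rw [← hinv p]
  -- With `u` frozen, `fderiv ℝ F u v` is the inner product of `v` with the gradient `a` of `F` at
  -- `u`, so Stein's identity in direction `a` applies to the variable `v`.
  have e2 : ∀ u, ∫ v, F (c • u - s • v) * fderiv ℝ F u v ∂(isoGaussian n σ)
      = - (s * σ ^ 2) * ∫ v, fderiv ℝ F (c • u - s • v)
        ((InnerProductSpace.toDual ℝ (EuclideanSpace ℝ (Fin n))).symm (fderiv ℝ F u))
        ∂(isoGaussian n σ) := by
    intro u
    set a := (InnerProductSpace.toDual ℝ (EuclideanSpace ℝ (Fin n))).symm (fderiv ℝ F u)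
    have tv : Function.HasTemperateGrowth fun v : EuclideanSpace ℝ (Fin n) => F (c • u - s • v) :=
      hF.comp ((Function.HasTemperateGrowth.const (c • u)).sub
        ((Function.HasTemperateGrowth.const s).smul .id'))
    have h := integral_inner_mul_isoGaussian hσ a tv
    have hd : ∀ v, fderiv ℝ (fun v : EuclideanSpace ℝ (Fin n) => F (c • u - s • v)) v a
        = - s * fderiv ℝ F (c • u - s • v) a := by
      intro v
      have h1 : HasFDerivAt (fun v : EuclideanSpace ℝ (Fin n) => c • u - s • v)
          (-(s • ContinuousLinearMap.id ℝ _)) v :=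
        ((hasFDerivAt_id v).const_smul s).const_sub (c • u)
      have h2 : HasFDerivAt (fun v : EuclideanSpace ℝ (Fin n) => F (c • u - s • v)) _ v :=
        ((hF.1.differentiable (by simp)) _).hasFDerivAt.comp v h1
      rw [h2.fderiv]
      simp
    have ha : ∀ v, inner ℝ a v = fderiv ℝ F u v := fun v => by
      rw [InnerProductSpace.toDual_symm_apply]
    simp_rw [ha, hd, integral_const_mul] at h
    rw [h]; ring
  have tD : Function.HasTemperateGrowth
      fun q : EuclideanSpace ℝ (Fin n) × EuclideanSpace ℝ (Fin n) =>
        fderiv ℝ F (c • q.1 - s • q.2)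
        ((InnerProductSpace.toDual ℝ (EuclideanSpace ℝ (Fin n))).symm (fderiv ℝ F q.1)) :=
    (hF.fderiv.comp ((((Function.HasTemperateGrowth.const c).smul (.fst .id'))).sub
      ((Function.HasTemperateGrowth.const s).smul (.snd .id')))).clm_apply
        (.clm_comp_left (InnerProductSpace.toDual ℝ
          (EuclideanSpace ℝ (Fin n))).symm.toContinuousLinearEquiv.toContinuousLinearMap
          (hF.fderiv.comp (.fst .id')))
  have iD := IsGaussian.integrable_of_hasTemperateGrowth
    ((isoGaussian n σ).prod (isoGaussian n σ)) tD
  have tN : Function.HasTemperateGrowth fun x => ‖fderiv ℝ F x‖ ^ 2 := by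
    have h1 : ∀ x, ‖fderiv ℝ F x‖ ^ 2 = inner ℝ
        ((InnerProductSpace.toDual ℝ (EuclideanSpace ℝ (Fin n))).symm (fderiv ℝ F x))
        ((InnerProductSpace.toDual ℝ (EuclideanSpace ℝ (Fin n))).symm (fderiv ℝ F x)) := by
      intro x
      rw [real_inner_self_eq_norm_sq, LinearIsometryEquiv.norm_map]
    simp_rw [h1]
    have h2 : Function.HasTemperateGrowth fun x =>
        (InnerProductSpace.toDual ℝ (EuclideanSpace ℝ (Fin n))).symm (fderiv ℝ F x) :=
      .clm_comp_left (InnerProductSpace.toDual ℝ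
          (EuclideanSpace ℝ (Fin n))).symm.toContinuousLinearEquiv.toContinuousLinearMap hF.fderiv
    exact h2.inner h2
  have tN1 : Function.HasTemperateGrowth
      fun q : EuclideanSpace ℝ (Fin n) × EuclideanSpace ℝ (Fin n) => ‖fderiv ℝ F q.1‖ ^ 2 :=
    tN.comp (.fst .id')
  have tN2 : Function.HasTemperateGrowth
      fun q : EuclideanSpace ℝ (Fin n) × EuclideanSpace ℝ (Fin n) =>
        ‖fderiv ℝ F (c • q.1 - s • q.2)‖ ^ 2 :=
    tN.comp ((((Function.HasTemperateGrowth.const c).smul (.fst .id'))).sub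
      ((Function.HasTemperateGrowth.const s).smul (.snd .id')))
  have iN1 := IsGaussian.integrable_of_hasTemperateGrowth
    ((isoGaussian n σ).prod (isoGaussian n σ)) tN1
  have iN2 := IsGaussian.integrable_of_hasTemperateGrowth
    ((isoGaussian n σ).prod (isoGaussian n σ)) tN2
  have eN2 : ∫ q, ‖fderiv ℝ F (c • q.1 - s • q.2)‖ ^ 2
        ∂((isoGaussian n σ).prod (isoGaussian n σ))
      = ∫ x, ‖fderiv ℝ F x‖ ^ 2 ∂(isoGaussian n σ) := by
    rw [← integral_comp_rotation θ tN2.1.continuous]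
    simp_rw [← hinv]
    exact integral_isoGaussian_prod_fst (f := fun x => ‖fderiv ℝ F x‖ ^ 2)
  have eN1 : ∫ q, ‖fderiv ℝ F q.1‖ ^ 2 ∂((isoGaussian n σ).prod (isoGaussian n σ))
      = ∫ x, ‖fderiv ℝ F x‖ ^ 2 ∂(isoGaussian n σ) :=
    integral_isoGaussian_prod_fst (f := fun x => ‖fderiv ℝ F x‖ ^ 2)
  have hle : ∫ q, fderiv ℝ F (c • q.1 - s • q.2)
        ((InnerProductSpace.toDual ℝ (EuclideanSpace ℝ (Fin n))).symm (fderiv ℝ F q.1))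
        ∂((isoGaussian n σ).prod (isoGaussian n σ))
      ≤ ∫ x, ‖fderiv ℝ F x‖ ^ 2 ∂(isoGaussian n σ) := by
    calc _ ≤ ∫ q, (‖fderiv ℝ F (c • q.1 - s • q.2)‖ ^ 2 + ‖fderiv ℝ F q.1‖ ^ 2) / 2
          ∂((isoGaussian n σ).prod (isoGaussian n σ)) := by
          refine integral_mono iD ((iN2.add iN1).div_const 2) fun q => ?_
          refine (Real.le_norm_self _).trans ((ContinuousLinearMap.le_opNorm _ _).trans ?_)
          rw [LinearIsometryEquiv.norm_map]
          have := sq_nonneg (‖fderiv ℝ F (c • q.1 - s • q.2)‖ - ‖fderiv ℝ F q.1‖)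
          linarith
      _ = _ := by
          rw [integral_div, integral_add iN2 iN1, eN1, eN2]
          ring
  rw [e1, integral_prod _ (IsGaussian.integrable_of_hasTemperateGrowth _ tΨ)]
  simp_rw [e2]
  rw [integral_const_mul, ← integral_prod (fun q : EuclideanSpace ℝ (Fin n) ×
    EuclideanSpace ℝ (Fin n) => fderiv ℝ F (c • q.1 - s • q.2)
        ((InnerProductSpace.toDual ℝ (EuclideanSpace ℝ (Fin n))).symm (fderiv ℝ F q.1))) iD]
  have : 0 ≤ s * σ ^ 2 := mul_nonneg hθ (sq_nonneg σ)
  nlinarith [mul_le_mul_of_nonneg_left hle this]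

/-- The Gaussian Poincaré inequality. -/
theorem integral_sq_sub_sq_integral_le_isoGaussian (hσ : 0 < σ)
    {F : EuclideanSpace ℝ (Fin n) → ℝ} (hF : F.HasTemperateGrowth) :
    ∫ x, F x ^ 2 ∂(isoGaussian n σ) - (∫ x, F x ∂(isoGaussian n σ)) ^ 2
      ≤ σ ^ 2 * ∫ x, ‖fderiv ℝ F x‖ ^ 2 ∂(isoGaussian n σ) := by
  set M := σ ^ 2 * ∫ x, ‖fderiv ℝ F x‖ ^ 2 ∂(isoGaussian n σ) with hM
  set φ := fun θ => ∫ p, F p.1 * F (ContinuousLinearMap.rotation θ p).1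
        ∂((isoGaussian n σ).prod (isoGaussian n σ)) with hφ
  have hd : ∀ θ, HasDerivAt (fun θ => φ θ - Real.cos θ * M) _ θ := fun θ =>
    (hasDerivAt_integral_rotation (σ := σ) hF θ).sub ((Real.hasDerivAt_cos θ).mul_const M)
  -- At angle `0` the two arguments coincide and `φ` is the second moment; at `π / 2` they are
  -- independent and `φ` is the squared mean. Monotonicity of `φ θ - cos θ * M` between these angles
  -- is the claim.
  have hmono : MonotoneOn (fun θ => φ θ - Real.cos θ * M) (Set.Icc 0 (Real.pi / 2)) := by
    refine monotoneOn_of_deriv_nonneg (convex_Icc _ _)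
      (fun θ _ => (hd θ).continuousAt.continuousWithinAt)
      (fun θ _ => (hd θ).differentiableAt.differentiableWithinAt) (fun θ hθ => ?_)
    rw [interior_Icc] at hθ
    rw [(hd θ).deriv]
    have := le_integral_rotation_deriv hσ hF
      (Real.sin_nonneg_of_nonneg_of_le_pi hθ.1.le (by linarith [hθ.2, Real.pi_pos]))
    linarith
  have h := hmono (Set.left_mem_Icc.2 (by positivity)) (Set.right_mem_Icc.2 (by positivity))
    (by positivity)
  have h0 : φ 0 = ∫ x, F x ^ 2 ∂(isoGaussian n σ) := by
    simp only [hφ, ContinuousLinearMap.rotation_apply, Real.cos_zero, Real.sin_zero, one_smul,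
      zero_smul, add_zero, ← sq]
    exact integral_isoGaussian_prod_fst (f := fun x => F x ^ 2)
  have h1 : φ (Real.pi / 2) = (∫ x, F x ∂(isoGaussian n σ)) ^ 2 := by
    simp only [hφ, ContinuousLinearMap.rotation_apply, Real.cos_pi_div_two, Real.sin_pi_div_two,
      one_smul, zero_smul, zero_add, sq]
    exact integral_prod_mul F F
  simp only [h0, h1, Real.cos_zero, Real.cos_pi_div_two] at h
  linarith

end poincare

/-! ### Second order Stein formula and variance bounds for smooth residuals -/

section secondOrder

variable {n : ℕ} {σ : ℝ}

/-- The Gaussian divergence (Skorokhod) operator `δ K = ⟪x, K⟫ - σ² div K`. -/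
noncomputable def gaussianDivergence (σ : ℝ)
    (K : EuclideanSpace ℝ (Fin n) → EuclideanSpace ℝ (Fin n)) (x : EuclideanSpace ℝ (Fin n)) : ℝ :=
  inner ℝ x (K x) - σ ^ 2 * traceCLM n (fderiv ℝ K x)

lemma hasTemperateGrowth_gaussianDivergence
    {K : EuclideanSpace ℝ (Fin n) → EuclideanSpace ℝ (Fin n)} (hK : K.HasTemperateGrowth) :
    (gaussianDivergence σ K).HasTemperateGrowth :=
  (Function.HasTemperateGrowth.inner .id' hK).fun_sub
    ((Function.HasTemperateGrowth.const (σ ^ 2)).fun_mul (.clm_comp_left (traceCLM n) hK.fderiv))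

lemma integral_gaussianDivergence (hσ : 0 < σ)
    {K : EuclideanSpace ℝ (Fin n) → EuclideanSpace ℝ (Fin n)} (hK : K.HasTemperateGrowth) :
    ∫ x, gaussianDivergence σ K x ∂(isoGaussian n σ) = 0 := by
  simpa [gaussianDivergence] using
    integral_mul_inner_sub_isoGaussian hσ (Function.HasTemperateGrowth.const (1 : ℝ)) hK

/-- The second order Stein formula. -/
theorem integral_gaussianDivergence_sq (hσ : 0 < σ)
    {K : EuclideanSpace ℝ (Fin n) → EuclideanSpace ℝ (Fin n)} (hK : K.HasTemperateGrowth) :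
    ∫ x, gaussianDivergence σ K x ^ 2 ∂(isoGaussian n σ)
      = σ ^ 2 * ∫ x, ‖K x‖ ^ 2 ∂(isoGaussian n σ)
        + σ ^ 4 * ∫ x, traceCLM n (fderiv ℝ K x ∘L fderiv ℝ K x) ∂(isoGaussian n σ) := by
  have hδ := hasTemperateGrowth_gaussianDivergence (σ := σ) hK
  have h := integral_mul_inner_sub_isoGaussian hσ hδ hK
  have hdK : ∀ x, HasFDerivAt K (fderiv ℝ K x) x := fun x =>
    (hK.1.differentiable (by simp) x).hasFDerivAt
  have hddK : ∀ x, HasFDerivAt (fderiv ℝ K) (fderiv ℝ (fderiv ℝ K) x) x := fun x =>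
    (hK.fderiv.1.differentiable (by simp) x).hasFDerivAt
  have hK' : Function.HasTemperateGrowth fun x => fderiv ℝ K x (K x) := hK.fderiv.clm_apply hK
  -- `h` leaves `E⟪x, DK(K)⟫` and a term in `D²K`. A second use of Stein's identity, for the field
  -- `DK(K)`, evaluates the former and cancels the latter.
  have h' := integral_inner_isoGaussian hσ hK'
  have e1 : ∀ x, fderiv ℝ (gaussianDivergence σ K) x (K x)
      = ‖K x‖ ^ 2 + inner ℝ x (fderiv ℝ K x (K x))
        - σ ^ 2 * traceCLM n (fderiv ℝ (fderiv ℝ K) x (K x)) := by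
    intro x
    have h1 := ((hasFDerivAt_id x).inner ℝ (hdK x)).sub
      (((traceCLM n).hasFDerivAt.comp x (hddK x)).const_mul (σ ^ 2))
    have h2 : HasFDerivAt (gaussianDivergence σ K) _ x := h1
    rw [h2.fderiv]
    simp [fderivInnerCLM_apply]
    ring
  have e2 : ∀ x, traceCLM n (fderiv ℝ (fun x => fderiv ℝ K x (K x)) x)
      = traceCLM n (fderiv ℝ (fderiv ℝ K) x (K x))
        + traceCLM n (fderiv ℝ K x ∘L fderiv ℝ K x) := by
    intro x
    rw [((hddK x).clm_apply (hdK x)).fderiv, ← map_add]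
    congr 1
    ext1 v
    -- Symmetry of the second derivative identifies the two `D²K` traces that must cancel.
    have hs : fderiv ℝ (fderiv ℝ K) x v (K x) = fderiv ℝ (fderiv ℝ K) x (K x) v :=
      second_derivative_symmetric hdK (hddK x) v (K x)
    simp [hs, add_comm]
  have t1 : Function.HasTemperateGrowth fun x => ‖K x‖ ^ 2 := by
    simpa only [real_inner_self_eq_norm_sq] using hK.inner hK
  have t2 : Function.HasTemperateGrowth fun x => inner ℝ x (fderiv ℝ K x (K x)) :=
    Function.HasTemperateGrowth.inner .id' hK'
  have t3 : Function.HasTemperateGrowth fun x => traceCLM n (fderiv ℝ (fderiv ℝ K) x (K x)) :=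
    .clm_comp_left _ (hK.fderiv.fderiv.clm_apply hK)
  have t4 : Function.HasTemperateGrowth fun x => traceCLM n (fderiv ℝ K x ∘L fderiv ℝ K x) :=
    .clm_comp_left _ ((ContinuousLinearMap.compL ℝ (EuclideanSpace ℝ (Fin n))
      (EuclideanSpace ℝ (Fin n)) (EuclideanSpace ℝ (Fin n))).bilinear_hasTemperateGrowth
        hK.fderiv hK.fderiv)
  have i1 := IsGaussian.integrable_of_hasTemperateGrowth (isoGaussian n σ) t1
  have i2 := IsGaussian.integrable_of_hasTemperateGrowth (isoGaussian n σ) t2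
  have i3 := IsGaussian.integrable_of_hasTemperateGrowth (isoGaussian n σ) t3
  have i4 := IsGaussian.integrable_of_hasTemperateGrowth (isoGaussian n σ) t4
  simp_rw [e2] at h'
  rw [integral_add i3 i4] at h'
  simp_rw [e1] at h
  rw [integral_sub (i1.fun_add i2) (i3.const_mul _), integral_add i1 i2, integral_const_mul, h'] at h
  simp_rw [sq (gaussianDivergence σ K _)]
  refine h.trans ?_
  ring

/-- After expanding the square, the Poincaré inequality handles `A²` and integration by parts
evaluates the cross term `A δK` exactly. -/
lemma integral_add_gaussianDivergence_sq_sub_le (hσ : 0 < σ)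
    {A : EuclideanSpace ℝ (Fin n) → ℝ} (hA : A.HasTemperateGrowth)
    {K : EuclideanSpace ℝ (Fin n) → EuclideanSpace ℝ (Fin n)} (hK : K.HasTemperateGrowth) :
    ∫ x, (A x + gaussianDivergence σ K x) ^ 2 ∂(isoGaussian n σ)
        - (∫ x, A x ∂(isoGaussian n σ)) ^ 2
      ≤ ∫ x, gaussianDivergence σ K x ^ 2 ∂(isoGaussian n σ)
        + σ ^ 2 * ∫ x, (‖fderiv ℝ A x‖ ^ 2 + 2 * fderiv ℝ A x (K x)) ∂(isoGaussian n σ) := by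
  have hδ := hasTemperateGrowth_gaussianDivergence (σ := σ) hK
  have h1 := integral_sq_sub_sq_integral_le_isoGaussian hσ hA
  have h2 : ∫ x, A x * gaussianDivergence σ K x ∂(isoGaussian n σ) = _ :=
    integral_mul_inner_sub_isoGaussian hσ hA hK
  have t2 := hA.fun_pow 2
  have t3 := hA.fun_mul hδ
  have t4 := hδ.fun_pow 2
  have t5 := hA.fderiv.clm_apply hK
  have t6 : Function.HasTemperateGrowth fun x => ‖fderiv ℝ A x‖ ^ 2 := by
    have h1 : ∀ x, ‖fderiv ℝ A x‖ ^ 2 = fderiv ℝ A x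
        ((InnerProductSpace.toDual ℝ (EuclideanSpace ℝ (Fin n))).symm (fderiv ℝ A x)) := by
      intro x
      rw [← InnerProductSpace.toDual_symm_apply, real_inner_self_eq_norm_sq,
        LinearIsometryEquiv.norm_map]
    simp_rw [h1]
    exact hA.fderiv.clm_apply (.clm_comp_left (InnerProductSpace.toDual ℝ
          (EuclideanSpace ℝ (Fin n))).symm.toContinuousLinearEquiv.toContinuousLinearMap hA.fderiv)
  have i2 := IsGaussian.integrable_of_hasTemperateGrowth (isoGaussian n σ) t2
  have i3 := IsGaussian.integrable_of_hasTemperateGrowth (isoGaussian n σ) t3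
  have i4 := IsGaussian.integrable_of_hasTemperateGrowth (isoGaussian n σ) t4
  have i5 := IsGaussian.integrable_of_hasTemperateGrowth (isoGaussian n σ) t5
  have i6 := IsGaussian.integrable_of_hasTemperateGrowth (isoGaussian n σ) t6
  have e : ∀ x, (A x + gaussianDivergence σ K x) ^ 2
      = A x ^ 2 + 2 * (A x * gaussianDivergence σ K x) + gaussianDivergence σ K x ^ 2 :=
    fun x => by ring
  simp_rw [e]
  rw [integral_add (i2.fun_add (i3.const_mul 2)) i4, integral_add i2 (i3.const_mul 2),
    integral_const_mul, h2, integral_add i6 (i5.const_mul 2), integral_const_mul]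
  linarith

lemma integral_norm_sq_isoGaussian (hσ : 0 < σ) :
    ∫ x, ‖x‖ ^ 2 ∂(isoGaussian n σ) = σ ^ 2 * n := by
  have h := integral_inner_isoGaussian hσ (n := n) (K := fun x => x) .id'
  simpa [traceCLM_apply] using h

lemma abs_traceCLM_le (A : EuclideanSpace ℝ (Fin n) →L[ℝ] EuclideanSpace ℝ (Fin n)) :
    |traceCLM n A| ≤ n * ‖A‖ := by
  rw [traceCLM_apply]
  refine (Finset.abs_sum_le_sum_abs _ _).trans ?_
  calc _ ≤ ∑ _i : Fin n, ‖A‖ := Finset.sum_le_sum fun i _ => by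
        refine (PiLp.norm_apply_le (A (EuclideanSpace.single i 1)) i).trans ?_
        refine (A.le_opNorm _).trans_eq ?_
        simp
    _ = _ := by simp

/-- The variance bound for `2‖h‖² - 2σ² div h + σ² n` with `h` smooth and `1`-Lipschitz. -/
theorem integral_sq_sub_le_of_norm_fderiv_le_one (hσ : 0 < σ)
    {h : EuclideanSpace ℝ (Fin n) → EuclideanSpace ℝ (Fin n)} (hh : h.HasTemperateGrowth)
    (hl : ∀ x, ‖fderiv ℝ h x‖ ≤ 1) :
    ∫ x, (2 * ‖h x‖ ^ 2 - 2 * σ ^ 2 * traceCLM n (fderiv ℝ h x) + σ ^ 2 * n) ^ 2 ∂(isoGaussian n σ)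
        - (∫ x, (2 * ‖h x‖ ^ 2 - 2 * σ ^ 2 * traceCLM n (fderiv ℝ h x) + σ ^ 2 * n)
          ∂(isoGaussian n σ)) ^ 2
      ≤ 8 * σ ^ 2 * ∫ x, (2 * ‖h x‖ ^ 2 - 2 * σ ^ 2 * traceCLM n (fderiv ℝ h x) + σ ^ 2 * n)
          ∂(isoGaussian n σ) := by
  have hdh : ∀ x, HasFDerivAt h (fderiv ℝ h x) x := fun x =>
    (hh.1.differentiable (by simp) x).hasFDerivAt
  have hK : Function.HasTemperateGrowth fun x => (2 : ℝ) • h x :=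
    (Function.HasTemperateGrowth.const (2 : ℝ)).fun_smul hh
  have hdK : ∀ x, fderiv ℝ (fun x => (2 : ℝ) • h x) x = (2 : ℝ) • fderiv ℝ h x := fun x =>
    ((hdh x).const_smul (2 : ℝ)).fderiv
  have t1 : Function.HasTemperateGrowth fun x => ‖h x‖ ^ 2 := by
    simpa only [real_inner_self_eq_norm_sq] using hh.inner hh
  have t2 : Function.HasTemperateGrowth fun x => inner ℝ x (h x) :=
    Function.HasTemperateGrowth.inner .id' hh
  -- `A` is chosen so that adding `δ(2h)` trades `-2⟪x, h⟫` for `-2σ² div h`.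
  set A : EuclideanSpace ℝ (Fin n) → ℝ :=
    fun x => 2 * ‖h x‖ ^ 2 - 2 * inner ℝ x (h x) + σ ^ 2 * n with hAdef
  have hA : A.HasTemperateGrowth :=
    (((Function.HasTemperateGrowth.const (2 : ℝ)).fun_mul t1).fun_sub
      ((Function.HasTemperateGrowth.const (2 : ℝ)).fun_mul t2)).fun_add (.const _)
  -- The `h` in the gradient of `-2⟪x, h⟫` is cancelled by `K = 2h`, so only the image of `2h - x`
  -- under the adjoint of `Dh` survives.
  have hdA : ∀ x, fderiv ℝ A x + innerSL ℝ ((2 : ℝ) • h x)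
      = (2 : ℝ) • (innerSL ℝ ((2 : ℝ) • h x - x) ∘L fderiv ℝ h x) := by
    intro x
    have h1 := ((((hdh x).norm_sq.const_mul 2).sub
      (((hasFDerivAt_id x).inner ℝ (hdh x)).const_mul 2)).add_const (σ ^ 2 * n))
    have h2 : HasFDerivAt A _ x := h1
    rw [h2.fderiv]
    ext v
    simp [fderivInnerCLM_apply, real_inner_comm]
    ring
  have eT : ∀ x, 2 * ‖h x‖ ^ 2 - 2 * σ ^ 2 * traceCLM n (fderiv ℝ h x) + σ ^ 2 * n
      = A x + gaussianDivergence σ (fun x => (2 : ℝ) • h x) x := by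
    intro x
    simp only [gaussianDivergence, hdK, map_smul, inner_smul_right, smul_eq_mul, hAdef]
    ring
  have hδ := hasTemperateGrowth_gaussianDivergence (σ := σ) hK
  have iA := IsGaussian.integrable_of_hasTemperateGrowth (isoGaussian n σ) hA
  have iδ := IsGaussian.integrable_of_hasTemperateGrowth (isoGaussian n σ) hδ
  have key := integral_add_gaussianDivergence_sq_sub_le hσ hA hK
  rw [integral_gaussianDivergence_sq hσ hK] at key
  simp_rw [eT]
  rw [integral_add iA iδ, integral_gaussianDivergence hσ hK, add_zero]
  refine key.trans ?_
  have tx : Function.HasTemperateGrowth fun x : EuclideanSpace ℝ (Fin n) => ‖x‖ ^ 2 := by fun_prop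
  have tv : Function.HasTemperateGrowth fun x => (2 : ℝ) • h x - x := hK.fun_sub .id'
  have t3 : Function.HasTemperateGrowth fun x => ‖(2 : ℝ) • h x - x‖ ^ 2 := by
    simpa only [real_inner_self_eq_norm_sq] using tv.inner tv
  have i3 := IsGaussian.integrable_of_hasTemperateGrowth (isoGaussian n σ) t3
  have ix := IsGaussian.integrable_of_hasTemperateGrowth (isoGaussian n σ) tx
  have tK2 : Function.HasTemperateGrowth fun x => ‖(2 : ℝ) • h x‖ ^ 2 := by
    simpa only [real_inner_self_eq_norm_sq] using hK.inner hK
  have iK2 := IsGaussian.integrable_of_hasTemperateGrowth (isoGaussian n σ) tK2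
  have eA : ∫ x, A x ∂(isoGaussian n σ)
      = 1 / 2 * ∫ x, ‖(2 : ℝ) • h x - x‖ ^ 2 ∂(isoGaussian n σ) + σ ^ 2 * n / 2 := by
    -- Completing the square; `E‖x‖² = σ² n` then gives the mean.
    have e : ∀ x, A x = 1 / 2 * ‖(2 : ℝ) • h x - x‖ ^ 2 - 1 / 2 * ‖x‖ ^ 2 + σ ^ 2 * n := by
      intro x
      rw [norm_sub_sq_real, norm_smul, inner_smul_left, real_inner_comm]
      simp [hAdef]
      ring
    simp_rw [e]
    rw [integral_add ((i3.const_mul _).sub' (ix.const_mul _)) (integrable_const _),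
      integral_sub (i3.const_mul _) (ix.const_mul _), integral_const_mul, integral_const_mul,
      integral_norm_sq_isoGaussian hσ, integral_const]
    simp
    ring
  have tD : Function.HasTemperateGrowth fun x => fderiv ℝ A x ((2 : ℝ) • h x) :=
    hA.fderiv.clm_apply hK
  have iD := IsGaussian.integrable_of_hasTemperateGrowth (isoGaussian n σ) tD
  -- The term `‖K‖²` of the second order Stein formula completes the square to `‖∇A + K‖²`.
  have le1 : ∀ x, ‖(2 : ℝ) • h x‖ ^ 2 + (‖fderiv ℝ A x‖ ^ 2 + 2 * fderiv ℝ A x ((2 : ℝ) • h x))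
      ≤ 4 * ‖(2 : ℝ) • h x - x‖ ^ 2 := by
    intro x
    have e : ‖(2 : ℝ) • h x‖ ^ 2 + (‖fderiv ℝ A x‖ ^ 2 + 2 * fderiv ℝ A x ((2 : ℝ) • h x))
        = ‖fderiv ℝ A x + innerSL ℝ ((2 : ℝ) • h x)‖ ^ 2 := by
      set k := (2 : ℝ) • h x
      set a := (InnerProductSpace.toDual ℝ (EuclideanSpace ℝ (Fin n))).symm (fderiv ℝ A x)
      have ha : fderiv ℝ A x = innerSL ℝ a := by
        ext v
        simp [a]
      rw [ha, ← map_add, innerSL_apply_norm, innerSL_apply_norm, innerSL_apply_apply,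
        norm_add_sq_real]
      ring
    rw [e, hdA, norm_smul, mul_pow]
    have h1 : ‖innerSL ℝ ((2 : ℝ) • h x - x) ∘L fderiv ℝ h x‖ ≤ ‖(2 : ℝ) • h x - x‖ := by
      refine (ContinuousLinearMap.opNorm_comp_le _ _).trans ?_
      rw [innerSL_apply_norm]
      exact mul_le_of_le_one_right (norm_nonneg _) (hl x)
    have h2 : ‖(2 : ℝ)‖ ^ 2 = 4 := by norm_num
    rw [h2]
    gcongr
  have tN : Integrable (fun x => ‖fderiv ℝ A x‖ ^ 2 + 2 * fderiv ℝ A x ((2 : ℝ) • h x))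
      (isoGaussian n σ) := by
    obtain ⟨k, C, hC, hk⟩ := hA.fderiv.norm_le
    refine Integrable.add ?_ (iD.const_mul 2)
    refine IsGaussian.integrable_of_norm_le _ (C := C ^ 2) (k := k * 2)
      ((hA.fderiv.1.continuous.norm.pow 2).aestronglyMeasurable) (.of_forall fun x => ?_)
    rw [norm_pow, norm_norm, pow_mul, ← mul_pow]
    gcongr
    exact hk x
  have le2 := integral_mono (iK2.add tN) (i3.const_mul 4) le1
  have le2' : ∫ x, ‖(2 : ℝ) • h x‖ ^ 2 ∂(isoGaussian n σ) +
      ∫ x, (‖fderiv ℝ A x‖ ^ 2 + 2 * fderiv ℝ A x ((2 : ℝ) • h x)) ∂(isoGaussian n σ)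
      ≤ 4 * ∫ x, ‖(2 : ℝ) • h x - x‖ ^ 2 ∂(isoGaussian n σ) := by
    rw [← integral_add iK2 tN, ← integral_const_mul]
    exact le2
  have le3 : ∫ x, traceCLM n (fderiv ℝ (fun x => (2 : ℝ) • h x) x ∘L
      fderiv ℝ (fun x => (2 : ℝ) • h x) x) ∂(isoGaussian n σ) ≤ 4 * n := by
    have hb : ∀ x, traceCLM n (fderiv ℝ (fun x => (2 : ℝ) • h x) x ∘L
        fderiv ℝ (fun x => (2 : ℝ) • h x) x) ≤ 4 * n := by
      intro x
      refine (le_abs_self _).trans ((abs_traceCLM_le _).trans ?_)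
      have h1 : ‖fderiv ℝ (fun x => (2 : ℝ) • h x) x‖ ≤ 2 := by
        rw [hdK, norm_smul]
        simpa using hl x
      have h2 := (ContinuousLinearMap.opNorm_comp_le (fderiv ℝ (fun x => (2 : ℝ) • h x) x)
        (fderiv ℝ (fun x => (2 : ℝ) • h x) x)).trans
          (mul_le_mul h1 h1 (norm_nonneg _) zero_le_two)
      have h3 := mul_le_mul_of_nonneg_left h2 (Nat.cast_nonneg n (α := ℝ))
      linarith
    have tK : Function.HasTemperateGrowth fun x => traceCLM n
        (fderiv ℝ (fun x => (2 : ℝ) • h x) x ∘L fderiv ℝ (fun x => (2 : ℝ) • h x) x) :=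
      .clm_comp_left _ ((ContinuousLinearMap.compL ℝ (EuclideanSpace ℝ (Fin n))
        (EuclideanSpace ℝ (Fin n)) (EuclideanSpace ℝ (Fin n))).bilinear_hasTemperateGrowth
          hK.fderiv hK.fderiv)
    have := integral_mono (IsGaussian.integrable_of_hasTemperateGrowth (isoGaussian n σ) tK)
      (integrable_const (4 * (n : ℝ))) hb
    simpa using this
  -- The constants match exactly: `8σ² E[A] = 4σ² E‖2h - x‖² + 4σ⁴ n`, the two summands being the
  -- bounds `le2'` and `le3`.
  rw [eA]
  have hs2 : 0 ≤ σ ^ 2 := sq_nonneg σ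
  have hs4 : 0 ≤ σ ^ 4 := by positivity
  have a1 := mul_le_mul_of_nonneg_left le2' hs2
  have a2 := mul_le_mul_of_nonneg_left le3 hs4
  linear_combination a1 + a2

/-- The variance bound for `SURE` in terms of its risk, for a smooth residual map. -/
theorem integral_sure_sq_sub_le (hσ : 0 < σ)
    {h : EuclideanSpace ℝ (Fin n) → EuclideanSpace ℝ (Fin n)} (hh : h.HasTemperateGrowth) :
    (∫ x, (‖h x‖ ^ 2 - 2 * σ ^ 2 * traceCLM n (fderiv ℝ h x) + σ ^ 2 * n) ∂(isoGaussian n σ)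
      = ∫ x, ‖x - h x‖ ^ 2 ∂(isoGaussian n σ)) ∧
    ∫ x, (‖h x‖ ^ 2 - 2 * σ ^ 2 * traceCLM n (fderiv ℝ h x) + σ ^ 2 * n) ^ 2 ∂(isoGaussian n σ)
        - (∫ x, ‖x - h x‖ ^ 2 ∂(isoGaussian n σ)) ^ 2
      ≤ ∫ x, (‖h x‖ ^ 2 - 2 * σ ^ 2 * traceCLM n (fderiv ℝ h x) + σ ^ 2 * n
          - ‖x - h x‖ ^ 2) ^ 2 ∂(isoGaussian n σ)
        + σ ^ 2 * ∫ x, (4 * ‖innerSL ℝ (x - h x) ∘L (1 - fderiv ℝ h x)‖ ^ 2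
          + 4 * inner ℝ (x - h x) ((1 - fderiv ℝ h x) ((2 : ℝ) • h x - x)))
            ∂(isoGaussian n σ) := by
  have hdh : ∀ x, HasFDerivAt h (fderiv ℝ h x) x := fun x =>
    (hh.1.differentiable (by simp) x).hasFDerivAt
  have hK : Function.HasTemperateGrowth fun x => (2 : ℝ) • h x - x :=
    ((Function.HasTemperateGrowth.const (2 : ℝ)).fun_smul hh).fun_sub .id'
  have hdK : ∀ x, fderiv ℝ (fun x => (2 : ℝ) • h x - x) x
      = (2 : ℝ) • fderiv ℝ h x - ContinuousLinearMap.id ℝ _ := fun x =>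
    (((hdh x).const_smul (2 : ℝ)).sub (hasFDerivAt_id x)).fderiv
  have tu : Function.HasTemperateGrowth fun x => x - h x :=
    Function.HasTemperateGrowth.id'.fun_sub hh
  have hA : Function.HasTemperateGrowth fun x => ‖x - h x‖ ^ 2 := by
    simpa only [real_inner_self_eq_norm_sq] using tu.inner tu
  have hdA : ∀ x, fderiv ℝ (fun x => ‖x - h x‖ ^ 2) x
      = (2 : ℝ) • (innerSL ℝ (x - h x) ∘L (1 - fderiv ℝ h x)) := by
    intro x
    have h1 := ((hasFDerivAt_id x).sub (hdh x)).norm_sq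
    have h2 : HasFDerivAt (fun x => ‖x - h x‖ ^ 2) _ x := h1
    rw [h2.fderiv]
    ext v
    simp
  -- With `h` the residual, `x - h` is the estimation error, so `δ(2h - x)` is exactly SURE minus
  -- the squared loss, and its second moment is the risk of SURE.
  have eS : ∀ x, ‖h x‖ ^ 2 - 2 * σ ^ 2 * traceCLM n (fderiv ℝ h x) + σ ^ 2 * n
      = ‖x - h x‖ ^ 2 + gaussianDivergence σ (fun x => (2 : ℝ) • h x - x) x := by
    intro x
    have e1 : traceCLM n (ContinuousLinearMap.id ℝ _) = n := by simp [traceCLM_apply]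
    simp only [gaussianDivergence, hdK, map_sub, map_smul, inner_sub_right, inner_smul_right,
      smul_eq_mul, e1, norm_sub_sq_real, real_inner_self_eq_norm_sq]
    ring
  have iA := IsGaussian.integrable_of_hasTemperateGrowth (isoGaussian n σ) hA
  have iδ := IsGaussian.integrable_of_hasTemperateGrowth (isoGaussian n σ)
    (hasTemperateGrowth_gaussianDivergence (σ := σ) hK)
  have key := integral_add_gaussianDivergence_sq_sub_le hσ hA hK
  simp_rw [eS, add_sub_cancel_left]
  refine ⟨by rw [integral_add iA iδ, integral_gaussianDivergence hσ hK, add_zero], ?_⟩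
  refine key.trans_eq ?_
  congr 2
  refine integral_congr_ae (.of_forall fun x => ?_)
  simp only [hdA, norm_smul, mul_pow, smul_apply, ContinuousLinearMap.comp_apply,
    innerSL_apply_apply, smul_eq_mul]
  norm_num
  ring

end secondOrder

/-! ### Mollification of weakly differentiable maps -/

section mollify

variable {n : ℕ}

lemma LipschitzWith.norm_le_mul_one_add_norm {G : Type*} [NormedAddCommGroup G]
    {g : EuclideanSpace ℝ (Fin n) → G} (hg : LipschitzWith 1 g)
    (x : EuclideanSpace ℝ (Fin n)) : ‖g x‖ ≤ (1 + ‖g 0‖) * (1 + ‖x‖) := by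
  have h := hg.dist_le_mul x 0
  rw [dist_eq_norm, dist_zero_right, NNReal.coe_one, one_mul] at h
  nlinarith [norm_le_insert' (g x) (g 0), norm_nonneg x, norm_nonneg (g 0),
    mul_nonneg (norm_nonneg x) (norm_nonneg (g 0))]

/-- Convolution of a smooth compactly supported kernel with a function of at most linear growth
has derivatives of at most linear growth. -/
lemma norm_iteratedFDeriv_convolution_le {G : Type} [NormedAddCommGroup G] [NormedSpace ℝ G]
    {g : EuclideanSpace ℝ (Fin n) → G} (hg : LocallyIntegrable g) {C : ℝ}
    (hC : ∀ᵐ x, ‖g x‖ ≤ C * (1 + ‖x‖)) (m : ℕ) :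
    ∀ {F W : Type} [NormedAddCommGroup F] [NormedSpace ℝ F] [NormedAddCommGroup W]
      [NormedSpace ℝ W] {f : EuclideanSpace ℝ (Fin n) → F} (_ : HasCompactSupport f)
      (_ : ContDiff ℝ (⊤ : ℕ∞) f) (L : F →L[ℝ] G →L[ℝ] W),
      ∃ C' : ℝ, ∀ x, ‖iteratedFDeriv ℝ m (convolution f g L volume) x‖ ≤ C' * (1 + ‖x‖) := by
  induction m with
  | zero =>
    intro F W _ _ _ _ f hfc hf L
    refine ⟨∫ t, ‖L‖ * ‖f t‖ * (|C| * (1 + ‖t‖)), fun x => ?_⟩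
    rw [norm_iteratedFDeriv_zero, convolution_def, ← integral_mul_const]
    have hcont : Continuous fun t => ‖L‖ * ‖f t‖ * (|C| * (1 + ‖t‖)) * (1 + ‖x‖) := by
      have := hf.continuous
      fun_prop
    have hcs : HasCompactSupport fun t => ‖L‖ * ‖f t‖ * (|C| * (1 + ‖t‖)) * (1 + ‖x‖) :=
      ((hfc.norm.mul_left (f := fun _ => ‖L‖)).mul_right
        (f' := fun t => |C| * (1 + ‖t‖))).mul_right (f' := fun _ => 1 + ‖x‖)
    refine norm_integral_le_of_norm_le (hcont.integrable_of_hasCompactSupport hcs) ?_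
    have hC' : ∀ᵐ t, ‖g (x - t)‖ ≤ C * (1 + ‖x - t‖) :=
      (quasiMeasurePreserving_sub_left_of_right_invariant volume x).ae hC
    filter_upwards [hC'] with t ht
    -- From `1 + ‖x - t‖ ≤ (1 + ‖t‖)(1 + ‖x‖)`; the factor in `t` is absorbed by the compactly
    -- supported kernel.
    have h1 : ‖g (x - t)‖ ≤ |C| * ((1 + ‖t‖) * (1 + ‖x‖)) := by
      refine ht.trans ((mul_le_mul_of_nonneg_right (le_abs_self C) (by positivity)).trans ?_)
      refine mul_le_mul_of_nonneg_left ?_ (abs_nonneg C)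
      nlinarith [norm_sub_le x t, norm_nonneg x, norm_nonneg t,
        mul_nonneg (norm_nonneg x) (norm_nonneg t)]
    calc ‖L (f t) (g (x - t))‖ ≤ ‖L‖ * ‖f t‖ * ‖g (x - t)‖ := L.le_opNorm₂ _ _
      _ ≤ ‖L‖ * ‖f t‖ * (|C| * ((1 + ‖t‖) * (1 + ‖x‖))) := by gcongr
      _ = _ := by ring
  | succ m ih =>
    intro F W _ _ _ _ f hfc hf L
    -- The derivative is again a convolution with `g`, with kernel `fderiv ℝ f` valued in another
    -- space; hence the induction quantifies over the kernel and its codomain.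
    obtain ⟨C', h⟩ := ih (hfc.fderiv ℝ) (hf.fderiv_right (m := (⊤ : ℕ∞)) (by simp))
      (L.precompL (EuclideanSpace ℝ (Fin n)))
    refine ⟨C', fun x => ?_⟩
    have e : fderiv ℝ (convolution f g L volume) = convolution (fderiv ℝ f) g
        (L.precompL (EuclideanSpace ℝ (Fin n))) volume :=
      funext fun x => (hfc.hasFDerivAt_convolution_left L (hf.of_le (by simp)) hg x).fderiv
    rw [← norm_iteratedFDeriv_fderiv, e]
    exact h x

lemma hasTemperateGrowth_convolution {F G W : Type} [NormedAddCommGroup F] [NormedSpace ℝ F]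
    [NormedAddCommGroup G] [NormedSpace ℝ G] [NormedAddCommGroup W] [NormedSpace ℝ W]
    {g : EuclideanSpace ℝ (Fin n) → G} (hg : LocallyIntegrable g) {C : ℝ}
    (hC : ∀ᵐ x, ‖g x‖ ≤ C * (1 + ‖x‖)) {f : EuclideanSpace ℝ (Fin n) → F}
    (hfc : HasCompactSupport f) (hf : ContDiff ℝ (⊤ : ℕ∞) f) (L : F →L[ℝ] G →L[ℝ] W) :
    Function.HasTemperateGrowth (convolution f g L volume) := by
  refine ⟨hfc.contDiff_convolution_left L hf hg, fun m => ?_⟩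
  obtain ⟨C', h⟩ := norm_iteratedFDeriv_convolution_le hg hC m hfc hf L
  exact ⟨1, C', by simpa using h⟩

/-- The standard sequence of bump functions shrinking to the origin. -/
noncomputable def shrinkingBump (n k : ℕ) : ContDiffBump (0 : EuclideanSpace ℝ (Fin n)) :=
  ⟨1 / ((k : ℝ) + 1), 2 * (1 / ((k : ℝ) + 1)), by positivity,
    lt_mul_of_one_lt_left (by positivity) one_lt_two⟩

lemma tendsto_shrinkingBump_rOut :
    Filter.Tendsto (fun k => (shrinkingBump n k).rOut) Filter.atTop (nhds 0) := by
  simpa [shrinkingBump] using (tendsto_one_div_add_atTop_nhds_zero_nat (𝕜 := ℝ)).const_mul 2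

/-- The `k`-th mollification of `g`. -/
noncomputable def mollify {G : Type} [NormedAddCommGroup G] [NormedSpace ℝ G]
    (g : EuclideanSpace ℝ (Fin n) → G) (k : ℕ) : EuclideanSpace ℝ (Fin n) → G :=
  convolution ((shrinkingBump n k).normed volume) g (ContinuousLinearMap.lsmul ℝ ℝ) volume

section

variable {G : Type} [NormedAddCommGroup G] [NormedSpace ℝ G] {g : EuclideanSpace ℝ (Fin n) → G}

lemma mollify_apply (k : ℕ) (x : EuclideanSpace ℝ (Fin n)) :
    mollify g k x = ∫ t, (shrinkingBump n k).normed volume t • g (x - t) := rfl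

lemma ae_tendsto_mollify [CompleteSpace G] (hg : LocallyIntegrable g) :
    ∀ᵐ x, Filter.Tendsto (fun k => mollify g k x) Filter.atTop (nhds (g x)) :=
  ContDiffBump.ae_convolution_tendsto_right_of_locallyIntegrable tendsto_shrinkingBump_rOut
    -- The ratio of outer to inner radius of every bump, which must stay bounded for convergence at
    -- Lebesgue points.
    (K := 2) (.of_forall fun _ => le_rfl) hg

lemma norm_mollify_le {M : ℝ} (hM : ∀ᵐ x, ‖g x‖ ≤ M) (k : ℕ) (x : EuclideanSpace ℝ (Fin n)) :
    ‖mollify g k x‖ ≤ M := by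
  have h1 : ∫ t, (shrinkingBump n k).normed volume t * M = M := by
    rw [integral_mul_const, ContDiffBump.integral_normed, one_mul]
  rw [mollify_apply, ← h1]
  refine norm_integral_le_of_norm_le ((shrinkingBump n k).integrable_normed.mul_const M) ?_
  filter_upwards [(quasiMeasurePreserving_sub_left_of_right_invariant volume x).ae hM] with t ht
  rw [norm_smul, Real.norm_of_nonneg (ContDiffBump.nonneg_normed _ _)]
  exact mul_le_mul_of_nonneg_left ht (ContDiffBump.nonneg_normed _ _)

lemma integrable_mollify_integrand (hg : LocallyIntegrable g) (k : ℕ)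
    (x : EuclideanSpace ℝ (Fin n)) :
    Integrable fun t => (shrinkingBump n k).normed volume t • g (x - t) :=
  (ContDiffBump.hasCompactSupport_normed (shrinkingBump n k)).convolutionExists_left
    (ContinuousLinearMap.lsmul ℝ ℝ) (ContDiffBump.continuous_normed _) hg x

lemma lipschitzWith_mollify (hg : LipschitzWith 1 g) (k : ℕ) : LipschitzWith 1 (mollify g k) := by
  refine LipschitzWith.of_dist_le_mul fun x y => ?_
  have hl := hg.continuous.locallyIntegrable (μ := (volume : Measure (EuclideanSpace ℝ (Fin n))))
  have h1 : ∫ t, (shrinkingBump n k).normed volume t * dist x y = dist x y := by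
    rw [integral_mul_const, ContDiffBump.integral_normed, one_mul]
  rw [dist_eq_norm, mollify_apply, mollify_apply, ← integral_sub (integrable_mollify_integrand hl k x)
    (integrable_mollify_integrand hl k y), NNReal.coe_one, one_mul, ← h1]
  refine norm_integral_le_of_norm_le ((shrinkingBump n k).integrable_normed.mul_const _)
    (.of_forall fun t => ?_)
  rw [← smul_sub, norm_smul, Real.norm_of_nonneg (ContDiffBump.nonneg_normed _ _), ← dist_eq_norm]
  refine mul_le_mul_of_nonneg_left ?_ (ContDiffBump.nonneg_normed _ _)
  simpa using hg.dist_le_mul (x - t) (y - t)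

lemma hasTemperateGrowth_mollify (hg : LocallyIntegrable g) {C : ℝ}
    (hC : ∀ᵐ x, ‖g x‖ ≤ C * (1 + ‖x‖)) (k : ℕ) : (mollify g k).HasTemperateGrowth :=
  hasTemperateGrowth_convolution hg hC (ContDiffBump.hasCompactSupport_normed _)
    (ContDiffBump.contDiff_normed _) _

end

/-- `D` is a weak derivative of `h`, as a field of endomorphisms. -/
def IsWeakFDeriv (h : EuclideanSpace ℝ (Fin n) → EuclideanSpace ℝ (Fin n))
    (D : EuclideanSpace ℝ (Fin n) → EuclideanSpace ℝ (Fin n) →L[ℝ] EuclideanSpace ℝ (Fin n)) :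
    Prop :=
  ∀ i j, IsWeakPartialDeriv i (fun x => h x j) (fun x => D x (EuclideanSpace.single i 1) j)

variable {h : EuclideanSpace ℝ (Fin n) → EuclideanSpace ℝ (Fin n)}
  {D : EuclideanSpace ℝ (Fin n) → EuclideanSpace ℝ (Fin n) →L[ℝ] EuclideanSpace ℝ (Fin n)}

lemma LocallyIntegrable.clm_comp {F W : Type*} [NormedAddCommGroup F] [NormedSpace ℝ F]
    [NormedAddCommGroup W] [NormedSpace ℝ W] {f : EuclideanSpace ℝ (Fin n) → F}
    (hf : LocallyIntegrable f) (L : F →L[ℝ] W) : LocallyIntegrable fun x => L (f x) :=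
  fun x => by
    obtain ⟨s, hs, hi⟩ := hf x
    exact ⟨s, hs, L.integrable_comp hi⟩

lemma LocallyIntegrable.sum_univ {F ι : Type*} [NormedAddCommGroup F] [Fintype ι]
    {f : ι → EuclideanSpace ℝ (Fin n) → F} (hf : ∀ i, LocallyIntegrable (f i)) :
    LocallyIntegrable fun x => ∑ i, f i x :=
  locallyIntegrable_finsetSum _ fun i _ => hf i

lemma IsWeakFDeriv.locallyIntegrable (hD : IsWeakFDeriv h D) : LocallyIntegrable h := by
  have e : h = fun x => ∑ j, (ContinuousLinearMap.toSpanSingleton ℝ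
      (EuclideanSpace.single j (1 : ℝ))) (h x j) := by
    funext x
    simpa using (sum_smul_single (h x)).symm
  -- Integrability of component `j` is read off `hD i j` for some index `i`, so dimension zero is
  -- separate.
  rcases isEmpty_or_nonempty (Fin n) with hn | hn
  · have : h = 0 := by ext x i; exact hn.elim i
    rw [this]; exact locallyIntegrable_zero
  rw [e]
  exact LocallyIntegrable.sum_univ fun j =>
    LocallyIntegrable.clm_comp (hD hn.some j).locallyIntegrable _

lemma clm_eq_sum (A : EuclideanSpace ℝ (Fin n) →L[ℝ] EuclideanSpace ℝ (Fin n)) :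
    A = ∑ i, ∑ j, (A (EuclideanSpace.single i 1) j) •
      ((EuclideanSpace.proj i : EuclideanSpace ℝ (Fin n) →L[ℝ] ℝ).smulRight
        (EuclideanSpace.single j (1 : ℝ))) := by
  ext1 v
  conv_lhs => rw [← sum_smul_single v, map_sum]
  simp only [sum_apply, smul_apply, ContinuousLinearMap.smulRight_apply, map_smul]
  refine Finset.sum_congr rfl fun i _ => ?_
  conv_lhs => rw [← sum_smul_single (A (EuclideanSpace.single i 1)), Finset.smul_sum]
  refine Finset.sum_congr rfl fun j _ => ?_
  rw [smul_comm]
  simp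

lemma IsWeakFDeriv.locallyIntegrable_deriv (hD : IsWeakFDeriv h D) : LocallyIntegrable D := by
  have e : D = fun x => ∑ i, ∑ j, (ContinuousLinearMap.toSpanSingleton ℝ
      ((EuclideanSpace.proj i : EuclideanSpace ℝ (Fin n) →L[ℝ] ℝ).smulRight
        (EuclideanSpace.single j (1 : ℝ)))) (D x (EuclideanSpace.single i 1) j) := by
    funext x
    exact clm_eq_sum (D x)
  rw [e]
  refine LocallyIntegrable.sum_univ fun i => LocallyIntegrable.sum_univ fun j => ?_
  exact LocallyIntegrable.clm_comp (hD i j).locallyIntegrable_deriv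
    (ContinuousLinearMap.toSpanSingleton ℝ
      ((EuclideanSpace.proj i : EuclideanSpace ℝ (Fin n) →L[ℝ] ℝ).smulRight
        (EuclideanSpace.single j (1 : ℝ))))

/-- Mollification commutes with weak differentiation. -/
lemma IsWeakFDeriv.hasFDerivAt_mollify (hD : IsWeakFDeriv h D) (k : ℕ)
    (x : EuclideanSpace ℝ (Fin n)) : HasFDerivAt (mollify h k) (mollify D k x) x := by
  set φ := (shrinkingBump n k).normed volume with hφdef
  have hφ : ContDiff ℝ (⊤ : ℕ∞) φ := ContDiffBump.contDiff_normed _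
  have hφc : HasCompactSupport φ := ContDiffBump.hasCompactSupport_normed _
  have hl := hD.locallyIntegrable
  have hlD := hD.locallyIntegrable_deriv
  have h1 := hφc.hasFDerivAt_convolution_left (ContinuousLinearMap.lsmul ℝ ℝ)
    (hφ.of_le (by simp)) hl x
  suffices e : mollify D k x = convolution (fderiv ℝ φ) h ((ContinuousLinearMap.lsmul ℝ ℝ).precompL
      (EuclideanSpace ℝ (Fin n))) volume x by
    rw [e]; exact h1
  have i1 : Integrable fun t => ((ContinuousLinearMap.lsmul ℝ ℝ).precompL
      (EuclideanSpace ℝ (Fin n))) (fderiv ℝ φ t) (h (x - t)) :=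
    (hφc.fderiv ℝ).convolutionExists_left _ (hφ.continuous_fderiv (by simp)) hl x
  have i2 := integrable_mollify_integrand hlD k x
  have key : ∀ i j, mollify D k x (EuclideanSpace.single i 1) j =
      (convolution (fderiv ℝ φ) h ((ContinuousLinearMap.lsmul ℝ ℝ).precompL
        (EuclideanSpace ℝ (Fin n))) volume x) (EuclideanSpace.single i 1) j := by
    intro i j
    let P : (EuclideanSpace ℝ (Fin n) →L[ℝ] EuclideanSpace ℝ (Fin n)) →L[ℝ] ℝ :=
      (EuclideanSpace.proj j : EuclideanSpace ℝ (Fin n) →L[ℝ] ℝ) ∘L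
        ContinuousLinearMap.apply ℝ (EuclideanSpace ℝ (Fin n)) (EuclideanSpace.single i (1 : ℝ))
    change P (mollify D k x) = P (convolution _ _ _ _ x)
    rw [mollify_apply, convolution_def, ← P.integral_comp_comm i1, ← P.integral_comp_comm i2]
    -- The weak derivative identity is used with the reflected kernel `t ↦ φ (x - t)` as test
    -- function; the sign from the reflection cancels the one from integration by parts.
    have hψ : ContDiff ℝ (⊤ : ℕ∞) fun t => φ (x - t) := hφ.comp (contDiff_const.sub contDiff_id)
    have hψc : HasCompactSupport fun t => φ (x - t) :=
      hφc.comp_homeomorph (Homeomorph.subLeft x)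
    have hψd : ∀ t, fderiv ℝ (fun t => φ (x - t)) t (EuclideanSpace.single i 1)
        = - fderiv ℝ φ (x - t) (EuclideanSpace.single i 1) := by
      intro t
      have e1 : HasFDerivAt (fun t => x - t)
        (-ContinuousLinearMap.id ℝ (EuclideanSpace ℝ (Fin n))) t := (hasFDerivAt_id t).const_sub x
      have e2 : HasFDerivAt (fun t => φ (x - t)) _ t :=
        ((hφ.differentiable (by simp)) (x - t)).hasFDerivAt.comp t e1
      rw [e2.fderiv]
      simp
    have hw := (hD i j).integral_eq _ hψ hψc
    simp_rw [hψd] at hw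
    rw [← integral_sub_left_eq_self _ volume x,
      ← integral_sub_left_eq_self (fun t => P (((ContinuousLinearMap.lsmul ℝ ℝ).precompL
      (EuclideanSpace ℝ (Fin n))) (fderiv ℝ φ t) (h (x - t)))) volume x]
    simp only [mul_neg, integral_neg, neg_inj, sub_sub_cancel] at hw ⊢
    convert hw.symm using 1
    · refine integral_congr_ae (.of_forall fun t => ?_)
      simp [P, mul_comm, ← hφdef]
    · refine integral_congr_ae (.of_forall fun t => ?_)
      simp [P, mul_comm]
  rw [clm_eq_sum (mollify D k x), clm_eq_sum (convolution _ _ _ _ x)]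
  simp_rw [key]

/-- No growth of `h` is assumed. The derivative of the mollification is the mollification of the
bounded `D`, and the mean value inequality then gives linear growth of the values. -/
lemma IsWeakFDeriv.hasTemperateGrowth_mollify (hD : IsWeakFDeriv h D) {M : ℝ}
    (hM : ∀ᵐ x, ‖D x‖ ≤ M) (k : ℕ) : (mollify h k).HasTemperateGrowth := by
  have e : fderiv ℝ (mollify h k) = mollify D k :=
    funext fun x => (hD.hasFDerivAt_mollify k x).fderiv
  have hM0 : 0 ≤ M := by
    obtain ⟨x, hx⟩ := hM.exists
    exact (norm_nonneg _).trans hx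
  have hd : Differentiable ℝ (mollify h k) := fun x =>
    (hD.hasFDerivAt_mollify k x).differentiableAt
  refine .of_fderiv ?_ hd (k := 1) (C := ‖mollify h k 0‖ + M) fun x => ?_
  · rw [e]
    refine _root_.hasTemperateGrowth_mollify hD.locallyIntegrable_deriv (C := M) ?_ k
    filter_upwards [hM] with x hx
    nlinarith [norm_nonneg x, mul_nonneg hM0 (norm_nonneg x)]
  · have h1 := Convex.norm_image_sub_le_of_norm_fderiv_le (𝕜 := ℝ) (s := Set.univ) (x := 0) (y := x)
      (f := mollify h k) (C := M) (fun y _ => hd y)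
      (fun y _ => by rw [e]; exact norm_mollify_le hM k y) convex_univ trivial trivial
    rw [sub_zero] at h1
    rw [pow_one]
    nlinarith [norm_le_insert' (mollify h k x) (mollify h k 0), norm_nonneg x,
      norm_nonneg (mollify h k 0), mul_nonneg (norm_nonneg x) (norm_nonneg (mollify h k 0))]

/-- The weak derivative of a `1`-Lipschitz map has norm at most one. -/
lemma IsWeakFDeriv.ae_norm_le_one (hD : IsWeakFDeriv h D) (hh : LipschitzWith 1 h) :
    ∀ᵐ x, ‖D x‖ ≤ 1 := by
  filter_upwards [ae_tendsto_mollify hD.locallyIntegrable_deriv] with x hx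
  refine le_of_tendsto hx.norm (.of_forall fun k => ?_)
  rw [← (hD.hasFDerivAt_mollify k x).fderiv]
  exact_mod_cast norm_fderiv_le_of_lipschitz ℝ (lipschitzWith_mollify hh k)

end mollify

/-! ### Passage to the limit from mollified to weakly differentiable maps -/

section tame

variable {n : ℕ} {M : ℝ} {F G W : Type*} [NormedAddCommGroup F] [NormedAddCommGroup G]
  [NormedAddCommGroup W]

/-- A continuous function of a point, a vector and an endomorphism which grows at most polynomially
in the first two arguments as long as the norm of the third one is at most `M`. -/
structure IsTame (M : ℝ) (Φ : EuclideanSpace ℝ (Fin n) × EuclideanSpace ℝ (Fin n) ×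
    (EuclideanSpace ℝ (Fin n) →L[ℝ] EuclideanSpace ℝ (Fin n)) → F) : Prop where
  continuous : Continuous Φ
  bound : ∃ (N : ℕ) (C : ℝ), 0 ≤ C ∧ ∀ p, ‖p.2.2‖ ≤ M →
    ‖Φ p‖ ≤ C * (1 + ‖p.1‖ + ‖p.2.1‖) ^ N

namespace IsTame

variable {Φ : EuclideanSpace ℝ (Fin n) × EuclideanSpace ℝ (Fin n) ×
    (EuclideanSpace ℝ (Fin n) →L[ℝ] EuclideanSpace ℝ (Fin n)) → F}
  {Ψ : EuclideanSpace ℝ (Fin n) × EuclideanSpace ℝ (Fin n) ×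
    (EuclideanSpace ℝ (Fin n) →L[ℝ] EuclideanSpace ℝ (Fin n)) → G}

lemma point : IsTame (n := n) M fun p => p.1 :=
  ⟨by fun_prop, 1, 1, zero_le_one, fun p _ => by
    rw [pow_one, one_mul]; linarith [norm_nonneg p.2.1]⟩

lemma vector : IsTame (n := n) M fun p => p.2.1 :=
  ⟨by fun_prop, 1, 1, zero_le_one, fun p _ => by
    rw [pow_one, one_mul]; linarith [norm_nonneg p.1]⟩

lemma endo : IsTame (n := n) M fun p => p.2.2 :=
  ⟨by fun_prop, 0, |M|, abs_nonneg M, fun p hp => by simpa using hp.trans (le_abs_self M)⟩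

lemma const (c : F) : IsTame (n := n) M fun _ => c :=
  ⟨continuous_const, 0, ‖c‖, norm_nonneg c, fun p _ => by simp⟩

lemma add {Φ' : EuclideanSpace ℝ (Fin n) × EuclideanSpace ℝ (Fin n) ×
    (EuclideanSpace ℝ (Fin n) →L[ℝ] EuclideanSpace ℝ (Fin n)) → F}
    (hΦ : IsTame M Φ) (hΦ' : IsTame M Φ') : IsTame M fun p => Φ p + Φ' p := by
  obtain ⟨N, C, hC, h⟩ := hΦ.bound
  obtain ⟨N', C', hC', h'⟩ := hΦ'.bound
  refine ⟨hΦ.continuous.add hΦ'.continuous, N + N', C + C', by positivity, fun p hp => ?_⟩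
  have hb : 1 ≤ 1 + ‖p.1‖ + ‖p.2.1‖ := by linarith [norm_nonneg p.1, norm_nonneg p.2.1]
  refine (norm_add_le _ _).trans ?_
  rw [add_mul]
  refine add_le_add ((h p hp).trans ?_) ((h' p hp).trans ?_)
  · exact mul_le_mul_of_nonneg_left (pow_le_pow_right₀ hb (Nat.le_add_right _ _)) hC
  · exact mul_le_mul_of_nonneg_left (pow_le_pow_right₀ hb (Nat.le_add_left _ _)) hC'

lemma norm (hΦ : IsTame M Φ) : IsTame M fun p => ‖Φ p‖ := by
  obtain ⟨N, C, hC, h⟩ := hΦ.bound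
  exact ⟨hΦ.continuous.norm, N, C, hC, fun p hp => by simpa using h p hp⟩

variable [NormedSpace ℝ F] [NormedSpace ℝ G] [NormedSpace ℝ W]

lemma bilinear (B : F →L[ℝ] G →L[ℝ] W) (hΦ : IsTame M Φ) (hΨ : IsTame M Ψ) :
    IsTame M fun p => B (Φ p) (Ψ p) := by
  obtain ⟨N, C, hC, h⟩ := hΦ.bound
  obtain ⟨N', C', hC', h'⟩ := hΨ.bound
  refine ⟨(B.continuous.comp hΦ.continuous).clm_apply hΨ.continuous, N + N', ‖B‖ * C * C',
    by positivity, fun p hp => (B.le_opNorm₂ _ _).trans ?_⟩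
  calc ‖B‖ * ‖Φ p‖ * ‖Ψ p‖ ≤ ‖B‖ * (C * (1 + ‖p.1‖ + ‖p.2.1‖) ^ N) *
        (C' * (1 + ‖p.1‖ + ‖p.2.1‖) ^ N') :=
      mul_le_mul (mul_le_mul_of_nonneg_left (h p hp) (norm_nonneg B)) (h' p hp) (norm_nonneg _)
        (by positivity)
    _ = _ := by ring

lemma clm (L : F →L[ℝ] G) (hΦ : IsTame M Φ) : IsTame M fun p => L (Φ p) := by
  obtain ⟨N, C, hC, h⟩ := hΦ.bound
  refine ⟨L.continuous.comp hΦ.continuous, N, ‖L‖ * C, by positivity, fun p hp => ?_⟩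
  rw [mul_assoc]
  exact L.le_opNorm_of_le (h p hp)

lemma mul {Φ Φ' : EuclideanSpace ℝ (Fin n) × EuclideanSpace ℝ (Fin n) ×
    (EuclideanSpace ℝ (Fin n) →L[ℝ] EuclideanSpace ℝ (Fin n)) → ℝ}
    (hΦ : IsTame M Φ) (hΦ' : IsTame M Φ') : IsTame M fun p => Φ p * Φ' p :=
  bilinear (ContinuousLinearMap.mul ℝ ℝ) hΦ hΦ'

lemma const_mul {Φ : EuclideanSpace ℝ (Fin n) × EuclideanSpace ℝ (Fin n) ×
    (EuclideanSpace ℝ (Fin n) →L[ℝ] EuclideanSpace ℝ (Fin n)) → ℝ} (c : ℝ)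
    (hΦ : IsTame M Φ) : IsTame M fun p => c * Φ p :=
  (const c).mul hΦ

lemma sub {Φ' : EuclideanSpace ℝ (Fin n) × EuclideanSpace ℝ (Fin n) ×
    (EuclideanSpace ℝ (Fin n) →L[ℝ] EuclideanSpace ℝ (Fin n)) → F}
    (hΦ : IsTame M Φ) (hΦ' : IsTame M Φ') : IsTame M fun p => Φ p - Φ' p := by
  simpa [sub_eq_add_neg] using hΦ.add (clm (-ContinuousLinearMap.id ℝ F) hΦ')

lemma sq {Φ : EuclideanSpace ℝ (Fin n) × EuclideanSpace ℝ (Fin n) ×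
    (EuclideanSpace ℝ (Fin n) →L[ℝ] EuclideanSpace ℝ (Fin n)) → ℝ}
    (hΦ : IsTame M Φ) : IsTame M fun p => Φ p ^ 2 := by
  simpa only [pow_two] using hΦ.mul hΦ

end IsTame

variable {σ : ℝ} {h : EuclideanSpace ℝ (Fin n) → EuclideanSpace ℝ (Fin n)}
  {D : EuclideanSpace ℝ (Fin n) → EuclideanSpace ℝ (Fin n) →L[ℝ] EuclideanSpace ℝ (Fin n)}

/-- The mollifications are uniformly `M`-Lipschitz, so boundedness in `k` at one point suffices for
a common linear bound. Any point where they converge will do, and almost every point does. -/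
lemma IsWeakFDeriv.exists_norm_mollify_le (hD : IsWeakFDeriv h D) (hM : ∀ᵐ x, ‖D x‖ ≤ M) :
    ∃ K, 0 ≤ K ∧ (∀ k x, ‖mollify h k x‖ ≤ K * (1 + ‖x‖)) ∧ ∀ᵐ x, ‖h x‖ ≤ K * (1 + ‖x‖) := by
  have hlim := ae_tendsto_mollify hD.locallyIntegrable
  obtain ⟨x₀, hx₀⟩ := hlim.exists
  obtain ⟨B, hB⟩ := hx₀.norm.bddAbove_range
  have hB' : ∀ k, ‖mollify h k x₀‖ ≤ B := fun k => hB ⟨k, rfl⟩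
  have hB0 : 0 ≤ B := (norm_nonneg _).trans (hB' 0)
  have hM0 : 0 ≤ M := by
    obtain ⟨x, hx⟩ := hM.exists
    exact (norm_nonneg _).trans hx
  have h1 : ∀ k x, ‖mollify h k x‖ ≤ (B + M * (1 + ‖x₀‖)) * (1 + ‖x‖) := by
    intro k x
    have h2 := Convex.norm_image_sub_le_of_norm_fderiv_le (𝕜 := ℝ) (s := Set.univ) (x := x₀) (y := x)
      (f := mollify h k) (C := M) (fun y _ => (hD.hasFDerivAt_mollify k y).differentiableAt)
      (fun y _ => by rw [(hD.hasFDerivAt_mollify k y).fderiv]; exact norm_mollify_le hM k y)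
      convex_univ trivial trivial
    have h3 := norm_le_insert' (mollify h k x) (mollify h k x₀)
    have h4 : M * ‖x - x₀‖ ≤ M * (‖x‖ + ‖x₀‖) :=
      mul_le_mul_of_nonneg_left (norm_sub_le _ _) hM0
    have := hB' k
    nlinarith [mul_nonneg hB0 (norm_nonneg x), mul_nonneg hM0 (norm_nonneg x),
      mul_nonneg (mul_nonneg hM0 (norm_nonneg x₀)) (norm_nonneg x)]
  refine ⟨B + M * (1 + ‖x₀‖), by positivity, h1, ?_⟩
  filter_upwards [hlim] with x hx
  exact le_of_tendsto hx.norm (.of_forall fun k => h1 k x)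

/-- Gaussian integrals of tame functionals of a map and of its weak derivative are limits of the
corresponding integrals for mollified maps. -/
theorem IsTame.tendsto_integral_mollify (hσ : 0 < σ) (hD : IsWeakFDeriv h D)
    (hM : ∀ᵐ x, ‖D x‖ ≤ M) {Φ : EuclideanSpace ℝ (Fin n) × EuclideanSpace ℝ (Fin n) ×
      (EuclideanSpace ℝ (Fin n) →L[ℝ] EuclideanSpace ℝ (Fin n)) → ℝ} (hΦ : IsTame M Φ) :
    Integrable (fun x => Φ (x, h x, D x)) (isoGaussian n σ) ∧
    Filter.Tendsto
      (fun k => ∫ x, Φ (x, mollify h k x, fderiv ℝ (mollify h k) x) ∂(isoGaussian n σ))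
      Filter.atTop (nhds (∫ x, Φ (x, h x, D x) ∂(isoGaussian n σ))) := by
  have hac := isoGaussian_absolutelyContinuous (n := n) hσ
  obtain ⟨K, hK, hb, hb'⟩ := hD.exists_norm_mollify_le hM
  obtain ⟨N, C, hC, hbound⟩ := hΦ.bound
  have hB : ∀ x v A, ‖v‖ ≤ K * (1 + ‖x‖) → ‖A‖ ≤ M →
      ‖Φ (x, v, A)‖ ≤ (C * (1 + K) ^ N) * (1 + ‖x‖) ^ N := by
    intro x v A hv hA
    refine (hbound (x, v, A) hA).trans ?_
    rw [mul_assoc, ← mul_pow]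
    refine mul_le_mul_of_nonneg_left (pow_le_pow_left₀ (by positivity) ?_ N) hC
    dsimp only
    linarith
  have hmeas : ∀ k, AEStronglyMeasurable
      (fun x => Φ (x, mollify h k x, fderiv ℝ (mollify h k) x)) (isoGaussian n σ) := by
    intro k
    have ht := hD.hasTemperateGrowth_mollify hM k
    exact (hΦ.continuous.comp (continuous_id.prodMk
      (ht.1.continuous.prodMk ht.fderiv.1.continuous))).aestronglyMeasurable
  have hle : ∀ k, ∀ᵐ x ∂(isoGaussian n σ),
      ‖Φ (x, mollify h k x, fderiv ℝ (mollify h k) x)‖ ≤ (C * (1 + K) ^ N) * (1 + ‖x‖) ^ N :=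
    fun k => .of_forall fun x => hB _ _ _ (hb k x) (by
      rw [(hD.hasFDerivAt_mollify k x).fderiv]; exact norm_mollify_le hM k x)
  have hlim : ∀ᵐ x ∂(isoGaussian n σ), Filter.Tendsto
      (fun k => Φ (x, mollify h k x, fderiv ℝ (mollify h k) x)) Filter.atTop
      (nhds (Φ (x, h x, D x))) := by
    filter_upwards [hac.ae_le (ae_tendsto_mollify hD.locallyIntegrable),
      hac.ae_le (ae_tendsto_mollify hD.locallyIntegrable_deriv)] with x h1 h2
    refine (hΦ.continuous.tendsto (x, h x, D x)).comp (tendsto_const_nhds.prodMk_nhds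
      (h1.prodMk_nhds ?_))
    simpa only [(hD.hasFDerivAt_mollify _ x).fderiv] using h2
  have hint := IsGaussian.integrable_one_add_norm_pow (isoGaussian n σ) (C * (1 + K) ^ N) N
  refine ⟨IsGaussian.integrable_of_norm_le _ (aestronglyMeasurable_of_tendsto_ae _ hmeas hlim)
    (C := C * (1 + K) ^ N) (k := N) ?_,
    tendsto_integral_of_dominated_convergence _ hmeas hint hle hlim⟩
  filter_upwards [hac.ae_le hb', hac.ae_le hM] with x h1 h2
  exact hB _ _ _ h1 h2

/-- The coefficient `a = 1` gives SURE, and `a = 2` gives the modified statistic divided by `2σ²`.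
-/
lemma isTame_sure (a : ℝ) : IsTame (n := n) M fun p =>
    a * ‖p.2.1‖ ^ 2 - 2 * σ ^ 2 * traceCLM n p.2.2 + σ ^ 2 * n :=
  ((IsTame.vector.norm.sq.const_mul a).sub ((IsTame.endo.clm (traceCLM n)).const_mul _)).add
    (.const _)

/-- The variance bound for `2‖h‖² - 2σ² div h + σ² n` with `h` weakly differentiable and
`‖∇h‖ ≤ 1`. -/
theorem IsWeakFDeriv.integral_sq_sub_le (hσ : 0 < σ) (hD : IsWeakFDeriv h D)
    (hM : ∀ᵐ x, ‖D x‖ ≤ 1) :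
    Integrable (fun x => 2 * ‖h x‖ ^ 2 - 2 * σ ^ 2 * traceCLM n (D x) + σ ^ 2 * n)
      (isoGaussian n σ) ∧
    Integrable (fun x => (2 * ‖h x‖ ^ 2 - 2 * σ ^ 2 * traceCLM n (D x) + σ ^ 2 * n) ^ 2)
      (isoGaussian n σ) ∧
    ∫ x, (2 * ‖h x‖ ^ 2 - 2 * σ ^ 2 * traceCLM n (D x) + σ ^ 2 * n) ^ 2 ∂(isoGaussian n σ)
        - (∫ x, (2 * ‖h x‖ ^ 2 - 2 * σ ^ 2 * traceCLM n (D x) + σ ^ 2 * n)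
          ∂(isoGaussian n σ)) ^ 2
      ≤ 8 * σ ^ 2 * ∫ x, (2 * ‖h x‖ ^ 2 - 2 * σ ^ 2 * traceCLM n (D x) + σ ^ 2 * n)
          ∂(isoGaussian n σ) := by
  obtain ⟨i1, l1⟩ := (isTame_sure (σ := σ) 2).tendsto_integral_mollify hσ hD hM
  obtain ⟨i2, l2⟩ := (isTame_sure (σ := σ) 2).sq.tendsto_integral_mollify hσ hD hM
  refine ⟨i1, i2, le_of_tendsto_of_tendsto' (l2.sub (l1.pow 2)) (l1.const_mul (8 * σ ^ 2))
    fun k => ?_⟩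
  refine integral_sq_sub_le_of_norm_fderiv_le_one hσ (hD.hasTemperateGrowth_mollify hM k)
    fun x => ?_
  rw [(hD.hasFDerivAt_mollify k x).fderiv]
  exact norm_mollify_le hM k x

lemma isTame_sureVarianceBound : IsTame (n := n) M fun p =>
    4 * ‖innerSL ℝ (p.1 - p.2.1) ∘L (1 - p.2.2)‖ ^ 2
      + 4 * inner ℝ (p.1 - p.2.1) ((1 - p.2.2) ((2 : ℝ) • p.2.1 - p.1)) := by
  have tu : IsTame (n := n) M fun p => p.1 - p.2.1 := .sub .point .vector
  have tA : IsTame (n := n) M fun p => 1 - p.2.2 := .sub (.const 1) .endo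
  have tv : IsTame (n := n) M fun p => (2 : ℝ) • p.2.1 - p.1 :=
    .sub (.clm ((2 : ℝ) • ContinuousLinearMap.id ℝ _) .vector) .point
  have t1 : IsTame (n := n) M fun p => innerSL ℝ (p.1 - p.2.1) := .clm (innerSL ℝ) tu
  have t2 : IsTame (n := n) M fun p => innerSL ℝ (p.1 - p.2.1) ∘L (1 - p.2.2) :=
    .bilinear (ContinuousLinearMap.compL ℝ (EuclideanSpace ℝ (Fin n))
      (EuclideanSpace ℝ (Fin n)) ℝ) t1 tA
  have t3 : IsTame (n := n) M fun p => (1 - p.2.2) ((2 : ℝ) • p.2.1 - p.1) :=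
    .bilinear (ContinuousLinearMap.id ℝ (EuclideanSpace ℝ (Fin n) →L[ℝ] EuclideanSpace ℝ (Fin n)))
      tA tv
  have t4 : IsTame (n := n) M fun p =>
      inner ℝ (p.1 - p.2.1) ((1 - p.2.2) ((2 : ℝ) • p.2.1 - p.1)) := .bilinear (innerSL ℝ) tu t3
  exact (t2.norm.sq.const_mul 4).add (t4.const_mul 4)

/-- Unbiasedness and the variance bound for `SURE`, for a residual map with bounded weak
derivative. -/
theorem IsWeakFDeriv.integral_sure_sq_sub_le (hσ : 0 < σ) (hD : IsWeakFDeriv h D)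
    (hM : ∀ᵐ x, ‖D x‖ ≤ M) :
    Integrable (fun x => ‖h x‖ ^ 2 - 2 * σ ^ 2 * traceCLM n (D x) + σ ^ 2 * n)
      (isoGaussian n σ) ∧
    Integrable (fun x => (‖h x‖ ^ 2 - 2 * σ ^ 2 * traceCLM n (D x) + σ ^ 2 * n) ^ 2)
      (isoGaussian n σ) ∧
    Integrable (fun x => ‖x - h x‖ ^ 2) (isoGaussian n σ) ∧
    Integrable (fun x => (‖h x‖ ^ 2 - 2 * σ ^ 2 * traceCLM n (D x) + σ ^ 2 * n
      - ‖x - h x‖ ^ 2) ^ 2) (isoGaussian n σ) ∧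
    Integrable (fun x => 4 * ‖innerSL ℝ (x - h x) ∘L (1 - D x)‖ ^ 2
          + 4 * inner ℝ (x - h x) ((1 - D x) ((2 : ℝ) • h x - x))) (isoGaussian n σ) ∧
    (∫ x, (‖h x‖ ^ 2 - 2 * σ ^ 2 * traceCLM n (D x) + σ ^ 2 * n) ∂(isoGaussian n σ)
      = ∫ x, ‖x - h x‖ ^ 2 ∂(isoGaussian n σ)) ∧
    ∫ x, (‖h x‖ ^ 2 - 2 * σ ^ 2 * traceCLM n (D x) + σ ^ 2 * n) ^ 2 ∂(isoGaussian n σ)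
        - (∫ x, ‖x - h x‖ ^ 2 ∂(isoGaussian n σ)) ^ 2
      ≤ ∫ x, (‖h x‖ ^ 2 - 2 * σ ^ 2 * traceCLM n (D x) + σ ^ 2 * n
          - ‖x - h x‖ ^ 2) ^ 2 ∂(isoGaussian n σ)
        + σ ^ 2 * ∫ x, (4 * ‖innerSL ℝ (x - h x) ∘L (1 - D x)‖ ^ 2
          + 4 * inner ℝ (x - h x) ((1 - D x) ((2 : ℝ) • h x - x)))
            ∂(isoGaussian n σ) := by
  have tS : IsTame (n := n) M fun p =>
      ‖p.2.1‖ ^ 2 - 2 * σ ^ 2 * traceCLM n p.2.2 + σ ^ 2 * n := by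
    simpa using isTame_sure (σ := σ) (M := M) (n := n) 1
  have tu : IsTame (n := n) M fun p => p.1 - p.2.1 := .sub .point .vector
  have tu2 : IsTame (n := n) M fun p => ‖p.1 - p.2.1‖ ^ 2 := tu.norm.sq
  have tQ := isTame_sureVarianceBound (n := n) (M := M)
  obtain ⟨i1, l1⟩ := tS.tendsto_integral_mollify hσ hD hM
  obtain ⟨i2, l2⟩ := tS.sq.tendsto_integral_mollify hσ hD hM
  obtain ⟨i3, l3⟩ := tu2.tendsto_integral_mollify hσ hD hM
  obtain ⟨i4, l4⟩ := (tS.sub tu2).sq.tendsto_integral_mollify hσ hD hM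
  obtain ⟨i5, l5⟩ := tQ.tendsto_integral_mollify hσ hD hM
  have key := fun k => _root_.integral_sure_sq_sub_le hσ (hD.hasTemperateGrowth_mollify hM k)
  refine ⟨i1, i2, i3, i4, i5, ?_, ?_⟩
  · exact tendsto_nhds_unique l1 (l3.congr fun k => (key k).1.symm)
  · exact le_of_tendsto_of_tendsto' (l2.sub (l3.pow 2)) (l4.add (l5.const_mul (σ ^ 2)))
      fun k => (key k).2

/-- Second and fourth moment bounds for a Lipschitz function of a Gaussian vector. -/
theorem LipschitzWith.integral_pow_le_isoGaussian (hσ : 0 < σ)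
    {L : EuclideanSpace ℝ (Fin n) → ℝ} (hL : LipschitzWith 1 L) :
    (∀ m : ℕ, Integrable (fun x => L x ^ m) (isoGaussian n σ)) ∧
    ∫ x, L x ^ 2 ∂(isoGaussian n σ) - (∫ x, L x ∂(isoGaussian n σ)) ^ 2 ≤ σ ^ 2 ∧
    ∫ x, L x ^ 4 ∂(isoGaussian n σ) ≤ (∫ x, L x ^ 2 ∂(isoGaussian n σ)) ^ 2
      + 4 * σ ^ 2 * ∫ x, L x ^ 2 ∂(isoGaussian n σ) := by
  have hloc := hL.continuous.locallyIntegrable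
    (μ := (volume : Measure (EuclideanSpace ℝ (Fin n))))
  have hlim : ∀ x, Filter.Tendsto (fun k => mollify L k x) Filter.atTop (nhds (L x)) := fun x =>
    ContDiffBump.convolution_tendsto_right_of_continuous tendsto_shrinkingBump_rOut hL.continuous x
  have ht : ∀ k, (mollify L k).HasTemperateGrowth := fun k =>
    hasTemperateGrowth_mollify hloc (.of_forall hL.norm_le_mul_one_add_norm) k
  have hlip : ∀ k, LipschitzWith 1 (mollify L k) := lipschitzWith_mollify hL
  obtain ⟨B, hB⟩ := (hlim 0).norm.bddAbove_range
  have hB' : ∀ k, ‖mollify L k 0‖ ≤ B := fun k => hB ⟨k, rfl⟩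
  have hb : ∀ k x, ‖mollify L k x‖ ≤ (1 + B) * (1 + ‖x‖) := fun k x =>
    ((hlip k).norm_le_mul_one_add_norm x).trans
      (mul_le_mul_of_nonneg_right (by linarith [hB' k]) (by positivity))
  have hbL : ∀ x, ‖L x‖ ≤ (1 + B) * (1 + ‖x‖) := fun x =>
    le_of_tendsto (hlim x).norm (.of_forall fun k => hb k x)
  have hi : ∀ m : ℕ, Integrable (fun x => L x ^ m) (isoGaussian n σ) := fun m =>
    IsGaussian.integrable_of_norm_le _ (hL.continuous.pow m).aestronglyMeasurable
      (C := (1 + B) ^ m) (k := m) (.of_forall fun x => by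
        rw [norm_pow, ← mul_pow]; exact pow_le_pow_left₀ (norm_nonneg _) (hbL x) m)
  have hm : ∀ m : ℕ, Filter.Tendsto (fun k => ∫ x, mollify L k x ^ m ∂(isoGaussian n σ))
      Filter.atTop (nhds (∫ x, L x ^ m ∂(isoGaussian n σ))) := fun m =>
    tendsto_integral_of_dominated_convergence (fun x => (1 + B) ^ m * (1 + ‖x‖) ^ m)
      (fun k => ((ht k).1.continuous.pow m).aestronglyMeasurable)
      (IsGaussian.integrable_one_add_norm_pow _ _ _)
      (fun k => .of_forall fun x => by
        rw [norm_pow, ← mul_pow]; exact pow_le_pow_left₀ (norm_nonneg _) (hb k x) m)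
      (.of_forall fun x => (hlim x).pow m)
  have hd : ∀ k x, ‖fderiv ℝ (mollify L k) x‖ ^ 2 ≤ 1 := fun k x =>
    pow_le_one₀ (norm_nonneg _) (by exact_mod_cast norm_fderiv_le_of_lipschitz ℝ (hlip k))
  have hm1 := hm 1
  simp only [pow_one] at hm1
  refine ⟨hi, le_of_tendsto ((hm 2).sub (hm1.pow 2)) (.of_forall fun k => ?_),
    le_of_tendsto_of_tendsto' (hm 4) (((hm 2).pow 2).add ((hm 2).const_mul (4 * σ ^ 2)))
      fun k => ?_⟩
  · refine (integral_sq_sub_sq_integral_le_isoGaussian hσ (ht k)).trans ?_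
    have h1 : ∫ x, ‖fderiv ℝ (mollify L k) x‖ ^ 2 ∂(isoGaussian n σ)
        ≤ ∫ _x, (1 : ℝ) ∂(isoGaussian n σ) :=
      integral_mono_of_nonneg (.of_forall fun x => by positivity) (integrable_const _)
        (.of_forall (hd k))
    simp only [integral_const, probReal_univ, smul_eq_mul, mul_one] at h1
    nlinarith [sq_nonneg σ]
  -- The fourth moment bound is the Poincaré inequality for the square: its gradient has squared
  -- norm at most `4 L²`.
  · have h0 := integral_sq_sub_sq_integral_le_isoGaussian hσ ((ht k).fun_pow 2)
    have hd2 : ∀ x, ‖fderiv ℝ (fun x => mollify L k x ^ 2) x‖ ^ 2 ≤ 4 * mollify L k x ^ 2 := by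
      intro x
      have h1 := ((((ht k).1.differentiable (by simp)) x).hasFDerivAt).pow 2
      rw [h1.fderiv, norm_smul, mul_pow]
      refine (mul_le_of_le_one_right (by positivity) (hd k x)).trans_eq ?_
      rw [Real.norm_eq_abs, sq_abs]
      simp
      ring
    have h1 : ∫ x, ‖fderiv ℝ (fun x => mollify L k x ^ 2) x‖ ^ 2 ∂(isoGaussian n σ)
        ≤ ∫ x, 4 * mollify L k x ^ 2 ∂(isoGaussian n σ) :=
      integral_mono_of_nonneg (.of_forall fun x => by positivity)
        ((IsGaussian.integrable_of_hasTemperateGrowth _ ((ht k).fun_pow 2)).const_mul 4)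
        (.of_forall hd2)
    rw [integral_const_mul] at h1
    have e : ∀ x, (mollify L k x ^ 2) ^ 2 = mollify L k x ^ 4 := fun x => by ring
    simp_rw [e] at h0
    nlinarith [mul_le_mul_of_nonneg_left h1 (sq_nonneg σ)]

end tame

/-! ### Operator inequalities for symmetric endomorphisms -/

section endomorphisms

variable {n : ℕ} {A : EuclideanSpace ℝ (Fin n) →L[ℝ] EuclideanSpace ℝ (Fin n)}

/-- This is `A² ≤ A` for `0 ≤ A ≤ 1`, obtained without spectral theory: positivity at `v - A v`
gives `2‖A v‖² ≤ ⟪v, A v⟫ + ⟪A v, A (A v)⟫`, and the last term is at most `‖A v‖²`. -/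
lemma norm_sq_apply_le_inner (hs : ∀ v w, inner ℝ (A v) w = inner ℝ v (A w))
    (hp : ∀ v, 0 ≤ inner ℝ v (A v)) (h1 : ‖A‖ ≤ 1) (v : EuclideanSpace ℝ (Fin n)) :
    ‖A v‖ ^ 2 ≤ inner ℝ v (A v) := by
  have h := hp (v - A v)
  have h2 : inner ℝ (A v) (A (A v)) ≤ ‖A v‖ ^ 2 := by
    refine (real_inner_le_norm _ _).trans ?_
    rw [sq]
    exact mul_le_mul_of_nonneg_left (A.le_of_opNorm_le h1 _ |>.trans_eq (one_mul _))
      (norm_nonneg _)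
  rw [map_sub, inner_sub_left, inner_sub_right, inner_sub_right, ← hs v (A v),
    real_inner_self_eq_norm_sq] at h
  linarith

lemma traceCLM_comp_self_le (hs : ∀ v w, inner ℝ (A v) w = inner ℝ v (A w))
    (hp : ∀ v, 0 ≤ inner ℝ v (A v)) (h1 : ‖A‖ ≤ 1) :
    traceCLM n (A ∘L A) ≤ traceCLM n A := by
  rw [traceCLM_apply, traceCLM_apply]
  refine Finset.sum_le_sum fun i _ => ?_
  have h := norm_sq_apply_le_inner hs hp h1 (EuclideanSpace.single i 1)
  have e : ∀ w : EuclideanSpace ℝ (Fin n), w i = inner ℝ (EuclideanSpace.single i (1 : ℝ)) w :=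
    fun w => by simp [EuclideanSpace.inner_single_left]
  rw [e, e, ContinuousLinearMap.comp_apply, ← hs, real_inner_self_eq_norm_sq]
  exact h

/-- With `u = x - v` the left side is `4‖A u‖² - 8⟪u, A u⟫ + 4⟪u, A x⟫`. By `A² ≤ A` it is at most
`4⟪u, A x⟫ - 4⟪u, A u⟫ = ⟪x, A x⟫ - ⟪x - 2u, A (x - 2u)⟫`; positivity drops the last term and `‖A‖ ≤
1` bounds the other. -/
lemma sureVarianceBound_le_norm_sq (hs : ∀ v w, inner ℝ (A v) w = inner ℝ v (A w))
    (hp : ∀ v, 0 ≤ inner ℝ v (A v)) (h1 : ‖A‖ ≤ 1) (x v : EuclideanSpace ℝ (Fin n)) :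
    4 * ‖innerSL ℝ (x - v) ∘L A‖ ^ 2 + 4 * inner ℝ (x - v) (A ((2 : ℝ) • v - x)) ≤ ‖x‖ ^ 2 := by
  set u := x - v with hu
  have e1 : innerSL ℝ u ∘L A = innerSL ℝ (A u) := by
    ext w
    simp [hs]
  have e2 : (2 : ℝ) • v - x = x - (2 : ℝ) • u := by rw [hu]; module
  have h2 := norm_sq_apply_le_inner hs hp h1 u
  have h3 := hp (x - (2 : ℝ) • u)
  have h4 : inner ℝ x (A x) ≤ ‖x‖ ^ 2 := by
    refine (real_inner_le_norm _ _).trans ?_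
    rw [sq]
    exact mul_le_mul_of_nonneg_left (A.le_of_opNorm_le h1 _ |>.trans_eq (one_mul _))
      (norm_nonneg _)
  have h5 : inner ℝ x (A u) = inner ℝ u (A x) := by rw [← hs, real_inner_comm]
  rw [e1, e2, innerSL_apply_norm]
  simp only [map_sub, map_smul, inner_sub_left, inner_sub_right, inner_smul_left,
    inner_smul_right, h5] at h3 ⊢
  simp only [conj_trivial] at h3
  linarith

/-- The norm of a symmetric endomorphism is its numerical radius, by polarisation. -/
lemma norm_le_one_of_abs_inner_le (hs : ∀ v w, inner ℝ (A v) w = inner ℝ v (A w))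
    (hq : ∀ u, ‖u‖ = 1 → |inner ℝ u (A u)| ≤ 1) : ‖A‖ ≤ 1 := by
  have hq' : ∀ u, |inner ℝ u (A u)| ≤ ‖u‖ ^ 2 := by
    intro u
    rcases eq_or_ne u 0 with rfl | hu
    · simp
    have hu' : 0 < ‖u‖ := norm_pos_iff.2 hu
    have h := hq (‖u‖⁻¹ • u) (by rw [norm_smul, norm_inv, norm_norm, inv_mul_cancel₀ hu'.ne'])
    rw [map_smul, inner_smul_left, inner_smul_right, conj_trivial, ← mul_assoc, abs_mul,
      abs_of_pos (by positivity)] at h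
    field_simp at h
    exact h
  refine A.opNorm_le_bound zero_le_one fun u => ?_
  rw [one_mul]
  rcases eq_or_ne u 0 with rfl | hu
  · simp
  rcases eq_or_ne (A u) 0 with h0 | h0
  · simp [h0]
  have hu' : 0 < ‖u‖ := norm_pos_iff.2 hu
  have ha : 0 < ‖A u‖ := norm_pos_iff.2 h0
  -- Rescaling makes `p` and `q` of equal norm, so that polarising at `p ± q` loses nothing.
  set p := ‖A u‖ • u with hp
  set q := ‖u‖ • A u with hq2
  have h1 := (abs_le.1 (hq' (p + q))).2
  have h2 := (abs_le.1 (hq' (p - q))).1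
  have e1 : inner ℝ q (A p) = ‖u‖ * ‖A u‖ * ‖A u‖ ^ 2 := by
    rw [hp, hq2, map_smul, inner_smul_left, inner_smul_right, real_inner_self_eq_norm_sq]
    simp
    ring
  have e2 : inner ℝ p (A q) = inner ℝ q (A p) := by rw [← hs, real_inner_comm]
  have e3 : ‖p‖ = ‖A u‖ * ‖u‖ := by rw [hp, norm_smul, norm_norm]
  have e4 : ‖q‖ = ‖A u‖ * ‖u‖ := by rw [hq2, norm_smul, norm_norm, mul_comm]
  rw [norm_add_sq_real] at h1
  rw [norm_sub_sq_real] at h2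
  simp only [map_add, map_sub, inner_add_left, inner_add_right, inner_sub_left, inner_sub_right,
    e2, e1, e3, e4] at h1 h2
  have h3 : ‖u‖ * ‖A u‖ * ‖A u‖ ^ 2 ≤ (‖A u‖ * ‖u‖) ^ 2 := by linarith
  have h4 : (‖u‖ * ‖A u‖ ^ 2) * ‖A u‖ ≤ (‖u‖ * ‖A u‖ ^ 2) * ‖u‖ := by linarith
  exact le_of_mul_le_mul_left h4 (by positivity)

end endomorphisms

/-! ### From gradient matrices to endomorphisms -/

section matrix

variable {n : ℕ}

/-- The endomorphism of `ℝⁿ` attached to a gradient matrix, whose columns are the gradients of the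
components: its matrix is the transpose. -/
noncomputable def gradientCLM (G : Matrix (Fin n) (Fin n) ℝ) :
    EuclideanSpace ℝ (Fin n) →L[ℝ] EuclideanSpace ℝ (Fin n) :=
  Matrix.toEuclideanCLM (n := Fin n) (𝕜 := ℝ) G.transpose

lemma gradientCLM_single (G : Matrix (Fin n) (Fin n) ℝ) (i j : Fin n) :
    gradientCLM G (EuclideanSpace.single i 1) j = G i j := by
  simp [gradientCLM]

lemma traceCLM_gradientCLM (G : Matrix (Fin n) (Fin n) ℝ) :
    traceCLM n (gradientCLM G) = G.trace := by
  simp [traceCLM_apply, gradientCLM_single, Matrix.trace]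

lemma traceCLM_gradientCLM_comp (G : Matrix (Fin n) (Fin n) ℝ) :
    traceCLM n (gradientCLM G ∘L gradientCLM G) = (G ^ 2).trace := by
  rw [← traceCLM_gradientCLM]
  congr 1
  rw [gradientCLM, gradientCLM, Matrix.transpose_pow, map_pow, sq]
  rfl

/-- The transpose in `gradientCLM` is an adjoint, which preserves the operator norm. -/
lemma norm_one_sub_gradientCLM (G : Matrix (Fin n) (Fin n) ℝ) :
    ‖1 - gradientCLM G‖ = ‖Matrix.toEuclideanCLM (n := Fin n) (𝕜 := ℝ) (1 - G)‖ := by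
  have e : 1 - gradientCLM G = star (Matrix.toEuclideanCLM (n := Fin n) (𝕜 := ℝ) (1 - G)) := by
    rw [← map_star, gradientCLM, ← map_one (Matrix.toEuclideanCLM (n := Fin n) (𝕜 := ℝ)),
      ← map_sub]
    congr 1
    rw [Matrix.star_eq_conjTranspose, Matrix.conjTranspose_sub, Matrix.conjTranspose_one,
      Matrix.conjTranspose_eq_transpose_of_trivial]
  rw [e, ContinuousLinearMap.star_eq_adjoint, LinearIsometryEquiv.norm_map]

lemma inner_toEuclideanCLM_comm {B : Matrix (Fin n) (Fin n) ℝ} (hB : B.IsSymm)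
    (v w : EuclideanSpace ℝ (Fin n)) :
    inner ℝ (Matrix.toEuclideanCLM (n := Fin n) (𝕜 := ℝ) B v) w
      = inner ℝ v (Matrix.toEuclideanCLM (n := Fin n) (𝕜 := ℝ) B w) := by
  have h : star (Matrix.toEuclideanCLM (n := Fin n) (𝕜 := ℝ) B)
      = Matrix.toEuclideanCLM (n := Fin n) (𝕜 := ℝ) B := by
    rw [← map_star, Matrix.star_eq_conjTranspose, Matrix.conjTranspose_eq_transpose_of_trivial, hB]
  conv_lhs => rw [← h]
  rw [ContinuousLinearMap.star_eq_adjoint, ContinuousLinearMap.adjoint_inner_left]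

lemma Matrix.PosSemidef.isSymm {G : Matrix (Fin n) (Fin n) ℝ} (hG : G.PosSemidef) : G.IsSymm := by
  have h := hG.isHermitian
  rwa [Matrix.IsHermitian, Matrix.conjTranspose_eq_transpose_of_trivial] at h

lemma gradientCLM_eq_of_isSymm {G : Matrix (Fin n) (Fin n) ℝ} (hG : G.IsSymm) :
    gradientCLM G = Matrix.toEuclideanCLM (n := Fin n) (𝕜 := ℝ) G := by
  rw [gradientCLM, hG]

lemma inner_gradientCLM_nonneg {G : Matrix (Fin n) (Fin n) ℝ} (hG : G.PosSemidef)
    (v : EuclideanSpace ℝ (Fin n)) : 0 ≤ inner ℝ v (gradientCLM G v) := by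
  rw [gradientCLM_eq_of_isSymm hG.isSymm, Matrix.inner_toEuclideanCLM]
  simpa using hG.dotProduct_mulVec_nonneg v.ofLp

lemma norm_one_sub_gradientCLM_le_one {G : Matrix (Fin n) (Fin n) ℝ}
    (h : ‖Matrix.toEuclideanCLM (n := Fin n) (𝕜 := ℝ) (1 - G)‖ ≤ 1 ∨
        (G.IsSymm ∧ ∀ u : EuclideanSpace ℝ (Fin n), ‖u‖ = 1 →
          |inner ℝ u (Matrix.toEuclideanCLM (n := Fin n) (𝕜 := ℝ) (1 - G) u)| ≤ 1)) :
    ‖1 - gradientCLM G‖ ≤ 1 := by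
  rw [norm_one_sub_gradientCLM]
  rcases h with h | ⟨hs, h⟩
  · exact h
  · exact norm_le_one_of_abs_inner_le (inner_toEuclideanCLM_comm (Matrix.isSymm_one.sub hs)) h

end matrix

/-! ### The residual map and its weak derivative -/

section residual

variable {n : ℕ}

lemma IsWeakPartialDeriv.comp_add_left {i : Fin n} {f g : EuclideanSpace ℝ (Fin n) → ℝ}
    (hfg : IsWeakPartialDeriv i f g) (a : EuclideanSpace ℝ (Fin n)) :
    IsWeakPartialDeriv i (fun x => f (a + x)) (fun x => g (a + x)) where
  locallyIntegrable := by
    refine (locallyIntegrable_map_homeomorph (Homeomorph.addLeft a)).1 ?_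
    simpa [map_add_left_eq_self] using hfg.locallyIntegrable
  locallyIntegrable_deriv := by
    refine (locallyIntegrable_map_homeomorph (Homeomorph.addLeft a)).1 ?_
    simpa [map_add_left_eq_self] using hfg.locallyIntegrable_deriv
  integral_eq := by
    intro φ hφ hφc
    have h := hfg.integral_eq (fun x => φ (-a + x)) (hφ.comp (contDiff_const.add contDiff_id))
      (hφc.comp_homeomorph (Homeomorph.addLeft (-a)))
    rw [← integral_add_left_eq_self _ a, ← integral_add_left_eq_self
      (fun x => g x * φ (-a + x)) a] at h
    simpa [fderiv_comp_add_left] using h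

lemma IsWeakPartialDeriv.sub {i : Fin n} {f g f' g' : EuclideanSpace ℝ (Fin n) → ℝ}
    (hfg : IsWeakPartialDeriv i f g) (hfg' : IsWeakPartialDeriv i f' g') :
    IsWeakPartialDeriv i (fun x => f x - f' x) (fun x => g x - g' x) where
  locallyIntegrable := hfg.locallyIntegrable.sub hfg'.locallyIntegrable
  locallyIntegrable_deriv := hfg.locallyIntegrable_deriv.sub hfg'.locallyIntegrable_deriv
  integral_eq := by
    intro φ hφ hφc
    have hφ' : Continuous fun x => fderiv ℝ φ x (EuclideanSpace.single i 1) :=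
      (hφ.continuous_fderiv (by simp)).clm_apply continuous_const
    have hφ'c : HasCompactSupport fun x => fderiv ℝ φ x (EuclideanSpace.single i 1) :=
      (hφc.fderiv ℝ).comp_left
        (g := fun L : EuclideanSpace ℝ (Fin n) →L[ℝ] ℝ => L (EuclideanSpace.single i 1)) (by simp)
    have i1 : ∀ {f : EuclideanSpace ℝ (Fin n) → ℝ}, LocallyIntegrable f →
        Integrable fun x => f x * fderiv ℝ φ x (EuclideanSpace.single i 1) := fun hf =>
      hf.integrable_smul_right_of_hasCompactSupport hφ' hφ'c
    have i2 : ∀ {f : EuclideanSpace ℝ (Fin n) → ℝ}, LocallyIntegrable f →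
        Integrable fun x => f x * φ x := fun hf =>
      hf.integrable_smul_right_of_hasCompactSupport hφ.continuous hφc
    simp_rw [sub_mul]
    rw [integral_sub (i1 hfg.locallyIntegrable) (i1 hfg'.locallyIntegrable),
      integral_sub (i2 hfg.locallyIntegrable_deriv) (i2 hfg'.locallyIntegrable_deriv),
      hfg.integral_eq φ hφ hφc, hfg'.integral_eq φ hφ hφc]
    ring

lemma IsWeakGradient.isWeakFDeriv
    {f : EuclideanSpace ℝ (Fin n) → EuclideanSpace ℝ (Fin n)}
    {G : EuclideanSpace ℝ (Fin n) → Matrix (Fin n) (Fin n) ℝ} (hG : IsWeakGradient f G) :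
    IsWeakFDeriv f fun x => gradientCLM (G x) := by
  intro i j
  simpa only [gradientCLM_single] using hG i j

/-- The residual `x ↦ a + x - f (a + x)` is weakly differentiable if `f` is. -/
lemma IsWeakGradient.isWeakFDeriv_residual
    {f : EuclideanSpace ℝ (Fin n) → EuclideanSpace ℝ (Fin n)}
    {G : EuclideanSpace ℝ (Fin n) → Matrix (Fin n) (Fin n) ℝ} (hG : IsWeakGradient f G)
    (a : EuclideanSpace ℝ (Fin n)) :
    IsWeakFDeriv (fun x => a + x - f (a + x)) fun x => 1 - gradientCLM (G (a + x)) := by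
  intro i j
  have hd : ∀ x, HasFDerivAt (fun x : EuclideanSpace ℝ (Fin n) => (a + x) j)
      (EuclideanSpace.proj j : EuclideanSpace ℝ (Fin n) →L[ℝ] ℝ) x := fun x =>
    (EuclideanSpace.proj j : EuclideanSpace ℝ (Fin n) →L[ℝ] ℝ).hasFDerivAt.const_add (a j)
  have hc : ContDiff ℝ 1 fun x : EuclideanSpace ℝ (Fin n) => (a + x) j :=
    contDiff_const.add (EuclideanSpace.proj j : EuclideanSpace ℝ (Fin n) →L[ℝ] ℝ).contDiff
  have h := (hc.isWeakPartialDeriv i).sub ((hG i j).comp_add_left a)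
  simp_rw [(hd _).fderiv] at h
  simpa [gradientCLM_single] using h

lemma LipschitzWith.residual_risk {f : EuclideanSpace ℝ (Fin n) → EuclideanSpace ℝ (Fin n)}
    (hf : LipschitzWith 1 f) (a : EuclideanSpace ℝ (Fin n)) :
    LipschitzWith 1 fun x => ‖f (a + x) - a‖ := by
  refine LipschitzWith.of_dist_le_mul fun x y => ?_
  have h := hf.dist_le_mul (a + x) (a + y)
  rw [dist_add_left, dist_eq_norm] at h
  rw [Real.dist_eq]
  refine (abs_norm_sub_norm_le _ _).trans ?_
  simpa using h

end residual

/-! ### Lower bound for the mean of the modified statistic -/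

section expectation

variable {n : ℕ} {σ : ℝ} {h : EuclideanSpace ℝ (Fin n) → EuclideanSpace ℝ (Fin n)}
  {D : EuclideanSpace ℝ (Fin n) → EuclideanSpace ℝ (Fin n) →L[ℝ] EuclideanSpace ℝ (Fin n)}

lemma IsWeakFDeriv.aestronglyMeasurable (hσ : 0 < σ) (hD : IsWeakFDeriv h D) :
    AEStronglyMeasurable h (isoGaussian n σ) :=
  hD.locallyIntegrable.aestronglyMeasurable.mono_ac (isoGaussian_absolutelyContinuous hσ)

lemma IsWeakFDeriv.aestronglyMeasurable_deriv (hσ : 0 < σ) (hD : IsWeakFDeriv h D) :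
    AEStronglyMeasurable D (isoGaussian n σ) :=
  hD.locallyIntegrable_deriv.aestronglyMeasurable.mono_ac (isoGaussian_absolutelyContinuous hσ)

/-- Lower bound for the expectation of `2‖h‖² - 2σ² div h + σ² n`. -/
theorem IsWeakFDeriv.le_integral (hσ : 0 < σ) (hD : IsWeakFDeriv h D)
    (hh : Integrable (fun x => ‖h x‖ ^ 2) (isoGaussian n σ))
    (hd : ∀ i, Integrable (fun x => D x (EuclideanSpace.single i 1) i) (isoGaussian n σ)) :
    σ ^ 2 * n / 2 ≤ ∫ x, (2 * ‖h x‖ ^ 2 - 2 * σ ^ 2 * traceCLM n (D x) + σ ^ 2 * n)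
      ∂(isoGaussian n σ) := by
  have hm := hD.aestronglyMeasurable hσ
  have ix : Integrable (fun x : EuclideanSpace ℝ (Fin n) => ‖x‖ ^ 2) (isoGaussian n σ) :=
    IsGaussian.integrable_of_hasTemperateGrowth _ (by fun_prop)
  have hmi : ∀ i, AEStronglyMeasurable (fun x => h x i) (isoGaussian n σ) := fun i =>
    (EuclideanSpace.proj i : EuclideanSpace ℝ (Fin n) →L[ℝ] ℝ).continuous.comp_aestronglyMeasurable hm
  have hi : ∀ i, Integrable (fun x => h x i) (isoGaussian n σ) := fun i => by
    refine ((integrable_const (1 : ℝ)).add hh).mono' (hmi i) (.of_forall fun x => ?_)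
    have := PiLp.norm_apply_le (h x) i
    simp only [Pi.add_apply]
    nlinarith [sq_nonneg (‖h x‖ - 1)]
  have hxi : ∀ i, Integrable (fun x => x i * h x i) (isoGaussian n σ) := fun i => by
    refine (ix.add hh).mono' (Continuous.aestronglyMeasurable (by fun_prop) |>.mul (hmi i))
      (.of_forall fun x => ?_)
    have h1 := PiLp.norm_apply_le (h x) i
    have h2 := PiLp.norm_apply_le x i
    rw [norm_mul]
    refine (mul_le_mul h2 h1 (norm_nonneg _) (norm_nonneg _)).trans ?_
    simp only [Pi.add_apply]
    nlinarith [sq_nonneg (‖h x‖ - ‖x‖), sq_nonneg ‖h x‖, sq_nonneg ‖x‖]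
  have itr : Integrable (fun x => traceCLM n (D x)) (isoGaussian n σ) := by
    simp_rw [traceCLM_apply]
    exact integrable_finsetSum _ fun i _ => hd i
  have iin : Integrable (fun x => inner ℝ x (h x)) (isoGaussian n σ) := by
    simp_rw [inner_eq_sum]
    exact integrable_finsetSum _ fun i _ => hxi i
  have stein : ∫ x, inner ℝ x (h x) ∂(isoGaussian n σ)
      = σ ^ 2 * ∫ x, traceCLM n (D x) ∂(isoGaussian n σ) := by
    simp_rw [inner_eq_sum, traceCLM_apply]
    rw [integral_finsetSum _ fun i _ => hxi i, integral_finsetSum _ fun i _ => hd i, Finset.mul_sum]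
    exact Finset.sum_congr rfl fun i _ =>
      (hD i i).integral_mul_isoGaussian hσ (hi i) (hxi i) (hd i)
  -- Pointwise this is `0 ≤ ½ ‖2h - x‖²`, expanded.
  have hle : ∫ x, -(1 / 2 * ‖x‖ ^ 2) ∂(isoGaussian n σ)
      ≤ ∫ x, (2 * ‖h x‖ ^ 2 - 2 * inner ℝ x (h x)) ∂(isoGaussian n σ) := by
    refine integral_mono (ix.const_mul _).neg ((hh.const_mul 2).sub (iin.const_mul 2)) fun x => ?_
    have h0 := sq_nonneg ‖(2 : ℝ) • h x - x‖
    rw [norm_sub_sq_real, norm_smul, inner_smul_left, real_inner_comm] at h0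
    simp only [Real.norm_ofNat, conj_trivial] at h0
    simp only
    linarith
  rw [integral_neg, integral_const_mul, integral_norm_sq_isoGaussian hσ,
    integral_sub (hh.const_mul 2) (iin.const_mul 2), integral_const_mul, integral_const_mul,
    stein] at hle
  rw [integral_add ((hh.const_mul 2).sub' (itr.const_mul _)) (integrable_const _),
    integral_sub (hh.const_mul 2) (itr.const_mul _), integral_const_mul, integral_const_mul,
    integral_const]
  simp only [probReal_univ, smul_eq_mul, one_mul]
  linarith

end expectation

/-! ### Minkowski's inequality for fourth moments -/

section fourthMoments

variable {Ω : Type*} [MeasurableSpace Ω] {P : Measure Ω}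

lemma memLp_four_iff_integrable_pow {f : Ω → ℝ} (hf : AEStronglyMeasurable f P) :
    MemLp f 4 P ↔ Integrable (fun ω => f ω ^ 4) P := by
  rw [← integrable_norm_rpow_iff hf (by norm_num) (by norm_num)]
  have e : ∀ ω, ‖f ω‖ ^ (4 : ℝ≥0∞).toReal = f ω ^ 4 := fun ω => by
    have h4 : (4 : ℝ≥0∞).toReal = ((4 : ℕ) : ℝ) := by norm_num
    rw [h4, Real.rpow_natCast, Real.norm_eq_abs, Even.pow_abs (by decide)]
  simp_rw [e]

lemma eLpNorm_four_eq {f : Ω → ℝ} (hf : MemLp f 4 P) :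
    eLpNorm f 4 P = ENNReal.ofReal ((∫ ω, f ω ^ 4 ∂P) ^ (1 / 4 : ℝ)) := by
  rw [hf.eLpNorm_eq_integral_rpow_norm (by norm_num) (by norm_num)]
  have h4 : (4 : ℝ≥0∞).toReal = ((4 : ℕ) : ℝ) := by norm_num
  simp_rw [h4, Real.rpow_natCast, Real.norm_eq_abs, Even.pow_abs (by decide : Even 4)]
  norm_num

lemma integral_pow_four_add_le {f g : Ω → ℝ} (hf : MemLp f 4 P) (hg : MemLp g 4 P) :
    (∫ ω, (f ω + g ω) ^ 4 ∂P) ^ (1 / 4 : ℝ)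
      ≤ (∫ ω, f ω ^ 4 ∂P) ^ (1 / 4 : ℝ) + (∫ ω, g ω ^ 4 ∂P) ^ (1 / 4 : ℝ) := by
  have hnn : ∀ u : Ω → ℝ, 0 ≤ (∫ ω, u ω ^ 4 ∂P) ^ (1 / 4 : ℝ) := fun u =>
    Real.rpow_nonneg (integral_nonneg fun ω => by positivity) _
  have h := eLpNorm_add_le hf.1 hg.1 (p := 4) (by norm_num)
  rw [eLpNorm_four_eq (hf.add hg), eLpNorm_four_eq hf, eLpNorm_four_eq hg,
    ← ENNReal.ofReal_add (hnn f) (hnn g), ENNReal.ofReal_le_ofReal_iff (add_nonneg (hnn f) (hnn g))]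
    at h
  exact h

end fourthMoments

/-! ### Extended expectations -/

section extExpectation

variable {Ω : Type*} [MeasurableSpace Ω] {P : Measure Ω}

lemma lintegral_ofReal_lt_top {X : Ω → ℝ} (hX : Integrable X P) :
    ∫⁻ ω, ENNReal.ofReal (X ω) ∂P < ∞ :=
  (lintegral_mono fun ω => Real.ofReal_le_enorm (X ω)).trans_lt hX.2

lemma extExpectation_eq_integral {X : Ω → ℝ} (hX : Integrable X P) :
    extExpectation P X = ((∫ ω, X ω ∂P : ℝ) : EReal) := by
  rw [extExpectation, integral_eq_lintegral_pos_part_sub_lintegral_neg_part hX, EReal.coe_sub,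
    EReal.coe_ennreal_toReal (lintegral_ofReal_lt_top hX).ne,
    EReal.coe_ennreal_toReal (lintegral_ofReal_lt_top hX.fun_neg).ne]

end extExpectation

/-! ### The statistics in terms of the residual, and part (i) -/

section statistics

variable {n : ℕ} {σ : ℝ} {μ : EuclideanSpace ℝ (Fin n)}
  {muhat : EuclideanSpace ℝ (Fin n) → EuclideanSpace ℝ (Fin n)}
  {G : EuclideanSpace ℝ (Fin n) → Matrix (Fin n) (Fin n) ℝ}

lemma traceCLM_one : traceCLM n 1 = n := by simp [traceCLM_apply]

lemma sureStat_add (x : EuclideanSpace ℝ (Fin n)) :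
    sureStat σ muhat G (μ + x) = ‖μ + x - muhat (μ + x)‖ ^ 2
      - 2 * σ ^ 2 * traceCLM n (1 - gradientCLM (G (μ + x))) + σ ^ 2 * n := by
  rw [map_sub, traceCLM_gradientCLM, traceCLM_one, sureStat]
  ring

lemma modifiedSureForSure_add (x : EuclideanSpace ℝ (Fin n)) :
    modifiedSureForSure σ muhat G (μ + x) = 2 * σ ^ 2 * (2 * ‖μ + x - muhat (μ + x)‖ ^ 2
      - 2 * σ ^ 2 * traceCLM n (1 - gradientCLM (G (μ + x))) + σ ^ 2 * n) := by
  rw [modifiedSureForSure, sureStat_add]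
  ring

variable {Ω : Type*} [MeasurableSpace Ω] {P : Measure Ω} {ε : Ω → EuclideanSpace ℝ (Fin n)}

lemma ProbabilityTheory.HasLaw.integrable_comp {ν : Measure (EuclideanSpace ℝ (Fin n))}
    (hε : HasLaw ε ν P) {f : EuclideanSpace ℝ (Fin n) → ℝ} (hf : Integrable f ν) :
    Integrable (fun ω => f (ε ω)) P := by
  rw [← hε.map_eq] at hf
  exact hf.comp_aemeasurable hε.aemeasurable

lemma ProbabilityTheory.HasLaw.integral_fun_comp {ν : Measure (EuclideanSpace ℝ (Fin n))}
    (hε : HasLaw ε ν P) {f : EuclideanSpace ℝ (Fin n) → ℝ} (hf : AEStronglyMeasurable f ν) :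
    ∫ ω, f (ε ω) ∂P = ∫ x, f x ∂ν :=
  hε.integral_comp hf

theorem modifiedSureForSure_expectation [IsProbabilityMeasure P] (hσ : 0 < σ)
    (hε : HasLaw ε (isoGaussian n σ) P) (hG : IsWeakGradient muhat G)
    (hint : ∀ i, Integrable (fun ω => G (μ + ε ω) i i) P) :
    (∫⁻ ω, ENNReal.ofReal (-(modifiedSureForSure σ muhat G (μ + ε ω))) ∂P) < ∞ ∧
      ((σ ^ 4 * n : ℝ) : EReal) ≤
        extExpectation P (fun ω => modifiedSureForSure σ muhat G (μ + ε ω)) := by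
  have hD := hG.isWeakFDeriv_residual μ
  set h : EuclideanSpace ℝ (Fin n) → EuclideanSpace ℝ (Fin n) :=
    fun x => μ + x - muhat (μ + x) with hh
  set D : EuclideanSpace ℝ (Fin n) → EuclideanSpace ℝ (Fin n) →L[ℝ] EuclideanSpace ℝ (Fin n) :=
    fun x => 1 - gradientCLM (G (μ + x)) with hDdef
  have hdi : ∀ x i, D x (EuclideanSpace.single i 1) i = 1 - G (μ + x) i i := fun x i => by
    simp [hDdef, gradientCLM_single]
  have hd : ∀ i, Integrable (fun x => D x (EuclideanSpace.single i 1) i) (isoGaussian n σ) := by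
    intro i
    have hm : AEStronglyMeasurable (fun x => D x (EuclideanSpace.single i 1) i)
        (isoGaussian n σ) :=
      (hD i i).locallyIntegrable_deriv.aestronglyMeasurable.mono_ac
        (isoGaussian_absolutelyContinuous hσ)
    rw [← hε.map_eq] at hm ⊢
    refine (integrable_map_measure hm hε.aemeasurable).2 ?_
    simpa only [Function.comp_def, hdi] using (integrable_const (1 : ℝ)).sub' (hint i)
  have itr : Integrable (fun x => traceCLM n (D x)) (isoGaussian n σ) := by
    simp_rw [traceCLM_apply]
    exact integrable_finsetSum _ fun i _ => hd i
  have hm := (hD.aestronglyMeasurable hσ).norm.pow 2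
  have ig : Integrable (fun x => 4 * σ ^ 4 * traceCLM n (D x) - 2 * σ ^ 4 * n)
      (isoGaussian n σ) := (itr.const_mul _).sub (integrable_const _)
  have ig' := hε.integrable_comp ig
  have eR : ∀ ω, modifiedSureForSure σ muhat G (μ + ε ω) = 4 * σ ^ 2 * ‖h (ε ω)‖ ^ 2
      - (4 * σ ^ 4 * traceCLM n (D (ε ω)) - 2 * σ ^ 4 * n) := fun ω => by
    rw [modifiedSureForSure_add]
    ring
  have hneg : (∫⁻ ω, ENNReal.ofReal (-(modifiedSureForSure σ muhat G (μ + ε ω))) ∂P) < ∞ := by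
    refine (lintegral_mono fun ω => ENNReal.ofReal_le_ofReal ?_).trans_lt
      (lintegral_ofReal_lt_top ig')
    rw [eR]
    have : 0 ≤ 4 * σ ^ 2 * ‖h (ε ω)‖ ^ 2 := by positivity
    linarith
  refine ⟨hneg, ?_⟩
  -- The trace part is integrable, so the statistic is integrable exactly when `‖h‖²` is. If it is
  -- not, the positive part has infinite integral and the extended expectation is `+∞`.
  by_cases hi : Integrable (fun x => ‖h x‖ ^ 2) (isoGaussian n σ)
  · have hle := hD.le_integral hσ hi hd
    have iT : Integrable (fun x => 2 * ‖h x‖ ^ 2 - 2 * σ ^ 2 * traceCLM n (D x) + σ ^ 2 * n)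
        (isoGaussian n σ) :=
      ((hi.const_mul 2).sub (itr.const_mul _)).add (integrable_const _)
    simp_rw [modifiedSureForSure_add]
    rw [extExpectation_eq_integral ((hε.integrable_comp iT).const_mul _), integral_const_mul,
      hε.integral_fun_comp iT.1]
    rw [EReal.coe_le_coe_iff]
    nlinarith [mul_le_mul_of_nonneg_left hle (by positivity : 0 ≤ 2 * σ ^ 2)]
  · have htop : ∫⁻ ω, ENNReal.ofReal (modifiedSureForSure σ muhat G (μ + ε ω)) ∂P = ∞ := by
      by_contra hne
      apply hi
      have hR : Integrable (fun ω => modifiedSureForSure σ muhat G (μ + ε ω)) P := by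
        have hmR : AEStronglyMeasurable (fun ω => modifiedSureForSure σ muhat G (μ + ε ω)) P := by
          simp_rw [eR]
          have hm' : AEStronglyMeasurable (fun ω => ‖h (ε ω)‖ ^ 2) P := by
            rw [← hε.map_eq] at hm
            exact hm.comp_aemeasurable hε.aemeasurable
          exact (hm'.const_mul _).sub ig'.1
        refine ⟨hmR, ?_⟩
        rw [hasFiniteIntegral_def]
        have e : ∀ ω, ‖modifiedSureForSure σ muhat G (μ + ε ω)‖ₑ
            ≤ ENNReal.ofReal (modifiedSureForSure σ muhat G (μ + ε ω))
              + ENNReal.ofReal (-(modifiedSureForSure σ muhat G (μ + ε ω))) := by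
          intro ω
          rw [← ofReal_norm, Real.norm_eq_abs]
          rcases abs_cases (modifiedSureForSure σ muhat G (μ + ε ω)) with ⟨h1, -⟩ | ⟨h1, -⟩
          · rw [h1]; exact le_self_add
          · rw [h1]; exact le_add_self
        refine (lintegral_mono e).trans_lt ?_
        rw [lintegral_add_left' hmR.aemeasurable.ennreal_ofReal]
        exact ENNReal.add_lt_top.2 ⟨lt_top_iff_ne_top.2 hne, hneg⟩
      have h4 : Integrable (fun ω => ‖h (ε ω)‖ ^ 2) P := by
        refine ((hR.add ig').const_mul (1 / (4 * σ ^ 2))).congr (.of_forall fun ω => ?_)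
        simp only [Pi.add_apply, eR]
        field_simp
        ring
      rw [← hε.map_eq] at hm ⊢
      exact (integrable_map_measure hm hε.aemeasurable).2 h4
    rw [extExpectation, htop, ← EReal.coe_ennreal_toReal hneg.ne, EReal.coe_ennreal_top,
      EReal.top_sub_coe]
    exact le_top

end statistics

/-! ### Parts (ii), (iii) and (iv) -/

section main

variable {n : ℕ} {σ : ℝ} {μ : EuclideanSpace ℝ (Fin n)}
  {muhat : EuclideanSpace ℝ (Fin n) → EuclideanSpace ℝ (Fin n)}
  {G : EuclideanSpace ℝ (Fin n) → Matrix (Fin n) (Fin n) ℝ}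
  {Ω : Type*} [MeasurableSpace Ω] {P : Measure Ω} {ε : Ω → EuclideanSpace ℝ (Fin n)}

lemma ProbabilityTheory.HasLaw.ae_comp {ν : Measure (EuclideanSpace ℝ (Fin n))}
    (hε : HasLaw ε ν P) {p : EuclideanSpace ℝ (Fin n) → Prop} (hp : ∀ᵐ x ∂ν, p x) :
    ∀ᵐ ω ∂P, p (ε ω) := by
  rw [← hε.map_eq] at hp
  exact ae_of_ae_map hε.aemeasurable hp

lemma ae_comp_add_left {p : EuclideanSpace ℝ (Fin n) → Prop} (hp : ∀ᵐ x, p x)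
    (μ : EuclideanSpace ℝ (Fin n)) : ∀ᵐ x, p (μ + x) :=
  (measurePreserving_add_left volume μ).quasiMeasurePreserving.ae hp

lemma IsWeakGradient.ae_norm_gradientCLM_le_one (hG : IsWeakGradient muhat G)
    (hl : LipschitzWith 1 muhat) (μ : EuclideanSpace ℝ (Fin n)) :
    ∀ᵐ x, ‖gradientCLM (G (μ + x))‖ ≤ 1 :=
  ae_comp_add_left (hG.isWeakFDeriv.ae_norm_le_one hl) μ

lemma IsWeakGradient.ae_norm_residual_le_two (hG : IsWeakGradient muhat G)
    (hl : LipschitzWith 1 muhat) (μ : EuclideanSpace ℝ (Fin n)) :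
    ∀ᵐ x, ‖1 - gradientCLM (G (μ + x))‖ ≤ 2 := by
  filter_upwards [hG.ae_norm_gradientCLM_le_one hl μ] with x hx
  have h1 : ‖(1 : EuclideanSpace ℝ (Fin n) →L[ℝ] EuclideanSpace ℝ (Fin n))‖ ≤ 1 :=
    ContinuousLinearMap.norm_id_le
  exact (norm_sub_le _ _).trans (by linarith)

/-- For `a, l ≥ 0`, `|a - l| ≤ a + l` gives `(a - l)² ≤ |a² - l²|`. Truncating `s` at `0` only moves
it closer to `l² ≥ 0`. -/
lemma sqrt_max_sub_pow_four_le (s : ℝ) {l : ℝ} (hl : 0 ≤ l) :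
    (Real.sqrt (max s 0) - l) ^ 4 ≤ (s - l ^ 2) ^ 2 := by
  set a := Real.sqrt (max s 0) with ha
  have ha0 : 0 ≤ a := Real.sqrt_nonneg _
  have ha2 : a ^ 2 = max s 0 := Real.sq_sqrt (le_max_right _ _)
  have h1 : (a - l) ^ 2 ≤ |a ^ 2 - l ^ 2| := by
    have e : |a ^ 2 - l ^ 2| = |a - l| * (a + l) := by
      rw [← abs_of_nonneg (add_nonneg ha0 hl), ← abs_mul]
      congr 1
      ring
    rw [e, ← sq_abs, sq]
    refine mul_le_mul_of_nonneg_left ?_ (abs_nonneg _)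
    exact abs_le.2 ⟨by linarith, by linarith⟩
  have h2 : |a ^ 2 - l ^ 2| ≤ |s - l ^ 2| := by
    rw [ha2]
    rcases le_total 0 s with hs | hs
    · rw [max_eq_left hs]
    · rw [max_eq_right hs, zero_sub, abs_neg, abs_of_nonneg (sq_nonneg l),
        abs_of_nonpos (by linarith [sq_nonneg l])]
      linarith
  calc (a - l) ^ 4 = ((a - l) ^ 2) ^ 2 := by ring
    _ ≤ |s - l ^ 2| ^ 2 := pow_le_pow_left₀ (sq_nonneg _) (h1.trans h2) 2
    _ = _ := sq_abs _

/-- A nonnegative `1`-Lipschitz function of a Gaussian vector is close to the square root of its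
second moment. -/
lemma LipschitzWith.integral_sub_sqrt_pow_four_le (hσ : 0 < σ)
    {L : EuclideanSpace ℝ (Fin n) → ℝ} (hL : LipschitzWith 1 L) (h0 : ∀ x, 0 ≤ L x) :
    Integrable (fun x => (L x - Real.sqrt (∫ x, L x ^ 2 ∂(isoGaussian n σ))) ^ 4)
      (isoGaussian n σ) ∧
    ∫ x, (L x - Real.sqrt (∫ x, L x ^ 2 ∂(isoGaussian n σ))) ^ 4 ∂(isoGaussian n σ)
      ≤ (3 * σ) ^ 4 := by
  obtain ⟨hi, hv, -⟩ := hL.integral_pow_le_isoGaussian hσ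
  set r := Real.sqrt (∫ x, L x ^ 2 ∂(isoGaussian n σ)) with hr
  have hr0 : 0 ≤ r := Real.sqrt_nonneg _
  have hr2 : r ^ 2 = ∫ x, L x ^ 2 ∂(isoGaussian n σ) :=
    Real.sq_sqrt (integral_nonneg fun x => sq_nonneg _)
  have hLr : LipschitzWith 1 fun x => L x - r :=
    LipschitzWith.of_dist_le_mul fun x y => by
      rw [dist_sub_right]; exact hL.dist_le_mul x y
  obtain ⟨hi', -, h4⟩ := hLr.integral_pow_le_isoGaussian hσ
  have i1 : Integrable L (isoGaussian n σ) := by simpa using hi 1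
  have e2 : ∫ x, (L x - r) ^ 2 ∂(isoGaussian n σ)
      = 2 * r * (r - ∫ x, L x ∂(isoGaussian n σ)) := by
    have e : ∀ x, (L x - r) ^ 2 = L x ^ 2 - 2 * r * L x + r ^ 2 := fun x => by ring
    simp_rw [e]
    rw [integral_add ((hi 2).sub' (i1.const_mul _)) (integrable_const _),
      integral_sub (hi 2) (i1.const_mul _), integral_const_mul, integral_const, ← hr2]
    simp
    ring
  set m := ∫ x, L x ∂(isoGaussian n σ) with hm
  have hm0 : 0 ≤ m := integral_nonneg h0
  have hmr : m ≤ r := by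
    have h5 : 0 ≤ ∫ x, (L x - m) ^ 2 ∂(isoGaussian n σ) := integral_nonneg fun x => sq_nonneg _
    have e : ∀ x, (L x - m) ^ 2 = L x ^ 2 - 2 * m * L x + m ^ 2 := fun x => by ring
    simp_rw [e] at h5
    rw [integral_add ((hi 2).sub' (i1.const_mul _)) (integrable_const _),
      integral_sub (hi 2) (i1.const_mul _), integral_const_mul, integral_const, ← hr2, ← hm] at h5
    simp only [probReal_univ, smul_eq_mul, one_mul] at h5
    exact le_of_sq_le_sq (by linarith) hr0
  rw [← hr2] at hv
  -- Since `m ≥ 0`, `2r(r - m) ≤ 2(r + m)(r - m) = 2(r² - m²)`, twice the variance of `L`.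
  have hle : 2 * r * (r - m) ≤ 2 * σ ^ 2 := by
    nlinarith [mul_nonneg hm0 (sub_nonneg.2 hmr)]
  have hge : 0 ≤ 2 * r * (r - m) := mul_nonneg (by positivity) (sub_nonneg.2 hmr)
  refine ⟨hi' 4, h4.trans ?_⟩
  rw [e2]
  -- The second moment of `L - r` is at most `2σ²`, so its fourth is at most `(2σ²)² + 4σ²·2σ² =
  -- 12σ⁴`, well below `(3σ)⁴`.
  have h6 := pow_le_pow_left₀ hge hle 2
  have h7 := mul_le_mul_of_nonneg_left hle (by positivity : 0 ≤ 4 * σ ^ 2)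
  have h8 : 0 ≤ σ ^ 4 := by positivity
  nlinarith

theorem sure_fourth_moment [IsProbabilityMeasure P] (hσ : 0 < σ)
    (hε : HasLaw ε (isoGaussian n σ) P) (hG : IsWeakGradient muhat G)
    (hl : LipschitzWith 1 muhat) :
    Integrable (fun ω => ‖muhat (μ + ε ω) - μ‖ ^ 2) P ∧
      Integrable (fun ω => (sureStat σ muhat G (μ + ε ω) - ‖muhat (μ + ε ω) - μ‖ ^ 2) ^ 2) P ∧
      Integrable (fun ω => (Real.sqrt (max (sureStat σ muhat G (μ + ε ω)) 0)
        - Real.sqrt (∫ ω', ‖muhat (μ + ε ω') - μ‖ ^ 2 ∂P)) ^ 4) P ∧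
      (∫ ω, (Real.sqrt (max (sureStat σ muhat G (μ + ε ω)) 0)
        - Real.sqrt (∫ ω', ‖muhat (μ + ε ω') - μ‖ ^ 2 ∂P)) ^ 4 ∂P) ^ (1 / 4 : ℝ)
        ≤ sureRisk P σ μ muhat G (fun ω => μ + ε ω) ^ (1 / 4 : ℝ) + 3 * σ := by
  obtain ⟨i1, -, i3, i4, -⟩ := (hG.isWeakFDeriv_residual μ).integral_sure_sq_sub_le hσ
    (hG.ae_norm_residual_le_two hl μ)
  have eu : ∀ x, x - (μ + x - muhat (μ + x)) = muhat (μ + x) - μ := fun x => by abel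
  simp_rw [eu] at i3 i4
  simp_rw [← sureStat_add] at i1 i4
  obtain ⟨i5, h5⟩ := (hl.residual_risk μ).integral_sub_sqrt_pow_four_le hσ fun x => norm_nonneg _
  have er := hε.integral_fun_comp i3.1
  set r := Real.sqrt (∫ x, ‖muhat (μ + x) - μ‖ ^ 2 ∂(isoGaussian n σ)) with hr
  have j1 := hε.integrable_comp i1
  have j3 := hε.integrable_comp i3
  have j4 := hε.integrable_comp i4
  have j5 := hε.integrable_comp i5
  have hLm : AEStronglyMeasurable (fun ω => ‖muhat (μ + ε ω) - μ‖) P :=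
    ((hl.residual_risk μ).continuous.measurable.comp_aemeasurable
      hε.aemeasurable).aestronglyMeasurable
  have hSm : AEStronglyMeasurable
      (fun ω => Real.sqrt (max (sureStat σ muhat G (μ + ε ω)) 0)) P :=
    (Real.continuous_sqrt.comp (continuous_id.max continuous_const)).comp_aestronglyMeasurable j1.1
  have hpt : ∀ ω, (Real.sqrt (max (sureStat σ muhat G (μ + ε ω)) 0) - ‖muhat (μ + ε ω) - μ‖) ^ 4
      ≤ (sureStat σ muhat G (μ + ε ω) - ‖muhat (μ + ε ω) - μ‖ ^ 2) ^ 2 := fun ω =>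
    sqrt_max_sub_pow_four_le _ (norm_nonneg _)
  have j6 : Integrable (fun ω => (Real.sqrt (max (sureStat σ muhat G (μ + ε ω)) 0)
      - ‖muhat (μ + ε ω) - μ‖) ^ 4) P := by
    refine j4.mono' ((hSm.sub hLm).pow 4) (.of_forall fun ω => ?_)
    rw [Real.norm_of_nonneg (by positivity)]
    exact hpt ω
  have m1 := (memLp_four_iff_integrable_pow (hSm.sub hLm)).2 j6
  have m2 := (memLp_four_iff_integrable_pow (hLm.sub aestronglyMeasurable_const)).2 j5
  have m3 := m1.add m2
  have e3 : ∀ ω, (Real.sqrt (max (sureStat σ muhat G (μ + ε ω)) 0) - ‖muhat (μ + ε ω) - μ‖)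
      + (‖muhat (μ + ε ω) - μ‖ - r) = Real.sqrt (max (sureStat σ muhat G (μ + ε ω)) 0) - r :=
    fun ω => by ring
  -- Minkowski's inequality, splitting at the realised loss: the first piece is bounded by the risk,
  -- the second by the concentration of the loss.
  have key := integral_pow_four_add_le m1 m2
  have j7 := (memLp_four_iff_integrable_pow m3.1).1 m3
  simp only [Pi.add_apply, Pi.sub_apply, ← hr, e3] at key j7
  rw [er]
  refine ⟨j3, j4, j7, key.trans (add_le_add ?_ ?_)⟩
  · exact Real.rpow_le_rpow (integral_nonneg fun ω => by positivity)
      (integral_mono j6 j4 hpt) (by norm_num)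
  · rw [hε.integral_fun_comp i5.1]
    refine (Real.rpow_le_rpow (integral_nonneg fun ω => by positivity) h5 (by norm_num)).trans_eq ?_
    have h4 : (1 / 4 : ℝ) = ((4 : ℕ) : ℝ)⁻¹ := by norm_num
    rw [h4, Real.pow_rpow_inv_natCast (by positivity) (by norm_num)]

theorem sure_variance [IsProbabilityMeasure P] (hσ : 0 < σ)
    (hε : HasLaw ε (isoGaussian n σ) P) (hG : IsWeakGradient muhat G)
    (hl : LipschitzWith 1 muhat) (hpos : ∀ᵐ x, (G x).PosSemidef) :
    (∀ᵐ ω ∂P, sureForSure σ muhat G (μ + ε ω) ≤ modifiedSureForSure σ muhat G (μ + ε ω)) ∧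
      MemLp (fun ω => sureStat σ muhat G (μ + ε ω)) 2 P ∧
      Var[fun ω => sureStat σ muhat G (μ + ε ω); P]
        = ∫ ω, (sureStat σ muhat G (μ + ε ω) - ∫ ω', ‖muhat (μ + ε ω') - μ‖ ^ 2 ∂P) ^ 2 ∂P ∧
      Var[fun ω => sureStat σ muhat G (μ + ε ω); P]
        ≤ sureRisk P σ μ muhat G (fun ω => μ + ε ω) + σ ^ 4 * n := by
  have hac := isoGaussian_absolutelyContinuous (n := n) hσ
  have hnorm := hac.ae_le (hG.ae_norm_gradientCLM_le_one hl μ)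
  have hpos' := hac.ae_le (ae_comp_add_left hpos μ)
  obtain ⟨i1, i2, i3, i4, i5, hE, hV⟩ :=
    (hG.isWeakFDeriv_residual μ).integral_sure_sq_sub_le hσ (hG.ae_norm_residual_le_two hl μ)
  -- Symmetry and positivity of the gradient enter only here, after the limit, so they need not be
  -- tracked through mollification.
  have hQ : ∫ x, (4 * ‖innerSL ℝ (x - (μ + x - muhat (μ + x)))
        ∘L (1 - (1 - gradientCLM (G (μ + x))))‖ ^ 2
      + 4 * inner ℝ (x - (μ + x - muhat (μ + x))) ((1 - (1 - gradientCLM (G (μ + x))))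
        ((2 : ℝ) • (μ + x - muhat (μ + x)) - x))) ∂(isoGaussian n σ) ≤ σ ^ 2 * n := by
    rw [← integral_norm_sq_isoGaussian hσ]
    refine integral_mono_ae i5 (IsGaussian.integrable_of_hasTemperateGrowth _ (by fun_prop)) ?_
    filter_upwards [hnorm, hpos'] with x h1 h2
    rw [sub_sub_cancel]
    refine sureVarianceBound_le_norm_sq (fun v w => ?_) (inner_gradientCLM_nonneg h2) h1 _ _
    rw [gradientCLM_eq_of_isSymm h2.isSymm]
    exact inner_toEuclideanCLM_comm h2.isSymm v w
  have eu : ∀ x, x - (μ + x - muhat (μ + x)) = muhat (μ + x) - μ := fun x => by abel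
  have hV' := hV.trans (add_le_add_right (mul_le_mul_of_nonneg_left hQ (sq_nonneg σ)) _)
  simp_rw [eu] at i3 i4 hE hV'
  simp_rw [← sureStat_add] at i1 i2 i4 hE hV'
  have j1 := hε.integrable_comp i1
  have j2 := hε.integrable_comp i2
  have hmem : MemLp (fun ω => sureStat σ muhat G (μ + ε ω)) 2 P :=
    (memLp_two_iff_integrable_sq j1.1).2 j2
  have hE' : ∫ ω, sureStat σ muhat G (μ + ε ω) ∂P = ∫ ω, ‖muhat (μ + ε ω) - μ‖ ^ 2 ∂P := by
    rw [hε.integral_fun_comp i1.1, hε.integral_fun_comp i3.1, hE]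
  refine ⟨?_, hmem, ?_, ?_⟩
  · refine hε.ae_comp (p := fun x => sureForSure σ muhat G (μ + x)
      ≤ modifiedSureForSure σ muhat G (μ + x)) ?_
    filter_upwards [hnorm, hpos'] with x h1 h2
    have h3 : traceCLM n (gradientCLM (G (μ + x)) ∘L gradientCLM (G (μ + x)))
        ≤ traceCLM n (gradientCLM (G (μ + x))) := by
      refine traceCLM_comp_self_le (fun v w => ?_) (inner_gradientCLM_nonneg h2) h1
      rw [gradientCLM_eq_of_isSymm h2.isSymm]
      exact inner_toEuclideanCLM_comm h2.isSymm v w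
    rw [traceCLM_gradientCLM_comp, traceCLM_gradientCLM] at h3
    have h4 := mul_le_mul_of_nonneg_left h3 (by positivity : 0 ≤ 4 * σ ^ 4)
    rw [sureForSure, modifiedSureForSure, sureStat]
    linarith
  · rw [variance_eq_integral j1.1.aemeasurable, hE']
  · rw [variance_eq_sub hmem]
    simp only [Pi.pow_apply]
    rw [hE', hε.integral_fun_comp i2.1, hε.integral_fun_comp i3.1, sureRisk,
      hε.integral_fun_comp i4.1]
    refine hV'.trans_eq ?_
    ring

/-- An almost sure bound on the residual gradient holds Lebesgue almost everywhere. -/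
lemma IsWeakGradient.ae_norm_residual_le_one (hσ : 0 < σ)
    (hε : HasLaw ε (isoGaussian n σ) P) (hG : IsWeakGradient muhat G)
    (h1 : ∀ᵐ ω ∂P, ‖1 - gradientCLM (G (μ + ε ω))‖ ≤ 1) :
    ∀ᵐ x, ‖1 - gradientCLM (G (μ + x))‖ ≤ 1 := by
  -- A measurable representative of the norm is needed to transfer the almost sure bound to the law
  -- of the noise; the everywhere positive density then carries it to Lebesgue measure.
  obtain ⟨g, hg, he⟩ := ((hG.isWeakFDeriv_residual μ).aestronglyMeasurable_deriv hσ).norm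
  have h2 : ∀ᵐ ω ∂P, g (ε ω) ≤ 1 := by
    filter_upwards [h1, hε.ae_comp he] with ω hω hω'
    rw [← hω']
    exact hω
  have h3 : ∀ᵐ x ∂(isoGaussian n σ), g x ≤ 1 := by
    rw [← hε.map_eq, ae_map_iff hε.aemeasurable
      (measurableSet_le hg.measurable measurable_const)]
    exact h2
  refine (absolutelyContinuous_isoGaussian hσ).ae_le ?_
  filter_upwards [h3, he] with x hx hx'
  rw [hx']
  exact hx

theorem modifiedSureForSure_relative_variance [IsProbabilityMeasure P] (hn : 0 < n) (hσ : 0 < σ)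
    (hε : HasLaw ε (isoGaussian n σ) P) (hG : IsWeakGradient muhat G)
    (h1 : ∀ᵐ ω ∂P, ‖1 - gradientCLM (G (μ + ε ω))‖ ≤ 1) :
    MemLp (fun ω => modifiedSureForSure σ muhat G (μ + ε ω)) 2 P ∧
      ∫ ω, (modifiedSureForSure σ muhat G (μ + ε ω)
          / (∫ ω', modifiedSureForSure σ muhat G (μ + ε ω') ∂P) - 1) ^ 2 ∂P
        ≤ 16 * σ ^ 4 / ∫ ω', modifiedSureForSure σ muhat G (μ + ε ω') ∂P ∧
      16 * σ ^ 4 / (∫ ω', modifiedSureForSure σ muhat G (μ + ε ω') ∂P) ≤ 16 / (n : ℝ) := by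
  have hD := hG.isWeakFDeriv_residual μ
  have hM := hG.ae_norm_residual_le_one hσ hε h1
  obtain ⟨i1, i2, hV⟩ := hD.integral_sq_sub_le hσ hM
  obtain ⟨i3, -⟩ := (IsTame.vector (n := n) (M := 1)).norm.sq.tendsto_integral_mollify hσ hD hM
  have i4 : ∀ i, Integrable (fun x => (1 - gradientCLM (G (μ + x))) (EuclideanSpace.single i 1) i)
      (isoGaussian n σ) := fun i =>
    ((IsTame.endo (n := n) (M := 1)).clm
      ((EuclideanSpace.proj i : EuclideanSpace ℝ (Fin n) →L[ℝ] ℝ) ∘L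
        ContinuousLinearMap.apply ℝ (EuclideanSpace ℝ (Fin n))
          (EuclideanSpace.single i (1 : ℝ)))).tendsto_integral_mollify hσ hD hM |>.1
  have hle := hD.le_integral hσ i3 i4
  set T : EuclideanSpace ℝ (Fin n) → ℝ := fun x => 2 * ‖μ + x - muhat (μ + x)‖ ^ 2
      - 2 * σ ^ 2 * traceCLM n (1 - gradientCLM (G (μ + x))) + σ ^ 2 * n with hT
  have j1 := hε.integrable_comp i1
  have j2 := hε.integrable_comp i2
  have e1 := hε.integral_fun_comp i1.1
  have e2 := hε.integral_fun_comp i2.1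
  have eR : ∀ ω, modifiedSureForSure σ muhat G (μ + ε ω) = 2 * σ ^ 2 * T (ε ω) := fun ω =>
    modifiedSureForSure_add (ε ω)
  simp_rw [eR]
  rw [integral_const_mul]
  change Integrable (fun ω => T (ε ω)) P at j1
  change Integrable (fun ω => T (ε ω) ^ 2) P at j2
  change ∫ ω, T (ε ω) ∂P = _ at e1
  change ∫ ω, T (ε ω) ^ 2 ∂P = _ at e2
  rw [e1]
  set m := ∫ x, T x ∂(isoGaussian n σ) with hm
  have hn' : (0 : ℝ) < n := Nat.cast_pos.2 hn
  have hs : 0 < 2 * σ ^ 2 := by positivity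
  have hmpos : 0 < m := lt_of_lt_of_le (by positivity) hle
  have hT2 : MemLp (fun ω => T (ε ω)) 2 P := (memLp_two_iff_integrable_sq j1.1).2 j2
  refine ⟨hT2.const_mul (2 * σ ^ 2), ?_, ?_⟩
  · have e : ∀ ω, (2 * σ ^ 2 * T (ε ω) / (2 * σ ^ 2 * m) - 1) ^ 2
        = (1 / m ^ 2) * (T (ε ω) ^ 2 - 2 * m * T (ε ω) + m ^ 2) := fun ω => by
      field_simp
      ring
    simp_rw [e]
    rw [integral_const_mul, integral_add (j2.sub' (j1.const_mul _)) (integrable_const _),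
      integral_sub j2 (j1.const_mul _), integral_const_mul, e1, e2, integral_const]
    simp only [probReal_univ, smul_eq_mul, one_mul]
    -- Dividing `Var T ≤ 8σ² m` by `m²` gives `8σ² / m = 16σ⁴ / (2σ² m)`, where `2σ² m` is the mean
    -- of the modified statistic.
    have h2 : ∫ x, T x ^ 2 ∂(isoGaussian n σ) - 2 * m * m + m ^ 2 ≤ 8 * σ ^ 2 * m := by
      linarith
    refine (mul_le_mul_of_nonneg_left h2 (by positivity)).trans_eq ?_
    field_simp
    ring
  -- Here `m ≥ σ² n / 2`, that is, the mean of the modified statistic is at least `σ⁴ n`.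
  · rw [div_le_div_iff₀ (by positivity) hn']
    nlinarith [mul_le_mul_of_nonneg_left hle (by positivity : 0 ≤ 32 * σ ^ 2)]

end main

theorem mainTheorem4 {n : ℕ} (hn : 0 < n) {Ω : Type*} [MeasurableSpace Ω]
    (P : Measure Ω) [IsProbabilityMeasure P] (σ : ℝ) (hσ : 0 < σ)
    (μ : EuclideanSpace ℝ (Fin n)) (ε y : Ω → EuclideanSpace ℝ (Fin n))
    (hε : HasLaw ε (multivariateGaussian 0 (σ ^ 2 • (1 : Matrix (Fin n) (Fin n) ℝ))) P)
    (hy : ∀ ω, y ω = μ + ε ω)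
    (muhat : EuclideanSpace ℝ (Fin n) → EuclideanSpace ℝ (Fin n))
    (G : EuclideanSpace ℝ (Fin n) → Matrix (Fin n) (Fin n) ℝ)
    (hG : IsWeakGradient muhat G) :
    -- (i)
    ((∀ i, Integrable (fun ω => G (y ω) i i) P) →
      (∫⁻ ω, ENNReal.ofReal (-(modifiedSureForSure σ muhat G (y ω))) ∂P) < ∞ ∧
      ((σ ^ 4 * n : ℝ) : EReal) ≤
        extExpectation P (fun ω => modifiedSureForSure σ muhat G (y ω))) ∧
    -- (ii)
    (LipschitzWith 1 muhat →
      Integrable (fun ω => ‖muhat (y ω) - μ‖ ^ 2) P ∧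
      Integrable (fun ω => (sureStat σ muhat G (y ω) - ‖muhat (y ω) - μ‖ ^ 2) ^ 2) P ∧
      Integrable (fun ω => (Real.sqrt (max (sureStat σ muhat G (y ω)) 0)
        - Real.sqrt (∫ ω', ‖muhat (y ω') - μ‖ ^ 2 ∂P)) ^ 4) P ∧
      (∫ ω, (Real.sqrt (max (sureStat σ muhat G (y ω)) 0)
        - Real.sqrt (∫ ω', ‖muhat (y ω') - μ‖ ^ 2 ∂P)) ^ 4 ∂P) ^ (1 / 4 : ℝ)
        ≤ sureRisk P σ μ muhat G y ^ (1 / 4 : ℝ) + 3 * σ) ∧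
    -- (iii)
    (LipschitzWith 1 muhat → (∀ᵐ x, (G x).PosSemidef) →
      (∀ᵐ ω ∂P, sureForSure σ muhat G (y ω) ≤ modifiedSureForSure σ muhat G (y ω)) ∧
      MemLp (fun ω => sureStat σ muhat G (y ω)) 2 P ∧
      Var[fun ω => sureStat σ muhat G (y ω); P]
        = ∫ ω, (sureStat σ muhat G (y ω) - ∫ ω', ‖muhat (y ω') - μ‖ ^ 2 ∂P) ^ 2 ∂P ∧
      Var[fun ω => sureStat σ muhat G (y ω); P]
        ≤ sureRisk P σ μ muhat G y + σ ^ 4 * n) ∧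
    -- (iv)
    ((∀ᵐ ω ∂P, sureForSure σ muhat G (y ω) ≤ modifiedSureForSure σ muhat G (y ω)) →
      (∀ᵐ ω ∂P,
        ‖Matrix.toEuclideanCLM (n := Fin n) (𝕜 := ℝ) (1 - G (y ω))‖ ≤ 1 ∨
        ((G (y ω)).IsSymm ∧ ∀ u : EuclideanSpace ℝ (Fin n), ‖u‖ = 1 →
          |inner ℝ u (Matrix.toEuclideanCLM (n := Fin n) (𝕜 := ℝ) (1 - G (y ω)) u)| ≤ 1)) →
      MemLp (fun ω => modifiedSureForSure σ muhat G (y ω)) 2 P ∧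
      ∫ ω, (modifiedSureForSure σ muhat G (y ω)
          / (∫ ω', modifiedSureForSure σ muhat G (y ω') ∂P) - 1) ^ 2 ∂P
        ≤ 16 * σ ^ 4 / ∫ ω', modifiedSureForSure σ muhat G (y ω') ∂P ∧
      16 * σ ^ 4 / (∫ ω', modifiedSureForSure σ muhat G (y ω') ∂P) ≤ 16 / (n : ℝ)) := by
  obtain rfl : y = fun ω => μ + ε ω := funext hy
  refine ⟨fun h => modifiedSureForSure_expectation hσ hε hG h,
    fun h => sure_fourth_moment hσ hε hG h, fun h h' => sure_variance hσ hε hG h h',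
    fun _ h => modifiedSureForSure_relative_variance hn hσ hε hG ?_⟩
  filter_upwards [h] with ω hω
  exact norm_one_sub_gradientCLM_le_one hω
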